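/- **Theorem.** There are absolute constants $c>0$, $K,M,D,\Delta\in\mathbb N$ with $D\ge 1$, $\alpha>0$, $\beta>3/4$, and two fixed programs (a sequential and a parallel decoder) such that the following holds for all integers $n_0>1$, $N>1$ with $n_0\mid N$. Write $B=N/n_0$. Let $H_0=[\,I_{n_0-1}\mid \mathbf 1\,]$ and $G_0=(1\,1\cdots 1)$ be the parity check and generator matrices of the binary repetition code of length $n_0$, and let $H_1=I_B\otimes H_0$, $G_1=I_B\otimes G_0$ (the inner code, a direct sum of $B$ repetition codes). There are integers $m,k,d$ and a matrix $H_2\in\mathbb F_2^{m\times B}$, the parity check matrix of the outer code $C_2=\ker H_2$, such that: 1. *(Outer code.)* $C_2$ has dimension $k\ge cB$ and minimum distance at least $d\ge cB$. If $B\ge M$, then $C_2$ is an expander code: in the Tanner graph of $H_2$ every variable (column) has degree exactly $D$, every check (row) has degree at most $\Delta$, and every set $S$ of at most $\alpha B$ variables has at least $\beta D|S|$ neighbouring checks. 2. *(Quantum code.)* Put $\mathscr H_X=H_2G_1$, $\mathscr H_Z=H_1$, $\mathscr C_X=\ker\mathscr H_X$, $\mathscr C_Z=\ker\mathscr H_Z$.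 Then $\mathscr H_X\mathscr H_Z^{T}=0$, and the partially concatenated CSS code $\mathscr A\subseteq(\mathbb C^2)^{\otimes N}$ stabilized by $X(a)$ for the rows $a$ of $\mathscr H_X$ and $Z(b)$ for the rows $b$ of $\mathscr H_Z$ has dimension $2^k$ and distances $$d_Z=\mathrm{wt}_H(\mathscr C_X\setminus\mathscr C_Z^\perp)\ge d\ge cN/n_0,\qquad d_X=\mathrm{wt}_H(\mathscr C_Z\setminus\mathscr C_X^\perp)\ge n_0,$$ where $\mathrm{wt}_H(S)$ is the least Hamming weight of an element of $S$. That is, $\mathscr A=[[N,\Omega(N/n_0),d_Z\ge\Omega(N/n_0)/d_X\ge n_0]]$. 3. *(Syndrome decoding.)* Given the syndromes $\mathscr H_Xe_Z^T$ and $\mathscr H_Ze_X^T$ of a $Z$-error $e_Z$ and an $X$-error $e_X$, the sequential program outputs $\tilde e_Z,\tilde e_X$ with $e_Z+\tilde e_Z\in\mathscr C_Z^\perp$ whenever $\mathrm{wt}_H(e_Z)\le\lfloor (d-1)/2\rfloor$, and $e_X+\tilde e_X\in\mathscr C_X^\perp$ whenever $\mathrm{wt}_H(e_X)\le\lfloor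 (n_0-1)/2\rfloor$. For all errors it halts after at most $KN$ steps of a random access machine with one processor. The parallel program has the same input and output and halts after at most $K(\log(N/n_0)+n_0)$ steps of a synchronous parallel random access machine (concurrent reads, exclusive writes) with at most $K\bigl(N/n_0+(N/n_0)\log(N/n_0)\bigr)$ processors. The words and addresses that the programs write are at most $KN$, and besides the syndromes the memory initially contains a table of at most $KN$ words, each at most $KN$, that depends only on the code. 4. *(Encoding.)* There is a circuit of Hadamard and C-NOT gates on the $N$ qubits, of size at most $K\bigl((N/n_0)^2+N\bigr)$ and depth at most $K(N/n_0+n_0)$, that maps the states $|\psi\rangle\otimes|0\cdots0\rangle$, with $|\psi\rangle$ an arbitrary state of some $k$ of the qubits, onto $\mathscr A$. -/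

import Mathlib

namespace PCCSS

open scoped Kronecker

/-! ### Binary linear codes -/

/-- The binary linear code with parity check matrix `H`. -/
def codeOf {ρ ι : Type*} [Fintype ι] (H : Matrix ρ ι (ZMod 2)) : Submodule (ZMod 2) (ι → ZMod 2) :=
  LinearMap.ker H.mulVecLin

/-- The dual code `C^⊥`. -/
def dualCode {ι : Type*} [Fintype ι] (C : Submodule (ZMod 2) (ι → ZMod 2)) :
    Submodule (ZMod 2) (ι → ZMod 2) where
  carrier := {v | ∀ w ∈ C, w ⬝ᵥ v = 0}
  add_mem' := by
    intro a b ha hb w hw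
    rw [dotProduct_add, ha w hw, hb w hw, add_zero]
  zero_mem' := by
    intro w _
    exact dotProduct_zero w
  smul_mem' := by
    intro r a ha w hw
    rw [dotProduct_smul, ha w hw, smul_zero]

/-- `wt_H(C ∖ D)`: the least Hamming weight of a vector of `C` outside `D`
(it is `0` if there is no such vector). -/
noncomputable def minWeightOutside {ι : Type*} [Fintype ι]
    (C D : Submodule (ZMod 2) (ι → ZMod 2)) : ℕ :=
  sInf {w | ∃ v ∈ C, v ∉ D ∧ hammingNorm v = w}

/-- The Tanner graph of the parity check matrix `H` (variables = columns, checks = rows) is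
`D`-regular on the variable side, has check degrees at most `Δ`, and every set `S` of at most
`α n` variables has at least `β D |S|` neighbouring checks. -/
structure IsExpanderCheckMatrix {m n : ℕ} (H : Matrix (Fin m) (Fin n) (ZMod 2))
    (D Δ : ℕ) (α β : ℝ) : Prop where
  variableDegree : ∀ j, (Finset.univ.filter fun i => H i j ≠ 0).card = D
  checkDegree : ∀ i, (Finset.univ.filter fun j => H i j ≠ 0).card ≤ Δ
  expansion : ∀ S : Finset (Fin n), (S.card : ℝ) ≤ α * n →
    β * D * S.card ≤ ((S.biUnion fun j => Finset.univ.filter fun i => H i j ≠ 0).card : ℝ)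

/-! ### Partial concatenation with a direct sum of repetition codes -/

/-- Parity check matrix `[I | 1]` of the binary repetition code of length `n`. -/
def repCheck (n : ℕ) : Matrix (Fin (n - 1)) (Fin n) (ZMod 2) :=
  Matrix.of fun i j => if j.val = i.val ∨ j.val = n - 1 then 1 else 0

/-- Generator matrix `(1 1 … 1)` of the binary repetition code of length `n`. -/
def repGen (n : ℕ) : Matrix (Fin 1) (Fin n) (ZMod 2) :=
  Matrix.of fun _ _ => 1

/-- Parity check matrix `I_B ⊗ H₀` of the direct sum of `B` repetition codes of length `n`. -/
def innerCheck (B n : ℕ) : Matrix (Fin B × Fin (n - 1)) (Fin B × Fin n) (ZMod 2) :=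
  (1 : Matrix (Fin B) (Fin B) (ZMod 2)) ⊗ₖ repCheck n

/-- Generator matrix `I_B ⊗ G₀` of the direct sum of `B` repetition codes of length `n`. -/
def innerGen (B n : ℕ) : Matrix (Fin B) (Fin B × Fin n) (ZMod 2) :=
  ((1 : Matrix (Fin B) (Fin B) (ZMod 2)) ⊗ₖ repGen n).submatrix (fun b => (b, 0)) id

/-- The `X`-stabilizer matrix `H₂ G₁` of the PC-CSS code with outer parity check matrix `H₂`. -/
def pcX {m B : ℕ} (n : ℕ) (H₂ : Matrix (Fin m) (Fin B) (ZMod 2)) :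
    Matrix (Fin m) (Fin B × Fin n) (ZMod 2) :=
  H₂ * innerGen B n

/-! ### Quantum CSS codes: states are functions on the computational basis `𝔽₂^ι` -/

/-- `X(u) |a⟩ = |a + u⟩`. -/
def pauliX {ι : Type*} (u : ι → ZMod 2) :
    ((ι → ZMod 2) → ℂ) →ₗ[ℂ] ((ι → ZMod 2) → ℂ) where
  toFun ψ x := ψ (x - u)
  map_add' _ _ := rfl
  map_smul' _ _ := rfl

/-- `Z(v) |a⟩ = (-1)^{v·a} |a⟩`. -/
def pauliZ {ι : Type*} [Fintype ι] (v : ι → ZMod 2) :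
    ((ι → ZMod 2) → ℂ) →ₗ[ℂ] ((ι → ZMod 2) → ℂ) where
  toFun ψ x := (-1) ^ (v ⬝ᵥ x).val * ψ x
  map_add' ψ φ := by
    funext x
    simp [mul_add]
  map_smul' r ψ := by
    funext x
    simp [mul_left_comm]

/-- The stabilizer code whose stabilizer generators are `X(a)` for the rows `a` of `HX` and `Z(b)`
for the rows `b` of `HZ`. -/
def cssSpace {ρ σ ι : Type*} [Fintype ι] (HX : Matrix ρ ι (ZMod 2)) (HZ : Matrix σ ι (ZMod 2)) :
    Submodule ℂ ((ι → ZMod 2) → ℂ) where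
  carrier := {ψ | (∀ i, pauliX (HX i) ψ = ψ) ∧ ∀ i, pauliZ (HZ i) ψ = ψ}
  add_mem' := by
    rintro a b ⟨ha, ha'⟩ ⟨hb, hb'⟩
    exact ⟨fun i => by rw [map_add, ha, hb], fun i => by rw [map_add, ha', hb']⟩
  zero_mem' := ⟨fun i => map_zero _, fun i => map_zero _⟩
  smul_mem' := by
    rintro r a ⟨ha, ha'⟩
    exact ⟨fun i => by rw [map_smul, ha], fun i => by rw [map_smul, ha']⟩

/-! ### Quantum circuits of Hadamard and C-NOT gates -/

inductive Gate (ι : Type*) where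
  | had (i : ι)
  | cnot (control target : ι) (h : control ≠ target)

namespace Gate

variable {ι : Type*} [DecidableEq ι]

/-- The qubits on which a gate acts. -/
def support : Gate ι → Finset ι
  | had i => {i}
  | cnot i j _ => {i, j}

/-- The unitary operator of a gate. -/
noncomputable def op : Gate ι → (((ι → ZMod 2) → ℂ) →ₗ[ℂ] ((ι → ZMod 2) → ℂ))
  | had i =>
    { toFun := fun ψ x => ((√2 : ℝ) : ℂ)⁻¹ *
        (ψ (Function.update x i 0) + (-1) ^ (x i).val * ψ (Function.update x i 1))
      map_add' := by
        intro ψ φ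
        funext x
        simp only [Pi.add_apply]
        ring
      map_smul' := by
        intro r ψ
        funext x
        simp only [Pi.smul_apply, smul_eq_mul, RingHom.id_apply]
        ring }
  | cnot i j _ =>
    { toFun := fun ψ x => ψ (Function.update x j (x j + x i))
      map_add' := fun _ _ => rfl
      map_smul' := fun _ _ => rfl }

end Gate

/-- A circuit: a list of layers, executed from left to right; the gates of one layer act on
pairwise disjoint sets of qubits. -/
structure Circuit (ι : Type*) [DecidableEq ι] where
  layers : List (List (Gate ι))
  disjoint : ∀ L ∈ layers, L.Pairwise fun g h => Disjoint g.support h.support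

namespace Circuit

variable {ι : Type*} [DecidableEq ι]

def depth (C : Circuit ι) : ℕ := C.layers.length

/-- The number of gates. -/
def size (C : Circuit ι) : ℕ := C.layers.flatten.length

/-- The unitary operator of a circuit (the first gate is applied first). -/
noncomputable def op (C : Circuit ι) : ((ι → ZMod 2) → ℂ) →ₗ[ℂ] ((ι → ZMod 2) → ℂ) :=
  C.layers.flatten.foldl (fun U g => g.op ∘ₗ U) LinearMap.id

end Circuit

/-- The states `|ψ⟩ ⊗ |0 … 0⟩` with an arbitrary state `|ψ⟩` on the qubits `inp i`, and all other
qubits in state `|0⟩`. -/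
def inputSpace {ι : Type*} {k : ℕ} (inp : Fin k ↪ ι) : Submodule ℂ ((ι → ZMod 2) → ℂ) where
  carrier := {ψ | ∀ x : ι → ZMod 2, (∃ i, i ∉ Set.range inp ∧ x i ≠ 0) → ψ x = 0}
  add_mem' := by
    intro a b ha hb x hx
    rw [Pi.add_apply, ha x hx, hb x hx, add_zero]
  zero_mem' := fun _ _ => rfl
  smul_mem' := by
    intro r a ha x hx
    rw [Pi.smul_apply, ha x hx, smul_zero]

/-- The circuit `C` encodes `k` qubits into the code space `Q`, without further ancillas. -/
def Circuit.Encodes {ι : Type*} [DecidableEq ι] (C : Circuit ι) (k : ℕ)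
    (Q : Submodule ℂ ((ι → ZMod 2) → ℂ)) : Prop :=
  ∃ inp : Fin k ↪ ι, (inputSpace inp).map C.op = Q

/-! ### Classical machine: a synchronous random access machine with exclusive writes

The shared memory consists of arrays of natural numbers. In one parallel step, every processor
`p` below a given number evaluates a fixed guard, address and value in the memory before the step
and, if the guard is nonzero, writes the value; different processors must write to
different cells. With a single processor this is an ordinary random access machine. -/

/-- Cell `i` of array `a` is `s a i`. -/
abbrev Mem := ℕ → ℕ → ℕ

inductive Expr where
  | const (n : ℕ)
  | pid
  | read (a : ℕ) (i : Expr)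
  | add (e f : Expr)
  | sub (e f : Expr)
  | mul (e f : Expr)
  | lt (e f : Expr)

/-- Value of an expression in memory `s` for processor number `p`; subtraction is truncated and
a comparison yields `1` (true) or `0` (false). -/
def Expr.eval (s : Mem) (p : ℕ) : Expr → ℕ
  | const n => n
  | pid => p
  | read a i => s a (i.eval s p)
  | add e f => e.eval s p + f.eval s p
  | sub e f => e.eval s p - f.eval s p
  | mul e f => e.eval s p * f.eval s p
  | lt e f => if e.eval s p < f.eval s p then 1 else 0

inductive Cmd where
  | skip
  /-- For all `p < count` in parallel: if `guard ≠ 0` then `a[addr] := val`. -/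
  | par (count guard : Expr) (a : ℕ) (addr val : Expr)
  | seq (c d : Cmd)
  | ite (e : Expr) (c d : Cmd)
  | loop (e : Expr) (c : Cmd)

/-- Processor `p` is active in a parallel step. -/
def Active (count guard : Expr) (s : Mem) (p : ℕ) : Prop :=
  p < count.eval s 0 ∧ guard.eval s p ≠ 0

/-- `Exec W P c s t s'`: started in memory `s`, the command `c` halts after `t` steps in memory
`s'`, uses at most `P` processors at any time, and all written values and addresses are
at most `W`. Programs are fixed objects, so a step evaluates expressions of bounded size. -/
inductive Exec (W P : ℕ) : Cmd → Mem → ℕ → Mem → Prop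
  | skip (s : Mem) : Exec W P Cmd.skip s 1 s
  | par (count guard : Expr) (a : ℕ) (addr val : Expr) (s s' : Mem)
      (procs : count.eval s 0 ≤ P)
      (word : ∀ p, Active count guard s p → addr.eval s p ≤ W ∧ val.eval s p ≤ W)
      (exclusive : ∀ p q, Active count guard s p → Active count guard s q →
        addr.eval s p = addr.eval s q → p = q)
      (written : ∀ p, Active count guard s p → s' a (addr.eval s p) = val.eval s p)
      (unchanged : ∀ b i, (¬ ∃ p, Active count guard s p ∧ b = a ∧ i = addr.eval s p) →
        s' b i = s b i) :
      Exec W P (Cmd.par count guard a addr val) s 1 s'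
  | seq (c d : Cmd) (s s' s'' : Mem) (t t' : ℕ) :
      Exec W P c s t s' → Exec W P d s' t' s'' → Exec W P (Cmd.seq c d) s (t + t') s''
  | iteTrue (e : Expr) (c d : Cmd) (s s' : Mem) (t : ℕ) :
      e.eval s 0 ≠ 0 → Exec W P c s t s' → Exec W P (Cmd.ite e c d) s (t + 1) s'
  | iteFalse (e : Expr) (c d : Cmd) (s s' : Mem) (t : ℕ) :
      e.eval s 0 = 0 → Exec W P d s t s' → Exec W P (Cmd.ite e c d) s (t + 1) s'
  | loopDone (e : Expr) (c : Cmd) (s : Mem) :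
      e.eval s 0 = 0 → Exec W P (Cmd.loop e c) s 1 s
  | loopStep (e : Expr) (c : Cmd) (s s' s'' : Mem) (t t' : ℕ) :
      e.eval s 0 ≠ 0 → Exec W P c s t s' → Exec W P (Cmd.loop e c) s' t' s'' →
      Exec W P (Cmd.loop e c) s (t + t' + 1) s''

/-! ### Syndrome decoding -/

/-- A bit vector as the contents of an array. -/
def bitArray {n : ℕ} (f : Fin n → ZMod 2) (i : ℕ) : ℕ :=
  if h : i < n then (f ⟨i, h⟩).val else 0

/-- A doubly indexed bit vector as the contents of an array; entry `(b, j)` is in cell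
`b * n + j`. -/
def bitArray₂ {B n : ℕ} (f : Fin B × Fin n → ZMod 2) : ℕ → ℕ :=
  bitArray fun i : Fin (B * n) => f (finProdFinEquiv.symm i)

/-- Initial memory: array `0` holds a precomputed table describing the code, arrays `1` and `2`
hold the two syndromes, everything else is zero. -/
def initMem (table : List ℕ) (s₁ s₂ : ℕ → ℕ) : Mem := fun a i =>
  if a = 0 then table.getD i 0 else if a = 1 then s₁ i else if a = 2 then s₂ i else 0

/-- The error read off from array `a` of the final memory. -/
def output {B n : ℕ} (s : Mem) (a : ℕ) : Fin B × Fin n → ZMod 2 :=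
  fun q => (s a (q.1.val * n + q.2.val) : ZMod 2)

/-- The program `prog` is a syndrome decoder for the PC-CSS code with outer parity check matrix
`H₂` and `B` repetition blocks of length `n`, correcting (up to stabilizers) every `Z`-error of
weight at most `tZ` and every `X`-error of weight at most `tX`. On the syndromes of
arbitrary errors it halts within time `T`, using at most `P` processors and words of size at most
`W`; the table depends on the code only and has at most `W` entries, each at most `W`. The estimated
`Z`- and `X`-errors are left in the arrays `3` and `4`. -/
def DecodesWithin {m B : ℕ} (n : ℕ) (H₂ : Matrix (Fin m) (Fin B) (ZMod 2)) (prog : Cmd)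
    (tZ tX W : ℕ) (T P : ℝ) : Prop :=
  ∃ table : List ℕ, table.length ≤ W ∧ (∀ a ∈ table, a ≤ W) ∧
    ∀ eZ eX : Fin B × Fin n → ZMod 2, ∃ (p t : ℕ) (s : Mem), (p : ℝ) ≤ P ∧ (t : ℝ) ≤ T ∧
      Exec W p prog
        (initMem table (bitArray ((pcX n H₂).mulVec eZ)) (bitArray₂ ((innerCheck B n).mulVec eX)))
        t s ∧
      (hammingNorm eZ ≤ tZ → eZ + output s 3 ∈ dualCode (codeOf (innerCheck B n))) ∧
      (hammingNorm eX ≤ tX → eX + output s 4 ∈ dualCode (codeOf (pcX n H₂)))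

end PCCSS

namespace PCCSS

open Finset

/-! ### Existence of expander codes -/

/-! The quantum code is reduced to the outer code by one adjointness: the rows of `pcX` are the
images under `rep` of the rows of `H₂`, and `rep_dotProduct` turns repetition into `blockParity`.
Hence `𝒞_Z` is the set of block-constant vectors, its dual the set of vectors with vanishing block
parities, and `𝒞_X` the set of vectors whose block parities lie in `C₂`. Up to stabilizers a
`Z`-error is just its vector of block parities, which is no heavier, so `d_Z ≥ d`. An undetected
nontrivial `X`-error fills a whole block, so `d_X ≥ n₀`.

The outer code comes from counting. Some graph with left degree 32 expands all small sets by the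
factor 30 (`exists_expanding_map`); splitting its right vertices bounds the check degrees by 128
while keeping at most `B / 2` checks (`exists_expander_code`). Expansion 30 out of 32 forces `28 *
S.card` checks with exactly one neighbour in `S` (`le_card_uniqueChecks`). This gives the distance
and drives both decoders for `Z`-errors. Sequentially, flipping a variable with more than 16
violated checks lowers the number of violated checks, and a stack keeps the search for such
variables local, so the time is linear (`Run.flipStep`). In parallel, a round of flips halves the
weight (`two_mul_card_supp_flipAll_le`), so logarithmically many rounds suffice. `X`-errors are
found by majority vote in each block (`innerEstimate_correct`). The programs are verified with the
timed total-correctness predicate `Run`.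

For the encoder, systematic generators `g p`, `p ∈ P`, of the row space of `H₂` are chosen. An
invertible linear map, realized by C-NOT gates, sends each `rep n (g p)` to a unit vector
(`mixMap_copyMap_rep`). It thereby identifies the code space with a space stabilized by `X` or `Z`
on single qubits, which Hadamard gates produce from the input space. Edge colourings of the C-NOT
gates give the depth, and injectivity of the circuit gives the dimension `2 ^ k`. -/

theorem choose_le_exp_mul_div_pow (n k : ℕ) (hk : 0 < k) :
    (n.choose k : ℝ) ≤ (Real.exp 1 * n / k) ^ k := by
  have hk' : (0 : ℝ) < k := by exact_mod_cast hk
  have h1 : (n.choose k : ℝ) ≤ (n : ℝ) ^ k / k.factorial := Nat.choose_le_pow_div k n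
  have h2 : (k : ℝ) ^ k / k.factorial ≤ Real.exp k :=
    Real.pow_div_factorial_le_exp (k : ℝ) hk'.le k
  have hf : (0 : ℝ) < k.factorial := by exact_mod_cast k.factorial_pos
  have h3 : Real.exp k = Real.exp 1 ^ k := by rw [← Real.exp_nat_mul, mul_one]
  rw [h3, div_le_iff₀ hf] at h2
  refine h1.trans ?_
  rw [div_pow, mul_pow, div_le_div_iff₀ hf (pow_pos hk' k)]
  nlinarith [pow_nonneg (Nat.cast_nonneg n : (0 : ℝ) ≤ n) k]

/-- The functions `f` for which all neighbours `(i, f j i)` of the vertices `j ∈ S` are in `T`. -/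
def trapped {B D q : ℕ} (S : Finset (Fin B)) (T : Finset (Fin D × Fin q)) :
    Finset (Fin B → Fin D → Fin q) :=
  univ.filter fun f => ∀ j ∈ S, ∀ i, (i, f j i) ∈ T

/-- AM–GM. It makes the count of trapped maps depend only on the size of the target set, not on how
that set is spread over the `D` parts. -/
theorem prod_le_arith_mean_pow {D : ℕ} (hD : 0 < D) (a : Fin D → ℝ) (ha : ∀ i, 0 ≤ a i) :
    ∏ i, a i ≤ ((∑ i, a i) / D) ^ D := by
  have hD' : (0 : ℝ) < D := by exact_mod_cast hD
  have h := Real.geom_mean_le_arith_mean univ (fun _ : Fin D => (1 : ℝ)) a (by simp)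
    (by simpa using hD) (fun i _ => ha i)
  simp only [Real.rpow_one, sum_const, card_univ, Fintype.card_fin, nsmul_eq_mul, mul_one,
    one_mul] at h
  have hp : 0 ≤ ∏ i, a i := prod_nonneg fun i _ => ha i
  calc ∏ i, a i = ((∏ i, a i) ^ ((D : ℝ)⁻¹)) ^ D := by
        rw [← Real.rpow_natCast, ← Real.rpow_mul hp, inv_mul_cancel₀ hD'.ne', Real.rpow_one]
    _ ≤ _ := pow_le_pow_left₀ (Real.rpow_nonneg hp _) h D

/-- The values `f j i` are independent: for `j ∈ S` the value is confined to the slice of `T` over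
`i`, otherwise it is free. The slice sizes add up to `T.card`, and AM–GM bounds their product. -/
theorem card_trapped_le {B D q : ℕ} (hD : 0 < D) (hq : 0 < q) (S : Finset (Fin B))
    (T : Finset (Fin D × Fin q)) :
    ((trapped S T).card : ℝ) ≤ ((T.card : ℝ) / (D * q)) ^ (D * S.card) * (q : ℝ) ^ (D * B) := by
  classical
  have hD' : (0 : ℝ) < D := by exact_mod_cast hD
  have hq' : (0 : ℝ) < q := by exact_mod_cast hq
  set A : Fin D → Finset (Fin q) := fun i => univ.filter fun x => (i, x) ∈ T with hA
  have h1 : trapped S T = Fintype.piFinset fun j => Fintype.piFinset fun i =>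
      if j ∈ S then A i else univ := by
    ext f
    simp only [trapped, mem_filter, mem_univ, true_and, Fintype.mem_piFinset, hA]
    refine forall_congr' fun j => ?_
    by_cases hj : j ∈ S <;> simp [hj]
  have h2 : (trapped S T).card = (∏ i, (A i).card) ^ S.card * (q ^ D) ^ (B - S.card) := by
    rw [h1, Fintype.card_piFinset]
    have : ∀ j, (Fintype.piFinset fun i => if j ∈ S then A i else univ).card
        = if j ∈ S then ∏ i, (A i).card else q ^ D := by
      intro j
      rw [Fintype.card_piFinset]
      by_cases hj : j ∈ S <;> simp [hj]
    simp only [this]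
    rw [prod_ite]
    simp only [prod_const]
    congr 2
    · simp
    · rw [filter_not, card_sdiff]
      simp
  have h3 : ∑ i, ((A i).card : ℝ) = T.card := by
    rw [← Nat.cast_sum]
    congr 1
    have := card_eq_sum_card_fiberwise (s := T) (t := univ) (f := Prod.fst) (by simp)
    rw [this]
    refine sum_congr rfl fun i _ => ?_
    refine card_bij (fun x _ => (i, x)) ?_ ?_ ?_
    · simp [hA]
    · simp
    · rintro ⟨a, b⟩ h
      simp only [mem_filter] at h
      obtain ⟨h, rfl⟩ := h
      exact ⟨b, by simp [hA, h], rfl⟩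
  have h4 := prod_le_arith_mean_pow hD (fun i => ((A i).card : ℝ)) (fun i => by positivity)
  rw [h3] at h4
  have hS : S.card ≤ B := by simpa using S.card_le_univ
  rw [h2, Nat.cast_mul, Nat.cast_pow, Nat.cast_prod, Nat.cast_pow, Nat.cast_pow]
  calc (∏ i, ((A i).card : ℝ)) ^ S.card * ((q : ℝ) ^ D) ^ (B - S.card)
      ≤ (((T.card : ℝ) / D) ^ D) ^ S.card * ((q : ℝ) ^ D) ^ (B - S.card) := by
        exact mul_le_mul_of_nonneg_right (pow_le_pow_left₀
          (prod_nonneg fun i _ => Nat.cast_nonneg _) h4 _) (pow_nonneg (pow_nonneg hq'.le _) _)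
    _ = ((T.card : ℝ) / (D * q)) ^ (D * S.card) * (q : ℝ) ^ (D * B) := by
        have hB : D * B = D * S.card + D * (B - S.card) := by
          rw [← mul_add, Nat.add_sub_cancel' hS]
        have hne : (q : ℝ) ^ (D * S.card) ≠ 0 := pow_ne_zero _ hq'.ne'
        rw [← div_div, div_pow _ (q : ℝ), ← pow_mul, ← pow_mul, hB, pow_add,
          ← mul_assoc, div_mul_cancel₀ _ hne]

/-- The fraction of variables up to which the codes constructed below expand. -/
noncomputable def expFrac : ℝ := 1 / (4 * 57600 * 3 ^ 31)

theorem expFrac_pos : 0 < expFrac := by unfold expFrac; positivity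

/-- The union bound for sets of size `s`: the number of `S`, the number of `T`, and the bound for
the probability that all `32 * s` edges of `S` end in `T`. The edges give 32 factors `s / Q` against
30 from the choice of `T`; the surplus of two beats the factor `B / s`. What remains is `e ^ 31 *
900 * B * s / Q ^ 2`, and `expFrac` is tuned to push this below `1 / 4`, using `e < 3`. -/
theorem choose_mul_choose_mul_pow_le {B Q s : ℕ} (hs : 0 < s) (hsB : (s : ℝ) ≤ expFrac * B)
    (hQ : B ≤ 8 * Q) :
    (B.choose s : ℝ) * Q.choose (30 * s) * ((30 * s : ℕ) / (Q : ℝ)) ^ (32 * s) ≤ (1 / 4) ^ s := by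
  have hs' : (0 : ℝ) < s := by exact_mod_cast hs
  have hB : (0 : ℝ) < B := by
    by_contra h
    have := expFrac_pos
    nlinarith
  have hQ' : (B : ℝ) ≤ 8 * Q := by exact_mod_cast hQ
  have hQ0 : (0 : ℝ) < Q := by linarith
  have he := Real.exp_one_lt_three
  have he0 := Real.exp_pos 1
  have h1 := choose_le_exp_mul_div_pow B s hs
  have h2 := choose_le_exp_mul_div_pow Q (30 * s) (by omega)
  calc (B.choose s : ℝ) * Q.choose (30 * s) * ((30 * s : ℕ) / (Q : ℝ)) ^ (32 * s)
      ≤ (Real.exp 1 * B / s) ^ s * (Real.exp 1 * Q / (30 * s : ℕ)) ^ (30 * s)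
          * ((30 * s : ℕ) / (Q : ℝ)) ^ (32 * s) := by gcongr
    _ = (Real.exp 1 ^ 31 * 900 * (B * s / Q ^ 2)) ^ s := by
        rw [pow_mul, pow_mul, ← mul_pow, ← mul_pow]
        congr 1
        push_cast
        field_simp
        norm_num
    _ ≤ (1 / 4) ^ s := by
        refine pow_le_pow_left₀ (by positivity) ?_ s
        have h3 : (B * s / Q ^ 2 : ℝ) ≤ 64 * expFrac := by
          rw [div_le_iff₀ (by positivity)]
          have : (B : ℝ) ^ 2 ≤ (8 * Q) ^ 2 := by gcongr
          have hp := expFrac_pos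
          nlinarith
        calc Real.exp 1 ^ 31 * 900 * (B * s / Q ^ 2)
            ≤ 3 ^ 31 * 900 * (64 * expFrac) := by gcongr
          _ = 1 / 4 := by
            unfold expFrac
            norm_num

theorem sum_Icc_quarter_pow_lt_one (n : ℕ) : ∑ s ∈ Icc 1 n, (1 / 4 : ℝ) ^ s < 1 := by
  have : ∑ s ∈ Icc 1 n, (1 / 4 : ℝ) ^ s = 1 / 3 - (1 / 3) * (1 / 4) ^ n := by
    induction n with
    | zero => simp
    | succ n ih =>
      rw [sum_Icc_succ_top (by omega), ih, pow_succ]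
      ring
  rw [this]
  have : (0 : ℝ) < (1 / 4) ^ n := by positivity
  linarith

/-- A first moment argument by counting: a map that fails is trapped for some `S` of size `s` and
some `T` of size exactly `30 * s`, and the fraction of such maps is at most `∑ 4⁻ˢ < 1`. -/
theorem exists_expanding_map {B q : ℕ} (hq : 0 < q) (hBq : B ≤ 256 * q) :
    ∃ f : Fin B → Fin 32 → Fin q, ∀ S : Finset (Fin B), (S.card : ℝ) ≤ expFrac * B →
      30 * S.card ≤ (S.biUnion fun j => univ.image fun i => (i, f j i)).card := by
  classical
  by_contra hcon
  push Not at hcon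
  set n := ⌊expFrac * B⌋₊ with hn
  have hnn : 0 ≤ expFrac * B := mul_nonneg expFrac_pos.le (Nat.cast_nonneg _)
  have hcover : (univ : Finset (Fin B → Fin 32 → Fin q)) ⊆
      (Icc 1 n).biUnion fun s => (powersetCard s (univ : Finset (Fin B))).biUnion fun S =>
        (powersetCard (30 * s) (univ : Finset (Fin 32 × Fin q))).biUnion fun T =>
          trapped S T := by
    intro f _
    obtain ⟨S, hS, hlt⟩ := hcon f
    have hSpos : 0 < S.card := by omega
    have hSn : S.card ≤ n := Nat.le_floor hS
    -- Enlarging the neighbourhood to exactly `30 * S.card` elements needs that many right vertices;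
    -- smallness of `expFrac` gives `S.card ≤ q`.
    have hle : 30 * S.card ≤ Fintype.card (Fin 32 × Fin q) := by
      simp only [Fintype.card_prod, Fintype.card_fin]
      have h1 : (B : ℝ) ≤ 256 * q := by exact_mod_cast hBq
      have h2 : expFrac ≤ 1 / 256 := by unfold expFrac; norm_num
      have h3 : (S.card : ℝ) ≤ q := by nlinarith [expFrac_pos, (Nat.cast_nonneg B : (0 : ℝ) ≤ B)]
      have h4 : S.card ≤ q := by exact_mod_cast h3
      omega
    obtain ⟨T, hT, hTc⟩ := exists_superset_card_eq hlt.le hle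
    simp only [mem_biUnion, mem_Icc, mem_powersetCard, subset_univ, true_and]
    refine ⟨S.card, ⟨hSpos, hSn⟩, S, rfl, T, hTc, ?_⟩
    simp only [trapped, mem_filter, mem_univ, true_and]
    intro j hj i
    exact hT (mem_biUnion.2 ⟨j, hj, mem_image_of_mem _ (mem_univ i)⟩)
  have hqB : (0 : ℝ) < (q : ℝ) ^ (32 * B) := by positivity
  have hle : ((q : ℝ) ^ (32 * B)) ≤ ∑ s ∈ Icc 1 n, (1 / 4 : ℝ) ^ s * (q : ℝ) ^ (32 * B) := by
    have hcard : (univ : Finset (Fin B → Fin 32 → Fin q)).card = q ^ (32 * B) := by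
      simp [pow_mul]
    have h1 := card_le_card hcover
    rw [hcard] at h1
    rw [← Nat.cast_pow]
    refine (Nat.cast_le.2 h1).trans ?_
    rw [Nat.cast_pow]
    refine (Nat.cast_le.2 card_biUnion_le).trans ?_
    rw [Nat.cast_sum]
    refine sum_le_sum fun s hs => ?_
    rw [mem_Icc] at hs
    have hsB : (s : ℝ) ≤ expFrac * B := (Nat.le_floor_iff hnn).1 hs.2
    have hkey := choose_mul_choose_mul_pow_le (Q := 32 * q) hs.1 hsB (by omega)
    refine le_trans ?_ (mul_le_mul_of_nonneg_right hkey hqB.le)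
    refine (Nat.cast_le.2 card_biUnion_le).trans ?_
    rw [Nat.cast_sum]
    have hin : ∀ S ∈ powersetCard s (univ : Finset (Fin B)),
        ((((powersetCard (30 * s) (univ : Finset (Fin 32 × Fin q))).biUnion fun T =>
          trapped S T).card : ℕ) : ℝ) ≤ (32 * q).choose (30 * s) *
            (((30 * s : ℕ) / ((32 * q : ℕ) : ℝ)) ^ (32 * s) * (q : ℝ) ^ (32 * B)) := by
      intro S hS
      refine (Nat.cast_le.2 card_biUnion_le).trans ?_
      rw [Nat.cast_sum]
      refine (sum_le_card_nsmul _ _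
        (((30 * s : ℕ) / ((32 * q : ℕ) : ℝ)) ^ (32 * s) * (q : ℝ) ^ (32 * B)) ?_).trans ?_
      · intro T hT
        have h := card_trapped_le (by norm_num : 0 < 32) hq S T
        rw [(mem_powersetCard.1 hS).2, (mem_powersetCard.1 hT).2] at h
        push_cast at h ⊢
        exact h
      · rw [card_powersetCard, nsmul_eq_mul]
        simp
    refine (sum_le_card_nsmul _ _ _ hin).trans ?_
    rw [card_powersetCard, nsmul_eq_mul]
    simp only [card_univ, Fintype.card_fin]
    apply le_of_eq
    ring
  rw [← sum_mul] at hle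
  have := sum_Icc_quarter_pow_lt_one n
  nlinarith

/-- The elements of `A` are numbered and cut into consecutive runs of length `Δ`. This serves to
split a right vertex of large degree into checks of degree at most `Δ`. -/
theorem exists_balanced_grouping {α : Type*} (A : Finset α) {Δ : ℕ} (hΔ : 0 < Δ) :
    ∃ r : α → ℕ, (∀ g, (A.filter fun a => r a = g).card ≤ Δ) ∧
      ∀ a ∈ A, r a < A.card / Δ + 1 := by
  classical
  refine ⟨fun a => if h : a ∈ A then (A.equivFin ⟨a, h⟩).val / Δ else 0, fun g => ?_,
    fun a ha => ?_⟩
  · have hcard : (Ico (g * Δ) (g * Δ + Δ)).card = Δ := by simp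
    refine le_of_le_of_eq ?_ hcard
    refine card_le_card_of_injOn (fun a => if h : a ∈ A then (A.equivFin ⟨a, h⟩).val else 0) ?_ ?_
    · intro a ha
      obtain ⟨ha, h⟩ := mem_filter.1 ha
      simp only [ha, dite_true] at h ⊢
      rw [coe_Ico, Set.mem_Ico, ← h]
      have h1 := Nat.div_add_mod (A.equivFin ⟨a, ha⟩).val Δ
      have h2 := Nat.mod_lt (A.equivFin ⟨a, ha⟩).val hΔ
      rw [mul_comm] at h1
      omega
    · intro a ha b hb h
      have ha := (mem_filter.1 ha).1
      have hb := (mem_filter.1 hb).1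
      simp only [ha, hb, dite_true] at h
      simpa using A.equivFin.injective (Fin.ext h)
  · simp only [ha, dite_true]
    have := (A.equivFin ⟨a, ha⟩).isLt
    exact Nat.lt_succ_of_le (Nat.div_le_div_right this.le)

/-- Every length `B ≥ 128` has an expander code of rate at least one half. -/
theorem exists_expander_code {B : ℕ} (hB : 128 ≤ B) :
    ∃ (m : ℕ) (H : Matrix (Fin m) (Fin B) (ZMod 2)),
      IsExpanderCheckMatrix H 32 128 expFrac (15 / 16) ∧ 2 * m ≤ B := by
  classical
  -- The `32 * q` right vertices number at most `B / 4`, and splitting the `32 * B` edges into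
  -- groups of 128 adds at most another `B / 4` checks; this gives `2 * m ≤ B`.
  set q := B / 128 with hq
  obtain ⟨f, hf⟩ := exists_expanding_map (B := B) (q := q) (by omega) (by omega)
  set A : Fin 32 × Fin q → Finset (Fin B) := fun v => univ.filter fun j => f j v.1 = v.2 with hA
  choose r hr hr' using fun v => exists_balanced_grouping (A v) (by norm_num : 0 < 128)
  -- The edge `(j, i)` ends in the group of the vertex `(i, f j i)` that contains `j`. The component
  -- `i` keeps the 32 checks of a variable distinct, so the column weight is exact.
  set e : Fin B → Fin 32 → (Fin 32 × Fin q) × ℕ := fun j i => ((i, f j i), r (i, f j i) j) with he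
  set E : Finset ((Fin 32 × Fin q) × ℕ) := univ.image fun v : Fin B × Fin 32 => e v.1 v.2 with hE
  have heE : ∀ j i, e j i ∈ E := fun j i => mem_image.2 ⟨(j, i), mem_univ _, rfl⟩
  have hEcard : 2 * E.card ≤ B := by
    have hsub : E ⊆ univ.biUnion fun v : Fin 32 × Fin q =>
        (range ((A v).card / 128 + 1)).image fun g => (v, g) := by
      intro x hx
      obtain ⟨⟨j, i⟩, -, rfl⟩ := mem_image.1 hx
      refine mem_biUnion.2 ⟨(i, f j i), mem_univ _, mem_image.2 ⟨_, mem_range.2 ?_, rfl⟩⟩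
      exact hr' _ _ (by simp [hA])
    have h1 : E.card ≤ ∑ v : Fin 32 × Fin q, ((A v).card / 128 + 1) := by
      refine (card_le_card hsub).trans (card_biUnion_le.trans (sum_le_sum fun v _ => ?_))
      exact card_image_le.trans_eq (card_range _)
    have h2 : ∑ v : Fin 32 × Fin q, (A v).card = 32 * B := by
      rw [Fintype.sum_prod_type]
      have : ∀ i : Fin 32, ∑ x : Fin q, (A (i, x)).card = B := by
        intro i
        have := card_eq_sum_card_fiberwise (s := (univ : Finset (Fin B))) (t := univ)
          (f := fun j => f j i) (by simp)
        simpa [hA] using this.symm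
      simp [this]
    have h3 : 128 * ∑ v : Fin 32 × Fin q, (A v).card / 128 ≤ 32 * B := by
      rw [← h2, mul_sum]
      exact sum_le_sum fun v _ => Nat.mul_div_le _ _
    rw [sum_add_distrib] at h1
    simp only [sum_const, card_univ, Fintype.card_prod, Fintype.card_fin, smul_eq_mul,
      mul_one] at h1
    omega
  set H : Matrix (Fin E.card) (Fin B) (ZMod 2) :=
    Matrix.of fun c j => if ∃ i, e j i = (E.equivFin.symm c).val then 1 else 0 with hH
  have hne : ∀ c j, H c j ≠ 0 ↔ ∃ i, e j i = (E.equivFin.symm c).val := by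
    intro c j
    simp [hH]
  refine ⟨E.card, H, ⟨fun j => ?_, fun c => ?_, fun S hS => ?_⟩, hEcard⟩
  · simp only [hne]
    have : (univ.filter fun c => ∃ i, e j i = (E.equivFin.symm c).val)
        = univ.image fun i => E.equivFin ⟨e j i, heE j i⟩ := by
      ext c
      simp only [mem_filter, mem_univ, true_and, mem_image]
      refine exists_congr fun i => ⟨fun h => ?_, fun h => ?_⟩
      · rw [← Equiv.eq_symm_apply]
        exact Subtype.ext h
      · rw [← h, Equiv.symm_apply_apply]
    rw [this, card_image_of_injective]
    · simp
    · intro i i' h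
      have := congrArg (fun x => (Subtype.val x).1.1) (E.equivFin.injective h)
      exact this
  · simp only [hne]
    set x := (E.equivFin.symm c).val
    refine (card_le_card ?_).trans (hr x.1 x.2)
    intro j hj
    obtain ⟨i, hi⟩ := (mem_filter.1 hj).2
    rw [← hi]
    simp [he, hA]
  · have h1 := hf S hS
    -- Forgetting the group maps the checks of `S` onto its unsplit neighbours, so splitting cannot
    -- spoil the expansion.
    have h2 : (S.biUnion fun j => univ.image fun i => (i, f j i)) ⊆
        (S.biUnion fun j => univ.filter fun c => H c j ≠ 0).image
          fun c => (E.equivFin.symm c).val.1 := by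
      intro v hv
      obtain ⟨j, hj, hv⟩ := mem_biUnion.1 hv
      obtain ⟨i, -, rfl⟩ := mem_image.1 hv
      refine mem_image.2 ⟨E.equivFin ⟨e j i, heE j i⟩, mem_biUnion.2 ⟨j, hj, ?_⟩, ?_⟩
      · simp only [hne, mem_filter, mem_univ, true_and]
        exact ⟨i, by rw [Equiv.symm_apply_apply]⟩
      · rw [Equiv.symm_apply_apply]
    have h3 : (30 * S.card : ℝ) ≤
        ((S.biUnion fun j => univ.filter fun c => H c j ≠ 0).card : ℝ) := by
      exact_mod_cast h1.trans ((card_le_card h2).trans card_image_le)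
    push_cast
    linarith

/-! ### Bit flipping on expander codes -/

section Flip

variable {m B : ℕ} (H : Matrix (Fin m) (Fin B) (ZMod 2))

/-- The checks in which the variable `j` takes part. -/
def checksOf (j : Fin B) : Finset (Fin m) := univ.filter fun c => H c j ≠ 0

/-- The variables of the check `c`. -/
def varsOf (c : Fin m) : Finset (Fin B) := univ.filter fun j => H c j ≠ 0

/-- The checks violated by `y`. -/
def unsat (y : Fin B → ZMod 2) : Finset (Fin m) := univ.filter fun c => H.mulVec y c ≠ 0

/-- The positions of the nonzero entries. -/
def supp (y : Fin B → ZMod 2) : Finset (Fin B) := univ.filter fun j => y j ≠ 0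

/-- The number of violated checks in which `j` takes part. -/
def unsatDeg (y : Fin B → ZMod 2) (j : Fin B) : ℕ := (checksOf H j ∩ unsat H y).card

/-- Expansion of a parity check matrix with column weights at most `32`, for sets of size at most
`e`. -/
structure Expands (e : ℕ) : Prop where
  degree_le : ∀ j, (checksOf H j).card ≤ 32
  expand : ∀ S : Finset (Fin B), S.card ≤ e → 30 * S.card ≤ (S.biUnion (checksOf H)).card

theorem zmod_two_cases (a : ZMod 2) : a = 0 ∨ a = 1 := by
  revert a
  decide

theorem zmod_two_eq_one {a : ZMod 2} (h : a ≠ 0) : a = 1 := (zmod_two_cases a).resolve_left h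

theorem hammingNorm_eq_card_supp (y : Fin B → ZMod 2) : hammingNorm y = (supp y).card := rfl

variable {H}

theorem mem_checksOf {j : Fin B} {c : Fin m} : c ∈ checksOf H j ↔ H c j ≠ 0 := by
  simp [checksOf]

theorem mem_varsOf {j : Fin B} {c : Fin m} : j ∈ varsOf H c ↔ H c j ≠ 0 := by
  simp [varsOf]

theorem mem_unsat {y : Fin B → ZMod 2} {c : Fin m} : c ∈ unsat H y ↔ H.mulVec y c ≠ 0 := by
  simp [unsat]

theorem mem_supp {y : Fin B → ZMod 2} {j : Fin B} : j ∈ supp y ↔ y j ≠ 0 := by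
  simp [supp]

theorem mulVec_eq_sum_varsOf (y : Fin B → ZMod 2) (c : Fin m) :
    H.mulVec y c = ∑ j ∈ varsOf H c, y j := by
  rw [varsOf, sum_filter, Matrix.mulVec, dotProduct]
  refine sum_congr rfl fun j _ => ?_
  rcases zmod_two_cases (H c j) with h | h <;> simp [h]

theorem mulVec_eq_card (y : Fin B → ZMod 2) (c : Fin m) :
    H.mulVec y c = (((supp y).filter fun j => H c j ≠ 0).card : ZMod 2) := by
  rw [mulVec_eq_sum_varsOf, card_filter, Nat.cast_sum, supp, varsOf, sum_filter, sum_filter]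
  refine sum_congr rfl fun j _ => ?_
  rcases zmod_two_cases (H c j) with h | h <;> rcases zmod_two_cases (y j) with hy | hy <;>
    simp [h, hy]

/-- The checks with exactly one neighbour in `S`. -/
def uniqueChecks (H : Matrix (Fin m) (Fin B) (ZMod 2)) (S : Finset (Fin B)) : Finset (Fin m) :=
  univ.filter fun c => (S.filter fun j => H c j ≠ 0).card = 1

/-- A check with a single neighbour in the support sees odd parity. -/
theorem uniqueChecks_subset_unsat (y : Fin B → ZMod 2) :
    uniqueChecks H (supp y) ⊆ unsat H y := by
  intro c hc
  rw [mem_unsat, mulVec_eq_card, (mem_filter.1 hc).2]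
  decide

theorem unsat_subset_biUnion (y : Fin B → ZMod 2) :
    unsat H y ⊆ (supp y).biUnion (checksOf H) := by
  intro c hc
  rw [mem_unsat, mulVec_eq_card] at hc
  have : ((supp y).filter fun j => H c j ≠ 0).Nonempty := by
    rw [nonempty_iff_ne_empty]
    intro h
    simp [h] at hc
  obtain ⟨j, hj⟩ := this
  obtain ⟨h1, h2⟩ := mem_filter.1 hj
  exact mem_biUnion.2 ⟨j, h1, mem_checksOf.2 h2⟩

theorem sum_card_checksOf_inter (S : Finset (Fin B)) (T : Finset (Fin m)) :
    ∑ j ∈ S, (checksOf H j ∩ T).card = ∑ c ∈ T, (S.filter fun j => H c j ≠ 0).card := by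
  have := sum_card_bipartiteAbove_eq_sum_card_bipartiteBelow (s := S) (t := T)
    (fun j c => H c j ≠ 0)
  refine Eq.trans (sum_congr rfl fun j _ => ?_) this
  congr 1
  ext c
  simp [bipartiteAbove, mem_checksOf, and_comm]

/-- Each unique check is counted at its only neighbour in `S`. This shares the unique checks out
among the variables of `S` and permits averaging. -/
theorem sum_card_checksOf_inter_uniqueChecks (S : Finset (Fin B)) :
    ∑ j ∈ S, (checksOf H j ∩ uniqueChecks H S).card = (uniqueChecks H S).card := by
  rw [sum_card_checksOf_inter, card_eq_sum_ones]
  exact sum_congr rfl fun c hc => (mem_filter.1 hc).2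

theorem card_biUnion_checksOf_le {e : ℕ} (hH : Expands H e) (S : Finset (Fin B)) :
    (S.biUnion (checksOf H)).card ≤ 32 * S.card := by
  rw [mul_comm]
  exact card_biUnion_le_card_mul _ _ _ fun j _ => hH.degree_le j

/-- At most `32 * S.card` edges leave `S`, and every neighbour that is not unique absorbs at least
two of them. Hence twice the number of neighbours, at least `60 * S.card`, is at most `32 * S.card`
plus the number of unique checks. -/
theorem le_card_uniqueChecks {e : ℕ} (hH : Expands H e) {S : Finset (Fin B)} (hS : S.card ≤ e) :
    28 * S.card ≤ (uniqueChecks H S).card := by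
  have h1 := hH.expand S hS
  have h2 : ∑ c : Fin m, (S.filter fun j => H c j ≠ 0).card ≤ 32 * S.card := by
    rw [← sum_card_checksOf_inter, mul_comm, ← smul_eq_mul]
    exact sum_le_card_nsmul _ _ _ fun j _ => by simpa using hH.degree_le j
  have h3 : 2 * (S.biUnion (checksOf H)).card ≤
      ∑ c : Fin m, (S.filter fun j => H c j ≠ 0).card + (uniqueChecks H S).card := by
    have hN : S.biUnion (checksOf H)
        = univ.filter fun c => 0 < (S.filter fun j => H c j ≠ 0).card := by
      ext c
      simp only [mem_biUnion, mem_checksOf, mem_filter, mem_univ, true_and, card_pos,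
        Finset.Nonempty]
    rw [hN, card_filter, uniqueChecks, card_filter, mul_sum, ← sum_add_distrib]
    refine sum_le_sum fun c _ => ?_
    split_ifs <;> omega
  omega

theorem le_card_unsat {e : ℕ} (hH : Expands H e) {y : Fin B → ZMod 2} (hy : (supp y).card ≤ e) :
    28 * (supp y).card ≤ (unsat H y).card :=
  (le_card_uniqueChecks hH hy).trans (card_le_card (uniqueChecks_subset_unsat y))

theorem card_unsat_le {e : ℕ} (hH : Expands H e) (y : Fin B → ZMod 2) :
    (unsat H y).card ≤ 32 * (supp y).card :=
  (card_le_card (unsat_subset_biUnion y)).trans (card_biUnion_checksOf_le hH _)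

theorem supp_eq_empty_iff {y : Fin B → ZMod 2} : supp y = ∅ ↔ y = 0 := by
  constructor
  · intro h
    ext j
    by_contra hj
    have : j ∈ supp y := mem_supp.2 hj
    simp [h] at this
  · rintro rfl
    simp [supp]

/-- Nonzero codewords have weight larger than the size up to which the graph expands. -/
theorem lt_hammingNorm_of_mem_codeOf {e : ℕ} (hH : Expands H e) {x : Fin B → ZMod 2}
    (hx : x ∈ codeOf H) (hx0 : x ≠ 0) : e < hammingNorm x := by
  by_contra! h
  rw [hammingNorm_eq_card_supp] at h
  have h1 := le_card_unsat hH h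
  have h2 : unsat H x = ∅ := by
    have : H.mulVec x = 0 := hx
    simp [unsat, this]
  rw [h2, card_empty] at h1
  have : (supp x).card = 0 := by omega
  exact hx0 (supp_eq_empty_iff.1 (card_eq_zero.1 this))

/-! ### Flips of single variables -/

/-- The unique checks of the support are violated and average at least 28 per variable of the
support, so not every share can be at most 16. -/
theorem exists_flippable {e : ℕ} (hH : Expands H e) {y : Fin B → ZMod 2}
    (hy : (supp y).card ≤ e) (hy0 : y ≠ 0) : ∃ j, 16 < unsatDeg H y j := by
  by_contra! h
  have h1 := le_card_uniqueChecks hH hy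
  rw [← sum_card_checksOf_inter_uniqueChecks] at h1
  have h2 : ∑ j ∈ supp y, (checksOf H j ∩ uniqueChecks H (supp y)).card ≤ (supp y).card • 16 := by
    refine sum_le_card_nsmul _ _ _ fun j _ => le_trans (card_le_card ?_) (h j)
    exact inter_subset_inter_left (uniqueChecks_subset_unsat y)
  rw [smul_eq_mul] at h2
  have : (supp y).card = 0 := by omega
  exact hy0 (supp_eq_empty_iff.1 (card_eq_zero.1 this))

theorem mulVec_add_single (y : Fin B → ZMod 2) (j : Fin B) (c : Fin m) :
    H.mulVec (y + Pi.single j 1) c = H.mulVec y c + H c j := by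
  rw [Matrix.mulVec_add, Pi.add_apply, Matrix.mulVec_single_one]
  rfl

/-- A flip toggles precisely the checks of `j`; more than 16 of the at most 32 become satisfied,
fewer than 16 become violated. -/
theorem card_unsat_flip_lt {e : ℕ} (hH : Expands H e) {y : Fin B → ZMod 2} {j : Fin B}
    (hj : 16 < unsatDeg H y j) : (unsat H (y + Pi.single j 1)).card < (unsat H y).card := by
  have h1 : unsat H (y + Pi.single j 1) ⊆
      (unsat H y \ checksOf H j) ∪ (checksOf H j \ unsat H y) := by
    intro c
    simp only [mem_unsat, mem_union, mem_sdiff, mem_checksOf, mulVec_add_single]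
    generalize H.mulVec y c = a
    generalize H c j = b
    revert a b
    decide
  have h2 := card_le_card h1
  have h3 := card_union_le (unsat H y \ checksOf H j) (checksOf H j \ unsat H y)
  have h4 := card_sdiff_add_card_inter (unsat H y) (checksOf H j)
  have h5 := card_sdiff_add_card_inter (checksOf H j) (unsat H y)
  have h6 := hH.degree_le j
  rw [inter_comm] at h4
  unfold unsatDeg at hj
  omega

/-- Locality: only variables that share a check with `j` can become flippable. This is why the
sequential decoder can keep its candidates on a stack. -/
theorem unsatDeg_flip_of_disjoint {y : Fin B → ZMod 2} {j i : Fin B}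
    (h : Disjoint (checksOf H i) (checksOf H j)) :
    unsatDeg H (y + Pi.single j 1) i = unsatDeg H y i := by
  unfold unsatDeg
  congr 1
  ext c
  simp only [mem_inter, mem_unsat, mulVec_add_single]
  refine and_congr_right fun hc => ?_
  have : c ∉ checksOf H j := fun h' => disjoint_left.1 h hc h'
  rw [mem_checksOf, not_not] at this
  rw [this, add_zero]

theorem card_supp_flip_le (y : Fin B → ZMod 2) (j : Fin B) :
    (supp (y + Pi.single j 1)).card ≤ (supp y).card + 1 := by
  refine (card_le_card (t := insert j (supp y)) ?_).trans (card_insert_le _ _)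
  intro i hi
  rw [mem_supp] at hi
  rw [mem_insert, mem_supp]
  by_cases h : i = j
  · exact Or.inl h
  · exact Or.inr (by simpa [h] using hi)

/-- The weight stays bounded while single variables are flipped. -/
theorem flip_invariant {e t : ℕ} (hH : Expands H e) (ht : 2 * t ≤ e) {y : Fin B → ZMod 2}
    {j : Fin B} (h : (supp y).card ≤ 2 * t ∧ (unsat H y).card ≤ 32 * t)
    (hj : 16 < unsatDeg H y j) :
    (supp (y + Pi.single j 1)).card ≤ 2 * t ∧ (unsat H (y + Pi.single j 1)).card ≤ 32 * t := by
  have h1 := card_unsat_flip_lt hH hj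
  have h2 := le_card_unsat hH (h.1.trans ht)
  have h3 := card_supp_flip_le y j
  -- This forces `t ≥ 1`. With `28 * w ≤ 32 * t` for the weight `w` before the flip, it leaves room
  -- for one more: `w + 1 ≤ 2 * t`.
  have h4 : 16 < (unsat H y).card := lt_of_lt_of_le hj (card_le_card inter_subset_right)
  omega

/-! ### Simultaneous flips -/

/-- One round of parallel bit flipping. -/
def flipAll (H : Matrix (Fin m) (Fin B) (ZMod 2)) (y : Fin B → ZMod 2) : Fin B → ZMod 2 :=
  fun j => y j + if 16 < unsatDeg H y j then 1 else 0

/-- The `28 * s` unique checks of a support of size `s` are shared out: a flipped variable takes at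
most 32, a stuck one at most 16. With `k` stuck variables, `28 * s ≤ 32 * (s - k) + 16 * k`. -/
theorem card_stuck_le {e : ℕ} (hH : Expands H e) {y : Fin B → ZMod 2}
    (hy : (supp y).card ≤ e) :
    4 * ((supp y).filter fun j => ¬ 16 < unsatDeg H y j).card ≤ (supp y).card := by
  have h1 := le_card_uniqueChecks hH hy
  rw [← sum_card_checksOf_inter_uniqueChecks,
    ← sum_filter_add_sum_filter_not _ (fun j => 16 < unsatDeg H y j)] at h1
  have h2 : ∑ j ∈ (supp y).filter (fun j => 16 < unsatDeg H y j),
      (checksOf H j ∩ uniqueChecks H (supp y)).card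
      ≤ ((supp y).filter fun j => 16 < unsatDeg H y j).card • 32 :=
    sum_le_card_nsmul _ _ _ fun j _ =>
      (card_le_card inter_subset_left).trans (hH.degree_le j)
  have h3 : ∑ j ∈ (supp y).filter (fun j => ¬ 16 < unsatDeg H y j),
      (checksOf H j ∩ uniqueChecks H (supp y)).card
      ≤ ((supp y).filter fun j => ¬ 16 < unsatDeg H y j).card • 16 := by
    refine sum_le_card_nsmul _ _ _ fun j hj => le_trans (card_le_card ?_)
      (not_lt.1 (mem_filter.1 hj).2)
    exact inter_subset_inter_left (uniqueChecks_subset_unsat y)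
  have h4 := card_filter_add_card_filter_not (s := supp y) (fun j => 16 < unsatDeg H y j)
  rw [smul_eq_mul] at h2 h3
  omega

/-- A wrongly flipped variable has at most 15 satisfied checks, and its violated ones are already
neighbours of the support. So `supp y ∪ C` has at most `32 * s + 15 * c` neighbours, while expansion
demands `30 * (s + c)`. -/
theorem card_new_le_of_subset {e : ℕ} (hH : Expands H e) {y : Fin B → ZMod 2}
    {C : Finset (Fin B)} (hC : ∀ j ∈ C, j ∉ supp y ∧ 16 < unsatDeg H y j)
    (hCe : (supp y).card + C.card ≤ e) : 15 * C.card ≤ 2 * (supp y).card := by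
  have hdis : Disjoint (supp y) C := disjoint_right.2 fun j hj => (hC j hj).1
  have h1 := hH.expand (supp y ∪ C) ((card_union_of_disjoint hdis).trans_le hCe)
  rw [card_union_of_disjoint hdis] at h1
  have h2 : (supp y ∪ C).biUnion (checksOf H) ⊆ (supp y).biUnion (checksOf H) ∪
      C.biUnion fun j => checksOf H j \ unsat H y := by
    intro c hc
    obtain ⟨j, hj, hcj⟩ := mem_biUnion.1 hc
    rcases mem_union.1 hj with hj | hj
    · exact mem_union_left _ (mem_biUnion.2 ⟨j, hj, hcj⟩)
    · by_cases hu : c ∈ unsat H y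
      · exact mem_union_left _ (unsat_subset_biUnion y hu)
      · exact mem_union_right _ (mem_biUnion.2 ⟨j, hj, mem_sdiff.2 ⟨hcj, hu⟩⟩)
  have h3 : (C.biUnion fun j => checksOf H j \ unsat H y).card ≤ C.card * 15 := by
    refine card_biUnion_le_card_mul _ _ _ fun j hj => ?_
    have h4 := card_sdiff_add_card_inter (checksOf H j) (unsat H y)
    have h5 := hH.degree_le j
    have h6 := (hC j hj).2
    unfold unsatDeg at h6
    omega
  have h4 := (card_le_card h2).trans (card_union_le _ _)
  have h5 := card_biUnion_checksOf_le hH (supp y)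
  omega

/-- A round of parallel bit flipping halves the weight. -/
theorem two_mul_card_supp_flipAll_le {e : ℕ} (hH : Expands H e) {y : Fin B → ZMod 2}
    (hy : 2 * (supp y).card ≤ e) : 2 * (supp (flipAll H y)).card ≤ (supp y).card := by
  set C := univ.filter fun j => j ∉ supp y ∧ 16 < unsatDeg H y j with hC
  have hmem : ∀ j ∈ C, j ∉ supp y ∧ 16 < unsatDeg H y j := fun j hj => (mem_filter.1 hj).2
  have h1 : supp (flipAll H y) ⊆ ((supp y).filter fun j => ¬ 16 < unsatDeg H y j) ∪ C := by
    intro j hj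
    rw [mem_supp, flipAll] at hj
    by_cases h : 16 < unsatDeg H y j
    · refine mem_union_right _ (mem_filter.2 ⟨mem_univ _, ?_, h⟩)
      rw [mem_supp, not_not]
      rw [if_pos h] at hj
      revert hj
      generalize y j = a
      revert a
      decide
    · rw [if_neg h, add_zero] at hj
      exact mem_union_left _ (mem_filter.2 ⟨mem_supp.2 hj, h⟩)
  have h2 := (card_le_card h1).trans (card_union_le _ _)
  have h3 := card_stuck_le hH (y := y) (by omega)
  -- Expansion is available only up to size `e`, so a large `C` is first cut down to the size `s` of
  -- the support; then `15 * s ≤ 2 * s` forces `s = 0`, and nothing is flipped. The total `1/4 +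
  -- 2/15` stays below `1/2`.
  have h4 : 15 * C.card ≤ 2 * (supp y).card := by
    rcases le_total C.card (supp y).card with h | h
    · exact card_new_le_of_subset hH hmem (by omega)
    · obtain ⟨C', hC', hcard⟩ := exists_subset_card_eq h
      have h5 := card_new_le_of_subset hH (fun j hj => hmem j (hC' hj)) (by omega)
      have h6 : (supp y).card = 0 := by omega
      have h7 : (unsat H y).card = 0 := by
        have := card_unsat_le hH y
        omega
      have h8 : C = ∅ := by
        rw [eq_empty_iff_forall_notMem]
        intro j hj
        have := (hmem j hj).2.trans_le (card_le_card inter_subset_right)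
        omega
      simp [h8]
  omega

theorem two_pow_mul_card_supp_iterate_flipAll_le {e : ℕ} (hH : Expands H e) {y : Fin B → ZMod 2}
    (hy : 2 * (supp y).card ≤ e) (r : ℕ) :
    2 ^ r * (supp ((flipAll H)^[r] y)).card ≤ (supp y).card := by
  induction r with
  | zero => simp
  | succ r ih =>
    rw [Function.iterate_succ_apply', pow_succ]
    have h1 : (supp ((flipAll H)^[r] y)).card ≤ (supp y).card :=
      (Nat.le_mul_of_pos_left _ (by positivity)).trans ih
    have h2 := two_mul_card_supp_flipAll_le hH (y := (flipAll H)^[r] y) (by omega)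
    calc 2 ^ r * 2 * (supp (flipAll H ((flipAll H)^[r] y))).card
        = 2 ^ r * (2 * (supp (flipAll H ((flipAll H)^[r] y))).card) := by ring
      _ ≤ 2 ^ r * (supp ((flipAll H)^[r] y)).card := Nat.mul_le_mul_left _ h2
      _ ≤ _ := ih

theorem iterate_flipAll_eq_zero {e : ℕ} (hH : Expands H e) {y : Fin B → ZMod 2}
    (hy : 2 * (supp y).card ≤ e) {r : ℕ} (hr : B < 2 ^ r) : (flipAll H)^[r] y = 0 := by
  have h1 := two_pow_mul_card_supp_iterate_flipAll_le hH hy r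
  have h2 : (supp y).card ≤ B := by simpa using (supp y).card_le_univ
  rw [← supp_eq_empty_iff, ← card_eq_zero]
  by_contra h
  have := Nat.le_mul_of_pos_right (2 ^ r) (Nat.pos_of_ne_zero h)
  omega

end Flip

/-! ### The partially concatenated code -/

section Concatenated

variable {m B n : ℕ}

/-- The sums of the entries of the blocks. -/
def blockParity (v : Fin B × Fin n → ZMod 2) : Fin B → ZMod 2 := fun b => ∑ j, v (b, j)

/-- Repetition of every entry `n` times. -/
def rep (n : ℕ) : (Fin B → ZMod 2) →ₗ[ZMod 2] (Fin B × Fin n → ZMod 2) where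
  toFun x q := x q.1
  map_add' _ _ := rfl
  map_smul' _ _ := rfl

theorem rep_apply (x : Fin B → ZMod 2) (q : Fin B × Fin n) : rep n x q = x q.1 := rfl

theorem pcX_eq_rep (H : Matrix (Fin m) (Fin B) (ZMod 2)) (i : Fin m) :
    pcX n H i = rep n (H i) := by
  ext q
  simp [pcX, innerGen, Matrix.mul_apply, Matrix.one_apply, repGen, rep_apply]

/-- The adjointness of `rep` and `blockParity`, through which syndromes and dual codes of the
concatenation reduce to the outer code. -/
theorem rep_dotProduct (x : Fin B → ZMod 2) (v : Fin B × Fin n → ZMod 2) :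
    rep n x ⬝ᵥ v = x ⬝ᵥ blockParity v := by
  simp only [dotProduct, blockParity, Fintype.sum_prod_type, mul_sum, rep_apply]

theorem pcX_mulVec (H : Matrix (Fin m) (Fin B) (ZMod 2)) (v : Fin B × Fin n → ZMod 2) :
    (pcX n H).mulVec v = H.mulVec (blockParity v) := by
  ext i
  rw [Matrix.mulVec, pcX_eq_rep, rep_dotProduct, Matrix.mulVec]

theorem innerCheck_mulVec (hn : 0 < n) (v : Fin B × Fin n → ZMod 2) (b : Fin B)
    (i : Fin (n - 1)) : (innerCheck B n).mulVec v (b, i) =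
      v (b, Fin.castLE (Nat.sub_le n 1) i) + v (b, ⟨n - 1, Nat.sub_lt hn one_pos⟩) := by
  have h : ∀ j : Fin n, repCheck n i j * v (b, j) =
      (if j = Fin.castLE (Nat.sub_le n 1) i then v (b, j) else 0) +
        if j = ⟨n - 1, Nat.sub_lt hn one_pos⟩ then v (b, j) else 0 := by
    intro j
    simp only [repCheck, Matrix.of_apply, ite_mul, one_mul, zero_mul, Fin.ext_iff,
      Fin.val_castLE]
    have := i.isLt
    split_ifs <;> first | omega | simp
  rw [Matrix.mulVec, dotProduct, Fintype.sum_prod_type]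
  simp only [innerCheck, Matrix.kroneckerMap_apply, Matrix.one_apply, ite_mul, one_mul, zero_mul]
  rw [Finset.sum_eq_single b]
  · simp only [if_true, h, sum_add_distrib, sum_ite_eq', mem_univ]
  · intro b' _ hb'
    simp [hb'.symm]
  · simp

theorem mem_codeOf_innerCheck {v : Fin B × Fin n → ZMod 2} :
    v ∈ codeOf (innerCheck B n) ↔ ∀ b j j', v (b, j) = v (b, j') := by
  have hmem : v ∈ codeOf (innerCheck B n) ↔ ∀ q, (innerCheck B n).mulVec v q = 0 := by
    rw [codeOf, LinearMap.mem_ker, Matrix.mulVecLin_apply, funext_iff]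
    rfl
  rw [hmem]
  constructor
  · intro h b j j'
    have hn : 0 < n := j.pos
    have hl : ∀ j : Fin n, v (b, j) = v (b, ⟨n - 1, Nat.sub_lt hn one_pos⟩) := by
      intro j
      by_cases hj : j.val < n - 1
      · have := h (b, ⟨j, hj⟩)
        rw [innerCheck_mulVec hn] at this
        exact CharTwo.add_eq_zero.1 this
      · congr 2
        ext
        simp only
        omega
    rw [hl j, hl j']
  · rintro h ⟨b, i⟩
    have hn : 0 < n := lt_of_lt_of_le i.pos (Nat.sub_le _ _)
    rw [innerCheck_mulVec hn, h b _ ⟨n - 1, Nat.sub_lt hn one_pos⟩, CharTwo.add_self_eq_zero]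

theorem rep_mem_codeOf_innerCheck (x : Fin B → ZMod 2) : rep n x ∈ codeOf (innerCheck B n) :=
  mem_codeOf_innerCheck.2 fun _ _ _ => rfl

theorem exists_rep_eq (hn : 0 < n) {v : Fin B × Fin n → ZMod 2}
    (hv : v ∈ codeOf (innerCheck B n)) : ∃ x, rep n x = v :=
  ⟨fun b => v (b, ⟨0, hn⟩), funext fun _ => mem_codeOf_innerCheck.1 hv _ _ _⟩

/-- The inner code is the range of `rep`, so its dual is the kernel of the adjoint map. -/
theorem mem_dualCode_innerCheck (hn : 0 < n) {v : Fin B × Fin n → ZMod 2} :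
    v ∈ dualCode (codeOf (innerCheck B n)) ↔ blockParity v = 0 := by
  constructor
  · intro h
    ext b
    have := h _ (rep_mem_codeOf_innerCheck (Pi.single b 1))
    rwa [rep_dotProduct, single_dotProduct, one_mul] at this
  · intro h w hw
    obtain ⟨x, rfl⟩ := exists_rep_eq hn hw
    rw [rep_dotProduct, h, dotProduct_zero]

theorem mem_codeOf_pcX {H : Matrix (Fin m) (Fin B) (ZMod 2)} {v : Fin B × Fin n → ZMod 2} :
    v ∈ codeOf (pcX n H) ↔ blockParity v ∈ codeOf H := by
  simp only [codeOf, LinearMap.mem_ker, Matrix.mulVecLin_apply, pcX_mulVec]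

theorem pcX_mul_transpose_innerCheck (H : Matrix (Fin m) (Fin B) (ZMod 2)) :
    pcX n H * (innerCheck B n).transpose = 0 := by
  ext i q
  have h : (innerCheck B n).mulVec (pcX n H i) = 0 := by
    rw [pcX_eq_rep]
    exact rep_mem_codeOf_innerCheck (H i)
  rw [Matrix.mul_apply']
  exact (dotProduct_comm _ _).trans (congrFun h q)

theorem hammingNorm_blockParity_le (v : Fin B × Fin n → ZMod 2) :
    hammingNorm (blockParity v) ≤ hammingNorm v := by
  refine (card_le_card (t := (univ.filter fun q => v q ≠ 0).image Prod.fst) ?_).trans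
    card_image_le
  intro b hb
  obtain ⟨j, -, hj⟩ := exists_ne_zero_of_sum_ne_zero (mem_filter.1 hb).2
  exact mem_image.2 ⟨(b, j), by simpa using hj, rfl⟩

/-- A vector with given block parities. -/
def firstInBlock (hn : 0 < n) (x : Fin B → ZMod 2) : Fin B × Fin n → ZMod 2 :=
  fun q => if q.2 = ⟨0, hn⟩ then x q.1 else 0

theorem blockParity_firstInBlock (hn : 0 < n) (x : Fin B → ZMod 2) :
    blockParity (firstInBlock hn x) = x := by
  ext b
  simp [blockParity, firstInBlock]

/-- Taking block parities does not increase the weight and yields a nonzero outer codeword. The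
hypothesis `hne` is essential, since the infimum over the empty set would be `0`. -/
theorem le_minWeightOutside_X {H : Matrix (Fin m) (Fin B) (ZMod 2)} (hn : 0 < n) {d : ℕ}
    (hd : ∀ x ∈ codeOf H, x ≠ 0 → d ≤ hammingNorm x) (hne : ∃ x ∈ codeOf H, x ≠ 0) :
    d ≤ minWeightOutside (codeOf (pcX n H)) (dualCode (codeOf (innerCheck B n))) := by
  refine le_csInf ?_ ?_
  · obtain ⟨x, hx, hx0⟩ := hne
    refine ⟨_, firstInBlock hn x, ?_, ?_, rfl⟩
    · rwa [mem_codeOf_pcX, blockParity_firstInBlock]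
    · rwa [mem_dualCode_innerCheck hn, blockParity_firstInBlock]
  · rintro _ ⟨v, hv, hv', rfl⟩
    rw [mem_dualCode_innerCheck hn] at hv'
    exact (hd _ (mem_codeOf_pcX.1 hv) hv').trans (hammingNorm_blockParity_le v)

/-- A nonzero block-constant vector fills a block. The set is nonempty: if `x` is a codeword with `x
b ≠ 0`, the repeated unit vector at `b` is not orthogonal to `firstInBlock hn x`. -/
theorem le_minWeightOutside_Z {H : Matrix (Fin m) (Fin B) (ZMod 2)} (hn : 0 < n)
    (hne : ∃ x ∈ codeOf H, x ≠ 0) :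
    n ≤ minWeightOutside (codeOf (innerCheck B n)) (dualCode (codeOf (pcX n H))) := by
  refine le_csInf ?_ ?_
  · obtain ⟨x, hx, hx0⟩ := hne
    obtain ⟨b, hb⟩ := Function.ne_iff.1 hx0
    refine ⟨_, rep n (Pi.single b 1), rep_mem_codeOf_innerCheck _, fun h => hb ?_, rfl⟩
    have := h (firstInBlock hn x) (by rwa [mem_codeOf_pcX, blockParity_firstInBlock])
    rwa [dotProduct_comm, rep_dotProduct, blockParity_firstInBlock, single_dotProduct,
      one_mul] at this
  · rintro _ ⟨v, hv, hv', rfl⟩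
    have hv0 : v ≠ 0 := by
      rintro rfl
      exact hv' (Submodule.zero_mem _)
    obtain ⟨⟨b, j⟩, hb⟩ := Function.ne_iff.1 hv0
    have hcard : (univ.image fun j : Fin n => (b, j)).card = n := by
      rw [card_image_of_injective _ (Prod.mk_right_injective b), card_univ, Fintype.card_fin]
    refine hcard.symm.trans_le (card_le_card ?_)
    intro q hq
    obtain ⟨j', -, rfl⟩ := mem_image.1 hq
    rw [mem_filter, mem_codeOf_innerCheck.1 hv b j' j]
    exact ⟨mem_univ _, hb⟩

end Concatenated

/-! ### Systematic generators of a binary code -/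

/-- `P` is taken minimal such that vectors of `R` are determined by their entries on `P`. Dropping
`p` destroys this, so some nonzero vector of `R` vanishes on the rest of `P`; its entry at `p` must
be `1`. -/
theorem exists_systematic_generators {ι : Type*} [Fintype ι] [DecidableEq ι]
    (R : Submodule (ZMod 2) (ι → ZMod 2)) :
    ∃ (P : Finset ι) (g : ι → ι → ZMod 2), (∀ p ∈ P, g p ∈ R) ∧
      (∀ p ∈ P, ∀ p' ∈ P, g p p' = if p = p' then 1 else 0) ∧
      ∀ r ∈ R, r = ∑ p ∈ P, r p • g p := by
  classical
  set good : Finset ι → Prop := fun P => ∀ r ∈ R, (∀ p ∈ P, r p = 0) → r = 0 with hgood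
  obtain ⟨P, hP, hmin⟩ := exists_min_image (univ.filter good) card
    ⟨univ, mem_filter.2 ⟨mem_univ _, fun r _ h => funext fun p => h p (mem_univ p)⟩⟩
  have hPg : good P := (mem_filter.1 hP).2
  have hex : ∀ p ∈ P, ∃ r ∈ R, (∀ p' ∈ P, r p' = if p = p' then 1 else 0) := by
    intro p hp
    have hbad : ¬ good (P.erase p) := by
      intro h
      have h1 := hmin _ (mem_filter.2 ⟨mem_univ _, h⟩)
      have h2 := card_erase_lt_of_mem hp
      omega
    simp only [hgood] at hbad
    push Not at hbad
    obtain ⟨r, hr, hr', hr0⟩ := hbad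
    refine ⟨r, hr, fun p' hp' => ?_⟩
    split_ifs with h
    · subst h
      refine zmod_two_eq_one fun h0 => hr0 (hPg r hr fun p' hp' => ?_)
      by_cases h : p' = p
      · rw [h, h0]
      · exact hr' p' (mem_erase.2 ⟨h, hp'⟩)
    · exact hr' p' (mem_erase.2 ⟨fun h' => h h'.symm, hp'⟩)
  choose! g hg hg' using hex
  refine ⟨P, g, hg, hg', fun r hr => ?_⟩
  rw [← sub_eq_zero]
  refine hPg _ (Submodule.sub_mem _ hr (Submodule.sum_mem _ fun p hp =>
    Submodule.smul_mem _ _ (hg p hp))) fun p' hp' => ?_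
  rw [Pi.sub_apply, Finset.sum_apply, sum_congr rfl fun p hp => by
    rw [Pi.smul_apply, hg' p hp p' hp']]
  simp [hp']

/-- Restriction to `P` identifies the row space with `𝔽₂^P`, so `P` counts the rank. The blocks
outside `P` will carry the encoded qubits. -/
theorem finrank_codeOf_eq {m B : ℕ} (H : Matrix (Fin m) (Fin B) (ZMod 2)) {P : Finset (Fin B)}
    {g : Fin B → Fin B → ZMod 2}
    (hg : ∀ p ∈ P, g p ∈ Submodule.span (ZMod 2) (Set.range H.row))
    (hδ : ∀ p ∈ P, ∀ p' ∈ P, g p p' = if p = p' then 1 else 0)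
    (hsum : ∀ r ∈ Submodule.span (ZMod 2) (Set.range H.row), r = ∑ p ∈ P, r p • g p) :
    Module.finrank (ZMod 2) (codeOf H) = Pᶜ.card := by
  set R := Submodule.span (ZMod 2) (Set.range H.row) with hR
  let φ : R →ₗ[ZMod 2] (P → ZMod 2) :=
    { toFun := fun r p => r.val p.val
      map_add' := fun _ _ => rfl
      map_smul' := fun _ _ => rfl }
  have hinj : Function.Injective φ := by
    intro r r' h
    apply Subtype.ext
    rw [hsum r r.2, hsum r' r'.2]
    refine sum_congr rfl fun p hp => ?_
    rw [show r.val p = r'.val p from congrFun h ⟨p, hp⟩]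
  have hsurj : Function.Surjective φ := by
    intro y
    refine ⟨⟨∑ p : P, y p • g p, Submodule.sum_mem _ fun p _ =>
      Submodule.smul_mem _ _ (hg p p.2)⟩, ?_⟩
    funext p'
    change (∑ p : P, y p • g p) p'.val = y p'
    rw [Finset.sum_apply, sum_congr rfl fun p _ => by
      rw [Pi.smul_apply, hδ p p.2 p' p'.2]]
    simp
  have h1 := (LinearEquiv.ofBijective φ ⟨hinj, hsurj⟩).finrank_eq
  rw [Module.finrank_fintype_fun_eq_card, Fintype.card_coe, hR,
    ← Matrix.rank_eq_finrank_span_row] at h1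
  have h2 := LinearMap.finrank_range_add_finrank_ker H.mulVecLin
  rw [Module.finrank_fintype_fun_eq_card, Fintype.card_fin] at h2
  change H.rank + Module.finrank (ZMod 2) (codeOf H) = B at h2
  rw [card_compl, Fintype.card_fin]
  omega

theorem le_finrank_codeOf_add {m B : ℕ} (H : Matrix (Fin m) (Fin B) (ZMod 2)) :
    B ≤ Module.finrank (ZMod 2) (codeOf H) + m := by
  have h2 := LinearMap.finrank_range_add_finrank_ker H.mulVecLin
  rw [Module.finrank_fintype_fun_eq_card, Fintype.card_fin] at h2
  change H.rank + Module.finrank (ZMod 2) (codeOf H) = B at h2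
  have := H.rank_le_height
  omega

/-! ### Circuits -/

section Circuits

variable {ι : Type*} [DecidableEq ι]

/-- The operator of a list of gates. -/
noncomputable def gatesOp (l : List (Gate ι)) : ((ι → ZMod 2) → ℂ) →ₗ[ℂ] ((ι → ZMod 2) → ℂ) :=
  l.foldl (fun U g => g.op ∘ₗ U) LinearMap.id

theorem foldl_gates_eq (l : List (Gate ι)) (V : ((ι → ZMod 2) → ℂ) →ₗ[ℂ] ((ι → ZMod 2) → ℂ)) :
    l.foldl (fun U g => g.op ∘ₗ U) V = gatesOp l ∘ₗ V := by
  induction l generalizing V with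
  | nil => rfl
  | cons g l ih =>
    rw [gatesOp, List.foldl_cons, List.foldl_cons, ih, ih (g.op ∘ₗ LinearMap.id),
      LinearMap.comp_id, LinearMap.comp_assoc]

theorem gatesOp_cons (g : Gate ι) (l : List (Gate ι)) :
    gatesOp (g :: l) = gatesOp l ∘ₗ g.op := by
  rw [gatesOp, List.foldl_cons, foldl_gates_eq, LinearMap.comp_id]

theorem gatesOp_append (l l' : List (Gate ι)) :
    gatesOp (l ++ l') = gatesOp l' ∘ₗ gatesOp l := by
  rw [gatesOp, List.foldl_append, foldl_gates_eq]
  rfl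

theorem had_had (i : ι) (ψ : (ι → ZMod 2) → ℂ) : (Gate.had i).op ((Gate.had i).op ψ) = ψ := by
  funext x
  have h2 : (((√2 : ℝ) : ℂ)⁻¹) * ((√2 : ℝ) : ℂ)⁻¹ = 1 / 2 := by
    rw [← mul_inv, ← Complex.ofReal_mul, Real.mul_self_sqrt (by norm_num)]
    norm_num
  have hx : ψ x = ψ (Function.update x i (x i)) := by rw [Function.update_eq_self]
  simp only [Gate.op, LinearMap.coe_mk, AddHom.coe_mk, Function.update_idem,
    Function.update_self, ZMod.val_zero, pow_zero, one_mul, ZMod.val_one, pow_one]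
  rw [hx]
  rcases zmod_two_cases (x i) with h | h <;>
    simp only [h, ZMod.val_zero, pow_zero, one_mul, ZMod.val_one, pow_one]
  · linear_combination (2 * ψ (Function.update x i 0)) * h2
  · linear_combination (2 * ψ (Function.update x i 1)) * h2

theorem gate_op_involutive (g : Gate ι) (ψ : (ι → ZMod 2) → ℂ) : g.op (g.op ψ) = ψ := by
  cases g with
  | had i => exact had_had i ψ
  | cnot i j h =>
    funext x
    simp only [Gate.op, LinearMap.coe_mk, AddHom.coe_mk, Function.update_self,
      Function.update_of_ne h, Function.update_idem]
    rw [add_assoc, CharTwo.add_self_eq_zero, add_zero, Function.update_eq_self]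

theorem gatesOp_injective (l : List (Gate ι)) : Function.Injective (gatesOp l) := by
  induction l with
  | nil => exact Function.injective_id
  | cons g l ih =>
    rw [gatesOp_cons, LinearMap.coe_comp]
    exact ih.comp (Function.LeftInverse.injective (gate_op_involutive g))

/-! #### Hadamard gates -/

/-- The states stabilized by `X` on the qubits in `A` and by `Z` on the qubits in `Z`. -/
def xzSpace (A Z : Set ι) : Submodule ℂ ((ι → ZMod 2) → ℂ) where
  carrier := {ψ | (∀ a ∈ A, ∀ x, ψ (x + Pi.single a 1) = ψ x) ∧ ∀ z ∈ Z, ∀ x, x z ≠ 0 → ψ x = 0}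
  add_mem' := by
    rintro ψ φ ⟨h1, h2⟩ ⟨h3, h4⟩
    exact ⟨fun a ha x => by rw [Pi.add_apply, h1 a ha, h3 a ha]; rfl,
      fun z hz x hx => by rw [Pi.add_apply, h2 z hz x hx, h4 z hz x hx, add_zero]⟩
  zero_mem' := ⟨fun _ _ _ => rfl, fun _ _ _ _ => rfl⟩
  smul_mem' := by
    rintro r ψ ⟨h1, h2⟩
    exact ⟨fun a ha x => by rw [Pi.smul_apply, h1 a ha]; rfl,
      fun z hz x hx => by rw [Pi.smul_apply, h2 z hz x hx, smul_zero]⟩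

theorem inputSpace_eq_xzSpace {k : ℕ} (inp : Fin k ↪ ι) :
    inputSpace inp = xzSpace ∅ (Set.range inp)ᶜ := by
  ext ψ
  constructor
  · intro h
    exact ⟨fun a ha => absurd ha (Set.notMem_empty a), fun z hz x hx => h x ⟨z, hz, hx⟩⟩
  · rintro ⟨-, h⟩ x ⟨z, hz, hx⟩
    exact h z hz x hx

theorem update_add_single {a i : ι} (h : a ≠ i) (x : ι → ZMod 2) (v : ZMod 2) :
    Function.update (x + Pi.single a 1) i v = Function.update x i v + Pi.single a 1 := by
  funext j
  by_cases hj : j = i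
  · subst hj
    simp [Pi.single_eq_of_ne h.symm]
  · simp [hj]

theorem had_apply (i : ι) (ψ : (ι → ZMod 2) → ℂ) (x : ι → ZMod 2) :
    (Gate.had i).op ψ x = ((√2 : ℝ) : ℂ)⁻¹ *
      (ψ (Function.update x i 0) + (-1) ^ (x i).val * ψ (Function.update x i 1)) := rfl

theorem had_mem_of_mem_Z {A Z : Set ι} {i : ι} (hi : i ∈ Z) (hiA : i ∉ A)
    {ψ : (ι → ZMod 2) → ℂ} (hψ : ψ ∈ xzSpace A Z) :
    (Gate.had i).op ψ ∈ xzSpace (insert i A) (Z \ {i}) := by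
  have h1 : ∀ x, (Gate.had i).op ψ x = ((√2 : ℝ) : ℂ)⁻¹ * ψ (Function.update x i 0) := by
    intro x
    rw [had_apply, hψ.2 i hi (Function.update x i 1) (by simp), mul_zero, add_zero]
  refine ⟨fun a ha x => ?_, fun z hz x hx => ?_⟩
  · rw [h1, h1]
    rcases ha with rfl | ha
    · congr 2
      funext j
      by_cases hj : j = a
      · subst hj
        simp
      · simp [hj]
    · have hai : a ≠ i := by
        rintro rfl
        exact hiA ha
      rw [update_add_single hai, hψ.1 a ha]
  · have hzi : z ≠ i := hz.2
    rw [h1, hψ.2 z hz.1 _ (by rwa [Function.update_of_ne hzi]), mul_zero]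

theorem had_mem_of_mem_X {A Z : Set ι} {i : ι} (hi : i ∈ A) (hiZ : i ∉ Z)
    {ψ : (ι → ZMod 2) → ℂ} (hψ : ψ ∈ xzSpace A Z) :
    (Gate.had i).op ψ ∈ xzSpace (A \ {i}) (insert i Z) := by
  have h1 : ∀ x, ψ (Function.update x i 1) = ψ (Function.update x i 0) := by
    intro x
    rw [← hψ.1 i hi (Function.update x i 0)]
    congr 1
    funext j
    by_cases hj : j = i
    · subst hj
      simp
    · simp [hj]
  refine ⟨fun a ha x => ?_, fun z hz x hx => ?_⟩
  · have hai : a ≠ i := ha.2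
    rw [had_apply, had_apply, update_add_single hai, update_add_single hai, hψ.1 a ha.1,
      hψ.1 a ha.1, Pi.add_apply, Pi.single_eq_of_ne hai.symm, add_zero]
  · rw [had_apply]
    rcases hz with rfl | hz
    · rw [h1, zmod_two_eq_one hx, ZMod.val_one, pow_one]
      ring
    · have hzi : z ≠ i := by
        rintro rfl
        exact hiZ hz
      rw [hψ.2 z hz _ (by rwa [Function.update_of_ne hzi]),
        hψ.2 z hz _ (by rwa [Function.update_of_ne hzi])]
      simp

/-- One inclusion is `H|0⟩ = |+⟩`; the other is `H|+⟩ = |0⟩`, because `H` is an involution. -/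
theorem map_had {A Z : Set ι} {i : ι} (hi : i ∈ Z) (hiA : i ∉ A) :
    (xzSpace A Z).map (Gate.had i).op = xzSpace (insert i A) (Z \ {i}) := by
  apply le_antisymm
  · rintro _ ⟨ψ, hψ, rfl⟩
    exact had_mem_of_mem_Z hi hiA hψ
  · intro φ hφ
    have h := had_mem_of_mem_X (Set.mem_insert i A) (fun h => h.2 rfl) hφ
    rw [Set.insert_sdiff_of_mem _ (Set.mem_singleton i), Set.sdiff_singleton_eq_self hiA,
      Set.insert_sdiff_singleton, Set.insert_eq_of_mem hi] at h
    exact ⟨_, h, had_had i φ⟩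

theorem map_hads (l : List ι) (hl : l.Nodup) {A Z : Set ι} (hlZ : ∀ i ∈ l, i ∈ Z)
    (hlA : ∀ i ∈ l, i ∉ A) :
    (xzSpace A Z).map (gatesOp (l.map Gate.had)) = xzSpace (A ∪ {i | i ∈ l}) (Z \ {i | i ∈ l}) := by
  induction l generalizing A Z with
  | nil =>
    simp [gatesOp]
  | cons i l ih =>
    rw [List.map_cons, gatesOp_cons, Submodule.map_comp,
      map_had (hlZ i List.mem_cons_self) (hlA i List.mem_cons_self), ih (List.nodup_cons.1 hl).2]
    · congr 1
      · ext j
        simp only [Set.mem_union, Set.mem_insert_iff, Set.mem_ofPred_eq, List.mem_cons]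
        tauto
      · ext j
        simp only [Set.mem_sdiff, Set.mem_singleton_iff, Set.mem_ofPred_eq, List.mem_cons]
        tauto
    · intro j hj
      refine ⟨hlZ j (List.mem_cons_of_mem _ hj), ?_⟩
      rintro rfl
      exact (List.nodup_cons.1 hl).1 hj
    · rintro j hj (rfl | h)
      · exact (List.nodup_cons.1 hl).1 hj
      · exact hlA j (List.mem_cons_of_mem _ hj) h

/-! #### C-NOT gates -/

/-- The C-NOT gate with control `p.1` and target `p.2`, if these are different. -/
def cnotList (p : ι × ι) : List (Gate ι) :=
  if h : p.1 ≠ p.2 then [Gate.cnot p.1 p.2 h] else []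

/-- All controls lie in `A` and all targets outside, so no gate changes a control and the gates act
as one simultaneous addition, in whatever order. -/
theorem gatesOp_cnots (A : Set ι) (l : List (ι × ι)) (hl : ∀ p ∈ l, p.1 ∈ A ∧ p.2 ∉ A)
    (ψ : (ι → ZMod 2) → ℂ) (x : ι → ZMod 2) :
    gatesOp (l.flatMap cnotList) ψ x =
      ψ fun t => x t + (l.map fun p => if p.2 = t then x p.1 else 0).sum := by
  induction l generalizing ψ with
  | nil => simp [gatesOp]
  | cons p l ih =>
    have hp := hl p List.mem_cons_self
    have hne : p.1 ≠ p.2 := fun h => hp.2 (h ▸ hp.1)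
    have hl' : ∀ q ∈ l, q.1 ∈ A ∧ q.2 ∉ A := fun q hq => hl q (List.mem_cons_of_mem _ hq)
    have hzero : (l.map fun q => if q.2 = p.1 then x q.1 else 0).sum = 0 := by
      refine List.sum_eq_zero fun a ha => ?_
      obtain ⟨q, hq, rfl⟩ := List.mem_map.1 ha
      exact if_neg fun h : q.2 = p.1 => (hl' q hq).2 (h ▸ hp.1)
    rw [List.flatMap_cons, gatesOp_append, LinearMap.comp_apply, ih hl']
    have hop : ∀ y, gatesOp (cnotList p) ψ y = ψ (Function.update y p.2 (y p.2 + y p.1)) := by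
      intro y
      rw [cnotList, dif_pos hne]
      rfl
    rw [hop]
    congr 1
    funext t
    rw [List.map_cons, List.sum_cons, hzero, add_zero]
    by_cases ht : t = p.2
    · subst ht
      rw [Function.update_self, if_pos rfl]
      ring
    · rw [Function.update_of_ne ht, if_neg (fun h => ht h.symm), zero_add]

/-- C-NOT gates for the given pairs, scheduled in `w` layers. -/
noncomputable def cnotLayers (pairs : Finset (ι × ι)) {w : ℕ} (κ : ι × ι → Fin w) :
    List (List (Gate ι)) :=
  (List.finRange w).map fun ℓ => (pairs.filter fun p => κ p = ℓ).toList.flatMap cnotList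

/-- `κ` is a proper edge colouring: gates of one colour share neither control nor target, and `A`
separates controls from targets. -/
theorem cnotLayers_disjoint {A : Set ι} {pairs : Finset (ι × ι)} {w : ℕ} {κ : ι × ι → Fin w}
    (hA : ∀ p ∈ pairs, p.1 ∈ A ∧ p.2 ∉ A)
    (hκ : ∀ p ∈ pairs, ∀ p' ∈ pairs, κ p = κ p' → p.1 = p'.1 ∨ p.2 = p'.2 → p = p') :
    ∀ L ∈ cnotLayers pairs κ, L.Pairwise fun g h => Disjoint g.support h.support := by
  intro L hL
  obtain ⟨ℓ, -, rfl⟩ := List.mem_map.1 hL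
  rw [List.pairwise_flatMap]
  refine ⟨fun p _ => ?_, ?_⟩
  · unfold cnotList
    split_ifs <;> simp
  · refine List.Pairwise.imp_of_mem ?_ (nodup_toList _)
    intro p p' hp hp' hne g hg g' hg'
    rw [mem_toList, mem_filter] at hp hp'
    unfold cnotList at hg hg'
    split_ifs at hg hg' with h1 h2 <;> try simp at hg hg'
    subst hg hg'
    have h3 : p.1 ≠ p'.1 := fun h => hne (hκ p hp.1 p' hp'.1 (hp.2.trans hp'.2.symm) (Or.inl h))
    have h4 : p.2 ≠ p'.2 := fun h => hne (hκ p hp.1 p' hp'.1 (hp.2.trans hp'.2.symm) (Or.inr h))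
    have h5 : p.1 ≠ p'.2 := fun h => (hA p' hp'.1).2 (h ▸ (hA p hp.1).1)
    have h6 : p.2 ≠ p'.1 := fun h => (hA p hp.1).2 (h ▸ (hA p' hp'.1).1)
    simp [Gate.support, h3.symm, h4.symm, h5.symm, h6.symm]

theorem length_cnotLayers (pairs : Finset (ι × ι)) {w : ℕ} (κ : ι × ι → Fin w) :
    (cnotLayers pairs κ).length = w := by
  simp [cnotLayers]

theorem length_flatten_cnotLayers_le (pairs : Finset (ι × ι)) {w : ℕ} (κ : ι × ι → Fin w) :
    (cnotLayers pairs κ).flatten.length ≤ pairs.card := by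
  rw [cnotLayers, List.length_flatten, List.map_map,
    card_eq_sum_card_fiberwise (f := κ) (t := univ) (by simp), ← List.ofFn_eq_map,
    List.sum_ofFn]
  refine sum_le_sum fun ℓ _ => ?_
  rw [Function.comp_apply, List.length_flatMap, ← length_toList]
  have : ∀ l : List (ι × ι), (l.map fun p => (cnotList p).length).sum ≤ l.length := by
    intro l
    induction l with
    | nil => simp
    | cons p l ih =>
      rw [List.map_cons, List.sum_cons, List.length_cons]
      have : (cnotList p).length ≤ 1 := by
        unfold cnotList
        split_ifs <;> simp
      omega
  exact this _

theorem gatesOp_cnotLayers {A : Set ι} {pairs : Finset (ι × ι)} {w : ℕ} (κ : ι × ι → Fin w)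
    (hA : ∀ p ∈ pairs, p.1 ∈ A ∧ p.2 ∉ A) (ψ : (ι → ZMod 2) → ℂ) (x : ι → ZMod 2) :
    gatesOp (cnotLayers pairs κ).flatten ψ x =
      ψ fun t => x t + ∑ p ∈ pairs, if p.2 = t then x p.1 else 0 := by
  have hflat : (cnotLayers pairs κ).flatten =
      ((List.finRange w).flatMap fun ℓ => (pairs.filter fun p => κ p = ℓ).toList).flatMap
        cnotList := by
    rw [cnotLayers, List.flatMap_assoc, List.flatMap_def]
  rw [hflat, gatesOp_cnots A]
  · congr 1
    funext t
    rw [List.map_flatMap, List.flatMap_def, List.sum_flatten, List.map_map, ← List.ofFn_eq_map,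
      List.sum_ofFn, ← sum_fiberwise pairs κ]
    congr 1
    exact sum_congr rfl fun ℓ _ => sum_map_toList _ _
  · intro p hp
    obtain ⟨ℓ, -, hp⟩ := List.mem_flatMap.1 hp
    rw [mem_toList, mem_filter] at hp
    exact hA p hp.1

/-! #### Dimension of the input space -/

/-- Amplitudes are arbitrary on the basis vectors that vanish off `inp`, of which there are `2 ^ k`,
and zero elsewhere. -/
theorem finrank_inputSpace {k : ℕ} (inp : Fin k ↪ ι) :
    Module.finrank ℂ (inputSpace inp) = 2 ^ k := by
  classical
  let φ : inputSpace inp →ₗ[ℂ] ((Fin k → ZMod 2) → ℂ) :=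
    { toFun := fun ψ y => ψ.val (Function.extend inp y 0)
      map_add' := fun _ _ => rfl
      map_smul' := fun _ _ => rfl }
  have hext : ∀ x : ι → ZMod 2, (∀ i, i ∉ Set.range inp → x i = 0) →
      Function.extend inp (x ∘ inp) 0 = x := by
    intro x hx
    funext i
    by_cases hi : i ∈ Set.range inp
    · obtain ⟨j, rfl⟩ := hi
      rw [inp.injective.extend_apply, Function.comp_apply]
    · rw [Function.extend_apply' _ _ _ hi, hx i hi, Pi.zero_apply]
  have hinj : Function.Injective φ := by
    intro ψ ψ' h
    apply Subtype.ext
    funext x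
    by_cases hx : ∃ i, i ∉ Set.range inp ∧ x i ≠ 0
    · rw [ψ.2 x hx, ψ'.2 x hx]
    · push Not at hx
      have := congrFun h (x ∘ inp)
      change ψ.val (Function.extend inp (x ∘ inp) 0) =
        ψ'.val (Function.extend inp (x ∘ inp) 0) at this
      rwa [hext x hx] at this
  have hsurj : Function.Surjective φ := by
    intro χ
    refine ⟨⟨fun x => if ∃ i, i ∉ Set.range inp ∧ x i ≠ 0 then 0 else χ (x ∘ inp),
      fun x hx => if_pos hx⟩, ?_⟩
    funext y
    change (if ∃ i, i ∉ Set.range inp ∧ Function.extend inp y 0 i ≠ 0 then (0 : ℂ) else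
      χ (Function.extend inp y 0 ∘ inp)) = χ y
    rw [if_neg, Function.extend_comp inp.injective]
    rintro ⟨i, hi, h⟩
    exact h (Function.extend_apply' _ _ _ hi)
  rw [(LinearEquiv.ofBijective φ ⟨hinj, hsurj⟩).finrank_eq, Module.finrank_fintype_fun_eq_card]
  simp [ZMod.card]

/-- Gates are involutions, so the circuit is injective and the code inherits the dimension of the
input space; the stabilizers need not be counted. -/
theorem Circuit.Encodes.finrank_eq {C : Circuit ι} {k : ℕ}
    {Q : Submodule ℂ ((ι → ZMod 2) → ℂ)} (h : C.Encodes k Q) : Module.finrank ℂ Q = 2 ^ k := by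
  obtain ⟨inp, rfl⟩ := h
  have hinj : Function.Injective C.op := gatesOp_injective _
  rw [← (Submodule.equivMapOfInjective C.op hinj (inputSpace inp)).finrank_eq, finrank_inputSpace]

end Circuits

/-! ### The encoder -/

/-- The vectors `u` with `X(u) φ = φ`. -/
def transStab {ι : Type*} (φ : (ι → ZMod 2) → ℂ) : Submodule (ZMod 2) (ι → ZMod 2) where
  carrier := {u | ∀ x, φ (x + u) = φ x}
  add_mem' := by
    intro u v hu hv x
    rw [← add_assoc, hv, hu]
  zero_mem' := fun x => by rw [add_zero]
  smul_mem' := by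
    intro r u hu x
    rcases zmod_two_cases r with rfl | rfl
    · rw [zero_smul, add_zero]
    · rw [one_smul, hu]

theorem mem_transStab {ι : Type*} {φ : (ι → ZMod 2) → ℂ} {u : ι → ZMod 2} :
    u ∈ transStab φ ↔ ∀ x, φ (x + u) = φ x := Iff.rfl

theorem pauliX_eq_self_iff {ι : Type*} {φ : (ι → ZMod 2) → ℂ} {u : ι → ZMod 2} :
    pauliX u φ = φ ↔ u ∈ transStab φ := by
  rw [mem_transStab, funext_iff]
  refine forall_congr' fun x => ?_
  have h : x - u = x + u := funext fun i => CharTwo.sub_eq_add _ _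
  rw [← h]
  rfl

theorem pauliZ_eq_self_iff {ι : Type*} [Fintype ι] {φ : (ι → ZMod 2) → ℂ} {v : ι → ZMod 2} :
    pauliZ v φ = φ ↔ ∀ x, v ⬝ᵥ x ≠ 0 → φ x = 0 := by
  rw [funext_iff]
  refine forall_congr' fun x => ?_
  change (-1) ^ (v ⬝ᵥ x).val * φ x = φ x ↔ _
  rcases zmod_two_cases (v ⬝ᵥ x) with h | h <;> rw [h]
  · simp
  · rw [ZMod.val_one, pow_one]
    simp only [ne_eq, one_ne_zero, not_false_eq_true, forall_const]
    constructor
    · intro h'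
      linear_combination (-1 / 2) * h'
    · intro h'
      rw [h', mul_zero]

section Encoder

variable {m B n : ℕ}

/-- The translations fixing a state form a subspace, so the rows of `H` may be replaced by their
span, hence by systematic generators. The `Z`-conditions together confine the state to the inner
code. -/
theorem mem_cssSpace_iff {H : Matrix (Fin m) (Fin B) (ZMod 2)}
    {φ : (Fin B × Fin n → ZMod 2) → ℂ} :
    φ ∈ cssSpace (pcX n H) (innerCheck B n) ↔
      Submodule.span (ZMod 2) (Set.range H.row) ≤ (transStab φ).comap (rep n) ∧
        ∀ x, x ∉ codeOf (innerCheck B n) → φ x = 0 := by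
  refine and_congr ?_ ?_
  · rw [Submodule.span_le, Set.range_subset_iff]
    refine forall_congr' fun i => ?_
    rw [pauliX_eq_self_iff, pcX_eq_rep]
    rfl
  · simp only [pauliZ_eq_self_iff]
    constructor
    · intro h x hx
      have : (innerCheck B n).mulVec x ≠ 0 := hx
      obtain ⟨q, hq⟩ := Function.ne_iff.1 this
      exact h q x hq
    · intro h q x hx
      refine h x fun hx' => hx ?_
      have : (innerCheck B n).mulVec x = 0 := hx'
      exact congrFun this q

/-- Adding the entry number `z` of every block to all other entries of the block. -/
def copyMap (z : Fin n) : (Fin B × Fin n → ZMod 2) →+ (Fin B × Fin n → ZMod 2) where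
  toFun x q := x q + if q.2 = z then 0 else x (q.1, z)
  map_zero' := by
    funext q
    simp
  map_add' x y := by
    funext q
    simp only [Pi.add_apply]
    split_ifs <;> ring

/-- Adding to the entries `(b, z)`, `b ∉ P`, the combination of the entries `(p, z)`, `p ∈ P`, with
the coefficients `g p b`. -/
def mixMap (z : Fin n) (P : Finset (Fin B)) (g : Fin B → Fin B → ZMod 2) :
    (Fin B × Fin n → ZMod 2) →+ (Fin B × Fin n → ZMod 2) where
  toFun x q := x q + if q.2 = z ∧ q.1 ∉ P then ∑ p ∈ P, g p q.1 * x (p, z) else 0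
  map_zero' := by
    funext q
    simp
  map_add' x y := by
    funext q
    simp only [Pi.add_apply, mul_add, sum_add_distrib]
    split_ifs <;> ring

theorem copyMap_apply (z : Fin n) (x : Fin B × Fin n → ZMod 2) (q : Fin B × Fin n) :
    copyMap z x q = x q + if q.2 = z then 0 else x (q.1, z) := rfl

theorem mixMap_apply (z : Fin n) (P : Finset (Fin B)) (g : Fin B → Fin B → ZMod 2)
    (x : Fin B × Fin n → ZMod 2) (q : Fin B × Fin n) :
    mixMap z P g x q = x q + if q.2 = z ∧ q.1 ∉ P then ∑ p ∈ P, g p q.1 * x (p, z) else 0 := rfl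

theorem copyMap_copyMap (z : Fin n) (x : Fin B × Fin n → ZMod 2) :
    copyMap z (copyMap z x) = x := by
  funext q
  simp only [copyMap_apply]
  split_ifs <;> simp [add_assoc, CharTwo.add_self_eq_zero]

theorem mixMap_mixMap (z : Fin n) (P : Finset (Fin B)) (g : Fin B → Fin B → ZMod 2)
    (x : Fin B × Fin n → ZMod 2) : mixMap z P g (mixMap z P g x) = x := by
  funext q
  have h : ∀ p ∈ P, mixMap z P g x (p, z) = x (p, z) := by
    intro p hp
    simp [mixMap_apply, hp]
  rw [mixMap_apply, sum_congr rfl fun p hp => by rw [h p hp], mixMap_apply, add_assoc,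
    CharTwo.add_self_eq_zero, add_zero]

theorem mixMap_copyMap_of_ne {z : Fin n} {P : Finset (Fin B)} {g : Fin B → Fin B → ZMod 2}
    (x : Fin B × Fin n → ZMod 2) {b : Fin B} {j : Fin n} (hj : j ≠ z) :
    mixMap z P g (copyMap z x) (b, j) = x (b, j) + x (b, z) := by
  simp [mixMap_apply, copyMap_apply, hj]

/-- The heart of the encoder. Copying collapses a repeated vector to its entries at position `z`;
mixing then cancels the entries outside `P`, since `g p` restricts on `P` to the unit vector at `p`.
An `X`-stabilizer generator thus becomes an `X` on a single qubit. -/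
theorem mixMap_copyMap_rep {z : Fin n} {P : Finset (Fin B)} {g : Fin B → Fin B → ZMod 2}
    (hδ : ∀ p ∈ P, ∀ p' ∈ P, g p p' = if p = p' then 1 else 0) {p : Fin B} (hp : p ∈ P) :
    mixMap z P g (copyMap z (rep n (g p))) = Pi.single (p, z) 1 := by
  funext ⟨b, j⟩
  by_cases hj : j = z
  · subst hj
    have hsum : ∀ b, ∑ p' ∈ P, g p' b * g p p' = g p b := by
      intro b
      rw [sum_congr rfl fun p' hp' => by rw [hδ p hp p' hp']]
      simp [hp]
    simp only [mixMap_apply, copyMap_apply, rep_apply, if_true, add_zero, hsum, true_and]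
    by_cases hb : b ∈ P
    · rw [if_neg (not_not.2 hb), add_zero, hδ p hp b hb]
      by_cases h : p = b
      · subst h
        simp
      · rw [if_neg h, Pi.single_eq_of_ne]
        intro h'
        exact h (congrArg Prod.fst h').symm
    · rw [if_pos hb, CharTwo.add_self_eq_zero, Pi.single_eq_of_ne]
      intro h'
      have h'' : b = p := congrArg Prod.fst h'
      exact hb (h'' ▸ hp)
  · rw [mixMap_copyMap_of_ne _ hj, rep_apply, rep_apply, CharTwo.add_self_eq_zero,
      Pi.single_eq_of_ne]
    intro h'
    exact hj (congrArg Prod.snd h')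

/-- With `M` the composite of copying and mixing, `ψ ∘ M` is invariant under `u` when `ψ` is
invariant under `M u`, and `M` sends the generators to unit vectors. Off position `z` the entries of
`M x` are `x (b, j) + x (b, z)`, and they all vanish exactly when `x` is block-constant. -/
theorem map_xzSpace_eq_cssSpace {H : Matrix (Fin m) (Fin B) (ZMod 2)} (z : Fin n)
    {P : Finset (Fin B)} {g : Fin B → Fin B → ZMod 2}
    (hg : ∀ p ∈ P, g p ∈ Submodule.span (ZMod 2) (Set.range H.row))
    (hδ : ∀ p ∈ P, ∀ p' ∈ P, g p p' = if p = p' then 1 else 0)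
    (hsum : ∀ r ∈ Submodule.span (ZMod 2) (Set.range H.row), r = ∑ p ∈ P, r p • g p)
    {U : ((Fin B × Fin n → ZMod 2) → ℂ) →ₗ[ℂ] ((Fin B × Fin n → ZMod 2) → ℂ)}
    (hU : ∀ ψ x, U ψ x = ψ (mixMap z P g (copyMap z x))) :
    (xzSpace {q | q.1 ∈ P ∧ q.2 = z} {q : Fin B × Fin n | q.2 ≠ z}).map U =
      cssSpace (pcX n H) (innerCheck B n) := by
  ext φ
  rw [mem_cssSpace_iff, Submodule.mem_map]
  constructor
  · rintro ⟨ψ, ⟨hX, hZ⟩, rfl⟩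
    constructor
    · intro r hr
      rw [hsum r hr]
      refine Submodule.sum_mem _ fun p hp => Submodule.smul_mem _ _ ?_
      intro x
      rw [hU, hU, map_add, map_add, mixMap_copyMap_rep hδ hp, hX _ ⟨hp, rfl⟩]
    · intro x hx
      rw [mem_codeOf_innerCheck] at hx
      have : ∃ b j, x (b, j) ≠ x (b, z) := by
        by_contra! h
        exact hx fun b j j' => by rw [h b j, h b j']
      obtain ⟨b, j, hbj⟩ := this
      have hj : j ≠ z := by
        rintro rfl
        exact hbj rfl
      rw [hU]
      refine hZ (b, j) hj _ ?_
      rw [mixMap_copyMap_of_ne x hj]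
      exact fun h => hbj (CharTwo.add_eq_zero.1 h)
  · rintro ⟨hX, hZ⟩
    -- The preimage is `φ ∘ M⁻¹`: both factors of `M` are involutions, so the inverse applies them
    -- in the opposite order.
    refine ⟨fun x => φ (copyMap z (mixMap z P g x)), ⟨?_, ?_⟩, ?_⟩
    · rintro ⟨p, _⟩ ⟨hp, rfl⟩ x
      simp only
      rw [← mixMap_copyMap_rep hδ hp, map_add, map_add, mixMap_mixMap, copyMap_copyMap]
      exact hX (hg p hp) _
    · rintro ⟨b, j⟩ hj x hx
      refine hZ _ fun h => hx ?_
      have h1 := mixMap_copyMap_of_ne (P := P) (g := g) (copyMap z (mixMap z P g x)) (b := b) hj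
      rwa [copyMap_copyMap, mixMap_mixMap, mem_codeOf_innerCheck.1 h b j z,
        CharTwo.add_self_eq_zero] at h1
    · funext x
      rw [hU, mixMap_mixMap, copyMap_copyMap]

/-- The C-NOT gates between different blocks. -/
def mixPairs (z : Fin n) (P : Finset (Fin B)) (g : Fin B → Fin B → ZMod 2) :
    Finset ((Fin B × Fin n) × (Fin B × Fin n)) :=
  univ.filter fun e => (e.1.2 = z ∧ e.1.1 ∈ P) ∧ (e.2.2 = z ∧ e.2.1 ∉ P) ∧ g e.1.1 e.2.1 ≠ 0

/-- The C-NOT gates within the blocks. -/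
def copyPairs (z : Fin n) : Finset ((Fin B × Fin n) × (Fin B × Fin n)) :=
  univ.filter fun e => e.1 = (e.2.1, z) ∧ e.2.2 ≠ z

theorem card_mixPairs_le (z : Fin n) (P : Finset (Fin B)) (g : Fin B → Fin B → ZMod 2) :
    (mixPairs z P g).card ≤ B ^ 2 := by
  have h : (univ : Finset (Fin B × Fin B)).card = B ^ 2 := by simp [sq]
  rw [← h]
  refine card_le_card_of_injOn (fun e => (e.1.1, e.2.1)) (by simp) ?_
  rintro ⟨⟨a, b⟩, ⟨c, d⟩⟩ h1 ⟨⟨a', b'⟩, ⟨c', d'⟩⟩ h2 h3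
  simp only [mixPairs, coe_filter, mem_univ, true_and, Set.mem_ofPred_eq, Prod.mk.injEq] at *
  obtain ⟨⟨rfl, -⟩, ⟨rfl, -⟩, -⟩ := h1
  obtain ⟨⟨rfl, -⟩, ⟨rfl, -⟩, -⟩ := h2
  exact ⟨⟨h3.1, rfl⟩, h3.2, rfl⟩

theorem card_copyPairs_le (z : Fin n) : (copyPairs (B := B) z).card ≤ B * n := by
  have h : (univ : Finset (Fin B × Fin n)).card = B * n := by simp
  rw [← h]
  refine card_le_card_of_injOn (fun e => e.2) (by simp) ?_
  rintro ⟨p, q⟩ h1 ⟨p', q'⟩ h2 h3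
  simp only [copyPairs, coe_filter, mem_univ, true_and, Set.mem_ofPred_eq] at h1 h2 h3
  subst h3
  rw [h1.1, h2.1]

theorem sum_mixPairs (z : Fin n) (P : Finset (Fin B)) (g : Fin B → Fin B → ZMod 2)
    (x : Fin B × Fin n → ZMod 2) :
    (fun t => x t + ∑ e ∈ mixPairs z P g, if e.2 = t then x e.1 else 0) = mixMap z P g x := by
  funext t
  rw [mixMap_apply]
  congr 1
  rw [mixPairs, sum_filter, Fintype.sum_prod_type]
  have h1 : ∀ p : Fin B × Fin n, (∑ q : Fin B × Fin n,
      if (p.2 = z ∧ p.1 ∈ P) ∧ (q.2 = z ∧ q.1 ∉ P) ∧ g p.1 q.1 ≠ 0 then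
        if q = t then x p else 0 else 0) =
      if p.2 = z then if p.1 ∈ P then
        if t.2 = z ∧ t.1 ∉ P then g p.1 t.1 * x p else 0 else 0 else 0 := by
    intro p
    rw [sum_eq_single t]
    · rcases zmod_two_cases (g p.1 t.1) with h | h <;> simp only [h] <;> split_ifs <;>
        simp_all
    · intro q _ hq
      simp [hq]
    · simp
  simp only [h1, Fintype.sum_prod_type, sum_ite_eq', mem_univ, if_true]
  rw [sum_ite_mem, univ_inter]
  split_ifs <;> simp

theorem sum_copyPairs (z : Fin n) (x : Fin B × Fin n → ZMod 2) :
    (fun t => x t + ∑ e ∈ copyPairs z, if e.2 = t then x e.1 else 0) = copyMap z x := by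
  funext t
  rw [copyMap_apply]
  congr 1
  rw [copyPairs, sum_filter, Fintype.sum_prod_type, sum_comm, sum_eq_single t]
  · rw [sum_eq_single (t.1, z)]
    · simp
    · intro p _ hp
      simp [hp]
    · simp
  · intro q _ hq
    simp [hq]
  · simp

/-- The inputs are the qubits `(b, z)` with `b ∉ P`. One layer of Hadamard gates acts on the pivots
`(p, z)`, then `B` layers mix between blocks and `n` layers copy within blocks. -/
theorem exists_encoder (hB : 0 < B) (hn : 0 < n) (H : Matrix (Fin m) (Fin B) (ZMod 2)) :
    ∃ C : Circuit (Fin B × Fin n),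
      C.Encodes (Module.finrank (ZMod 2) (codeOf H)) (cssSpace (pcX n H) (innerCheck B n)) ∧
        C.size ≤ B + B ^ 2 + B * n ∧ C.depth ≤ 1 + B + n := by
  have : NeZero B := ⟨hB.ne'⟩
  obtain ⟨P, g, hg, hδ, hsum⟩ :=
    exists_systematic_generators (Submodule.span (ZMod 2) (Set.range H.row))
  have hk := finrank_codeOf_eq H hg hδ hsum
  set z : Fin n := ⟨0, hn⟩
  set pivots : List (Fin B × Fin n) := P.toList.map fun p => (p, z) with hpivots
  have hmemp : ∀ q, q ∈ pivots ↔ q.1 ∈ P ∧ q.2 = z := by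
    rintro ⟨b, j⟩
    simp [hpivots, eq_comm]
  have hnodup : pivots.Nodup :=
    (nodup_toList P).map fun a b h => congrArg Prod.fst h
  set hads : List (Gate (Fin B × Fin n)) := pivots.map Gate.had with hhads
  -- Addition in `Fin B` is cyclic, so the sum of the block numbers is a Latin square: `B` colours
  -- suffice for the bipartite graph between `P` and its complement.
  set mix := cnotLayers (mixPairs z P g) fun e => e.1.1 + e.2.1 with hmix
  -- Gates with the same target position lie in different blocks.
  set copy := cnotLayers (copyPairs (B := B) z) fun e => e.2.2 with hcopy
  have hmixA : ∀ e ∈ mixPairs z P g, e.1 ∈ {q : Fin B × Fin n | q.1 ∈ P} ∧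
      e.2 ∉ {q : Fin B × Fin n | q.1 ∈ P} := by
    intro e he
    obtain ⟨h1, h2, -⟩ := (mem_filter.1 he).2
    exact ⟨h1.2, h2.2⟩
  have hcopyA : ∀ e ∈ copyPairs (B := B) z, e.1 ∈ {q : Fin B × Fin n | q.2 = z} ∧
      e.2 ∉ {q : Fin B × Fin n | q.2 = z} := by
    intro e he
    obtain ⟨h1, h2⟩ := (mem_filter.1 he).2
    exact ⟨congrArg Prod.snd h1, h2⟩
  let C : Circuit (Fin B × Fin n) :=
    { layers := hads :: (mix ++ copy)
      disjoint := by
        intro L hL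
        rw [List.mem_cons, List.mem_append] at hL
        rcases hL with rfl | hL | hL
        · rw [hhads, List.pairwise_map]
          refine List.Pairwise.imp ?_ hnodup
          intro a b hab
          simpa [Gate.support] using hab
        · refine cnotLayers_disjoint hmixA ?_ L hL
          rintro ⟨⟨a, b⟩, ⟨c, d⟩⟩ h1 ⟨⟨a', b'⟩, ⟨c', d'⟩⟩ h2 h3 h4
          obtain ⟨⟨h5, -⟩, ⟨h6, -⟩, -⟩ := (mem_filter.1 h1).2
          obtain ⟨⟨h7, -⟩, ⟨h8, -⟩, -⟩ := (mem_filter.1 h2).2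
          simp only [Prod.mk.injEq] at *
          subst h5 h6 h7 h8
          rcases h4 with ⟨rfl, -⟩ | ⟨rfl, -⟩
          · exact ⟨⟨rfl, rfl⟩, add_left_cancel h3, rfl⟩
          · exact ⟨⟨add_right_cancel h3, rfl⟩, rfl, rfl⟩
        · refine cnotLayers_disjoint hcopyA ?_ L hL
          rintro ⟨p, ⟨b, j⟩⟩ h1 ⟨p', ⟨b', j'⟩⟩ h2 h3 h4
          have h5 := ((mem_filter.1 h1).2).1
          have h6 := ((mem_filter.1 h2).2).1
          simp only [Prod.mk.injEq] at *
          subst h5 h6 h3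
          rcases h4 with h4 | h4
          · obtain ⟨rfl, -⟩ := Prod.mk.inj h4
            exact ⟨rfl, rfl, rfl⟩
          · obtain ⟨rfl, -⟩ := h4
            exact ⟨rfl, rfl, rfl⟩ }
  refine ⟨C, ?_, ?_, ?_⟩
  · rw [hk]
    set inp : Fin Pᶜ.card ↪ Fin B × Fin n :=
      ⟨fun i => ((Pᶜ.equivFin.symm i).val, z), fun i j h => by
        simpa using Subtype.ext (congrArg Prod.fst h)⟩ with hinp
    have hrange : ∀ q, q ∈ Set.range inp ↔ q.1 ∉ P ∧ q.2 = z := by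
      rintro ⟨b, j⟩
      constructor
      · rintro ⟨i, hi⟩
        obtain ⟨rfl, rfl⟩ := Prod.mk.inj hi
        exact ⟨mem_compl.1 (Pᶜ.equivFin.symm i).2, rfl⟩
      · rintro ⟨h1, h2⟩
        subst h2
        refine ⟨Pᶜ.equivFin ⟨b, mem_compl.2 h1⟩, ?_⟩
        change ((Pᶜ.equivFin.symm (Pᶜ.equivFin ⟨b, _⟩)).val, z) = (b, z)
        rw [Equiv.symm_apply_apply]
    refine ⟨inp, ?_⟩
    have hop : C.op = gatesOp (mix ++ copy).flatten ∘ₗ gatesOp hads := gatesOp_append _ _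
    rw [hop, Submodule.map_comp, inputSpace_eq_xzSpace, hhads, map_hads _ hnodup]
    · rw [← map_xzSpace_eq_cssSpace (U := gatesOp (mix ++ copy).flatten) z hg hδ hsum]
      · congr 2
        · ext q
          simp [hmemp]
        · ext q
          simp only [Set.mem_sdiff, Set.mem_compl_iff, hrange, Set.mem_ofPred_eq, hmemp]
          tauto
      · intro ψ x
        -- Gates act on states by precomposition, so the copying layers, though executed last, act
        -- first on `x`.
        rw [List.flatten_append, gatesOp_append, LinearMap.comp_apply,
          gatesOp_cnotLayers _ hcopyA, sum_copyPairs, gatesOp_cnotLayers _ hmixA, sum_mixPairs]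
    · intro q hq
      rw [Set.mem_compl_iff, hrange]
      exact fun h => h.1 ((hmemp q).1 hq).1
    · exact fun q _ => Set.notMem_empty q
  · change (hads :: (mix ++ copy)).flatten.length ≤ _
    rw [List.flatten_cons, List.flatten_append, List.length_append, List.length_append]
    have h1 : hads.length ≤ B := by
      rw [hhads, List.length_map, hpivots, List.length_map, length_toList]
      simpa using P.card_le_univ
    have h2 : mix.flatten.length ≤ B ^ 2 :=
      (length_flatten_cnotLayers_le _ _).trans (card_mixPairs_le z P g)
    have h3 : copy.flatten.length ≤ B * n :=
      (length_flatten_cnotLayers_le _ _).trans (card_copyPairs_le z)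
    omega
  · change (hads :: (mix ++ copy)).length ≤ _
    rw [List.length_cons, List.length_append, hmix, hcopy, length_cnotLayers, length_cnotLayers]
    omega

end Encoder

/-! ### Total correctness with running times -/

/-- Started in `s`, the command `c` halts within `T` steps in a memory with the property `Q`. -/
def Run (W P : ℕ) (c : Cmd) (s : Mem) (T : ℕ) (Q : Mem → Prop) : Prop :=
  ∃ t s', t ≤ T ∧ Exec W P c s t s' ∧ Q s'

namespace Run

variable {W P : ℕ}

theorem mono {c : Cmd} {s : Mem} {T T' : ℕ} {Q Q' : Mem → Prop} (h : Run W P c s T Q)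
    (hT : T ≤ T') (hQ : ∀ s', Q s' → Q' s') : Run W P c s T' Q' := by
  obtain ⟨t, s', ht, he, hq⟩ := h
  exact ⟨t, s', ht.trans hT, he, hQ s' hq⟩

theorem skip {s : Mem} {Q : Mem → Prop} (h : Q s) : Run W P Cmd.skip s 1 Q :=
  ⟨1, s, le_rfl, Exec.skip s, h⟩

theorem seq {c d : Cmd} {s : Mem} {T T' : ℕ} {Q Q' : Mem → Prop} (h : Run W P c s T Q)
    (h' : ∀ s', Q s' → Run W P d s' T' Q') : Run W P (Cmd.seq c d) s (T + T') Q' := by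
  obtain ⟨t, s', ht, he, hq⟩ := h
  obtain ⟨t', s'', ht', he', hq'⟩ := h' s' hq
  exact ⟨t + t', s'', Nat.add_le_add ht ht', Exec.seq _ _ _ _ _ _ _ he he', hq'⟩

theorem ite {e : Expr} {c d : Cmd} {s : Mem} {T : ℕ} {Q : Mem → Prop}
    (h₁ : e.eval s 0 ≠ 0 → Run W P c s T Q) (h₂ : e.eval s 0 = 0 → Run W P d s T Q) :
    Run W P (Cmd.ite e c d) s (T + 1) Q := by
  by_cases h : e.eval s 0 = 0
  · obtain ⟨t, s', ht, he, hq⟩ := h₂ h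
    exact ⟨t + 1, s', Nat.add_le_add_right ht 1, Exec.iteFalse _ _ _ _ _ _ h he, hq⟩
  · obtain ⟨t, s', ht, he, hq⟩ := h₁ h
    exact ⟨t + 1, s', Nat.add_le_add_right ht 1, Exec.iteTrue _ _ _ _ _ _ h he, hq⟩

/-- A loop with invariant `I` and variant `μ`. -/
theorem loop {e : Expr} {c : Cmd} (I : Mem → Prop) (μ : Mem → ℕ) {τ : ℕ}
    (h : ∀ s, I s → e.eval s 0 ≠ 0 → Run W P c s τ fun s' => I s' ∧ μ s' < μ s)
    {s : Mem} (hs : I s) :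
    Run W P (Cmd.loop e c) s ((τ + 1) * μ s + 1) fun s' => I s' ∧ e.eval s' 0 = 0 := by
  induction hn : μ s using Nat.strong_induction_on generalizing s with
  | _ n ih =>
    subst hn
    by_cases he : e.eval s 0 = 0
    · exact ⟨1, s, by omega, Exec.loopDone _ _ _ he, hs, he⟩
    · obtain ⟨t, s', ht, hex, hI, hμ⟩ := h s hs he
      obtain ⟨t', s'', ht', hex', hq⟩ := ih _ hμ hI rfl
      refine ⟨t + t' + 1, s'', ?_, Exec.loopStep _ _ _ _ _ _ _ he hex hex', hq⟩
      have := Nat.mul_le_mul_left (τ + 1) (Nat.succ_le_of_lt hμ)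
      rw [Nat.succ_eq_add_one, mul_add, mul_one] at this
      omega

end Run

/-- The memory `s` with cell `i` of array `a` overwritten by `v`. -/
def Mem.set (s : Mem) (a i v : ℕ) : Mem := fun b j => if b = a ∧ j = i then v else s b j

theorem Mem.set_of_ne {s : Mem} {a i v b : ℕ} (h : b ≠ a) : s.set a i v b = s b := by
  funext j
  simp [Mem.set, h]

theorem Mem.set_same {s : Mem} {a i v : ℕ} : s.set a i v a i = v := by
  simp [Mem.set]

theorem Mem.set_of_ne_idx {s : Mem} {a i v b j : ℕ} (h : j ≠ i) : s.set a i v b j = s b j := by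
  simp [Mem.set, h]

/-- One processor executes `a[addr] := val`. -/
def assign (a : ℕ) (addr val : Expr) : Cmd := Cmd.par (Expr.const 1) (Expr.const 1) a addr val

theorem Run.assign {W P : ℕ} (hP : 1 ≤ P) {a : ℕ} {addr val : Expr} {s : Mem} {Q : Mem → Prop}
    (h₁ : addr.eval s 0 ≤ W) (h₂ : val.eval s 0 ≤ W)
    (hQ : Q (s.set a (addr.eval s 0) (val.eval s 0))) :
    Run W P (PCCSS.assign a addr val) s 1 Q := by
  refine ⟨1, _, le_rfl, Exec.par _ _ _ _ _ _ _ ?_ ?_ ?_ ?_ ?_, hQ⟩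
  · exact hP
  · rintro p ⟨hp, -⟩
    obtain rfl : p = 0 := Nat.lt_one_iff.1 hp
    exact ⟨h₁, h₂⟩
  · rintro p q ⟨hp, -⟩ ⟨hq, -⟩ -
    exact (Nat.lt_one_iff.1 hp).trans (Nat.lt_one_iff.1 hq).symm
  · rintro p ⟨hp, -⟩
    obtain rfl : p = 0 := Nat.lt_one_iff.1 hp
    exact Mem.set_same
  · intro b i hbi
    by_cases hb : b = a ∧ i = addr.eval s 0
    · exact absurd ⟨0, ⟨Nat.one_pos, one_ne_zero⟩, hb⟩ hbi
    · simp [Mem.set, hb]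

/-- Up to the scratch array `9`, the memory `s'` arises from `s` by writing `V p` to cell `A p` of
array `a` for all `p < n`. -/
def Written (a n : ℕ) (A V : ℕ → ℕ) (s s' : Mem) : Prop :=
  (∀ b, b ≠ 9 → b ≠ a → s' b = s b) ∧ (∀ p < n, s' a (A p) = V p) ∧
    ∀ i, (∀ p < n, i ≠ A p) → s' a i = s a i

theorem Written.of_ne {a n : ℕ} {A V : ℕ → ℕ} {s s' : Mem} (h : Written a n A V s s') {b : ℕ}
    (h9 : b ≠ 9) (ha : b ≠ a) : s' b = s b := h.1 b h9 ha

theorem Written.eq_ite {a n : ℕ} {V : ℕ → ℕ} {s s' : Mem} (h : Written a n id V s s') (i : ℕ) :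
    s' a i = if i < n then V i else s a i := by
  split_ifs with hi
  · exact h.2.1 i hi
  · exact h.2.2 i fun p hp hip => hi (hip ▸ hp)

/-- Injectivity of the addresses makes the next memory well defined: the value in a written cell
comes from the only processor addressing it. -/
theorem Run.parAll {W P : ℕ} {count : Expr} {a : ℕ} {addr val : Expr} {s : Mem} {n : ℕ}
    (A V : ℕ → ℕ) (hcount : count.eval s 0 = n) (hnP : n ≤ P)
    (hA : ∀ p < n, addr.eval s p = A p) (hV : ∀ p < n, val.eval s p = V p)
    (hAW : ∀ p < n, A p ≤ W) (hVW : ∀ p < n, V p ≤ W)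
    (hinj : ∀ p < n, ∀ q < n, A p = A q → p = q) :
    Run W P (Cmd.par count (Expr.const 1) a addr val) s 1 (Written a n A V s) := by
  classical
  have hact : ∀ p, Active count (Expr.const 1) s p ↔ p < n := by
    intro p
    rw [Active, hcount]
    simp [Expr.eval]
  let s' : Mem := fun b i =>
    if h : b = a ∧ ∃ p, p < n ∧ i = A p then V h.2.choose else s b i
  have hw : ∀ p < n, s' a (A p) = V p := by
    intro p hp
    have h : a = a ∧ ∃ q, q < n ∧ A p = A q := ⟨rfl, p, hp, rfl⟩
    have h' : s' a (A p) = V h.2.choose := dif_pos h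
    exact h'.trans (congrArg V (hinj p hp _ h.2.choose_spec.1 h.2.choose_spec.2).symm)
  refine ⟨1, s', le_rfl, Exec.par _ _ _ _ _ _ _ (hcount.trans_le hnP) ?_ ?_ ?_ ?_, ?_, hw, ?_⟩
  · intro p hp
    rw [hact] at hp
    rw [hA p hp, hV p hp]
    exact ⟨hAW p hp, hVW p hp⟩
  · intro p q hp hq h
    rw [hact] at hp hq
    rw [hA p hp, hA q hq] at h
    exact hinj p hp q hq h
  · intro p hp
    rw [hact] at hp
    rw [hA p hp, hV p hp, hw p hp]
  · intro b i h
    refine dif_neg ?_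
    rintro ⟨rfl, p, hp, rfl⟩
    exact h ⟨p, (hact p).2 hp, rfl, (hA p hp).symm⟩
  · intro b _ hb
    funext i
    exact dif_neg fun h => hb h.1
  · intro i hi
    refine dif_neg ?_
    rintro ⟨-, p, hp, h⟩
    exact hi p hp h

/-- Replacement of the processor number by an expression. -/
def Expr.substPid : Expr → Expr → Expr
  | const n, _ => const n
  | pid, r => r
  | read a i, r => read a (i.substPid r)
  | add e f, r => add (e.substPid r) (f.substPid r)
  | sub e f, r => sub (e.substPid r) (f.substPid r)
  | mul e f, r => mul (e.substPid r) (f.substPid r)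
  | lt e f, r => lt (e.substPid r) (f.substPid r)

/-- This lets one processor impersonate the processor whose number is stored in a cell. -/
theorem Expr.eval_substPid (e r : Expr) (s : Mem) (p : ℕ) :
    (e.substPid r).eval s p = e.eval s (r.eval s p) := by
  induction e <;> simp_all [Expr.substPid, Expr.eval]

/-- The assignments `a[addr] := val` for all processor numbers below `count`, executed by one
processor one after the other, or by `count` processors in one step. -/
def forAll (parallel : Bool) (count : Expr) (a : ℕ) (addr val : Expr) : Cmd :=
  if parallel then Cmd.par count (Expr.const 1) a addr val
  else Cmd.seq (assign 9 (Expr.const 0) (Expr.const 0))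
    (Cmd.loop (Expr.lt (Expr.read 9 (Expr.const 0)) count)
      (Cmd.seq (assign a (addr.substPid (Expr.read 9 (Expr.const 0)))
          (val.substPid (Expr.read 9 (Expr.const 0))))
        (assign 9 (Expr.const 0) (Expr.add (Expr.read 9 (Expr.const 0)) (Expr.const 1)))))

/-- Running time of `forAll`. -/
def forAllTime (parallel : Bool) (n : ℕ) : ℕ := if parallel then 1 else 3 * n + 2

/-- If the processors do not read what others write, the sequential and the parallel execution have
the same effect. -/
theorem Run.forAll {W P : ℕ} (parallel : Bool) {count : Expr} {a : ℕ} {addr val : Expr} {s : Mem}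
    {n : ℕ} (A V : ℕ → ℕ) (hP : 1 ≤ P) (hnP : parallel = true → n ≤ P) (hnW : n ≤ W) (ha : a ≠ 9)
    (hcount : ∀ s' : Mem, (∀ b, b ≠ 9 → b ≠ a → s' b = s b) → count.eval s' 0 = n)
    (hAV : ∀ p < n, ∀ s' : Mem, (∀ b, b ≠ 9 → b ≠ a → s' b = s b) →
      (∀ i, (∀ q < n, q ≠ p → i ≠ A q) → s' a i = s a i) →
      addr.eval s' p = A p ∧ val.eval s' p = V p)
    (hAW : ∀ p < n, A p ≤ W) (hVW : ∀ p < n, V p ≤ W)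
    (hinj : ∀ p < n, ∀ q < n, A p = A q → p = q) :
    Run W P (PCCSS.forAll parallel count a addr val) s (forAllTime parallel n)
      (Written a n A V s) := by
  cases parallel with
  | true =>
    have h := fun p hp => hAV p hp s (fun _ _ _ => rfl) (fun _ _ => rfl)
    exact Run.parAll A V (hcount s fun _ _ _ => rfl) (hnP rfl) (fun p hp => (h p hp).1)
      (fun p hp => (h p hp).2) hAW hVW hinj
  | false =>
    -- Cell `0` of array `9` is the loop counter: the writes of the processors below it, and no
    -- others, have been made.
    let I : Mem → Prop := fun s' => s' 9 0 ≤ n ∧ Written a (s' 9 0) A V s s'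
    have hstep : ∀ s', I s' →
        (Expr.lt (Expr.read 9 (Expr.const 0)) count).eval s' 0 ≠ 0 →
        Run W P (Cmd.seq (PCCSS.assign a (addr.substPid (Expr.read 9 (Expr.const 0)))
          (val.substPid (Expr.read 9 (Expr.const 0))))
          (PCCSS.assign 9 (Expr.const 0)
            (Expr.add (Expr.read 9 (Expr.const 0)) (Expr.const 1)))) s' (1 + 1)
          fun s'' => I s'' ∧ n - s'' 9 0 < n - s' 9 0 := by
      rintro s' ⟨hle, hb, hw, hu⟩ hlt
      have hlt : s' 9 0 < n := by
        simp only [Expr.eval, hcount s' hb] at hlt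
        by_contra h
        simp [h] at hlt
      set i := s' 9 0 with hi
      -- Only lower-numbered processors have written, so processor `i` still finds its own cell
      -- unchanged; this admits updates that read the cell they overwrite.
      have hav := hAV i hlt s' hb (fun j hj => hu j fun p hp =>
        hj p (hp.trans hlt) hp.ne)
      refine Run.seq (Q := fun s'' => s'' = s'.set a (A i) (V i)) (Run.assign hP ?_ ?_ ?_) ?_
      · rw [Expr.eval_substPid]
        exact hav.1.trans_le (hAW i hlt)
      · rw [Expr.eval_substPid]
        exact hav.2.trans_le (hVW i hlt)
      · rw [Expr.eval_substPid, Expr.eval_substPid]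
        change s'.set a (addr.eval s' i) (val.eval s' i) = _
        rw [hav.1, hav.2]
      · rintro _ rfl
        have h9 : (s'.set a (A i) (V i)) 9 0 = i := by
          rw [Mem.set_of_ne ha.symm]
        refine Run.assign hP (Nat.zero_le _) ?_ ?_
        · simp only [Expr.eval, h9]
          omega
        · simp only [Expr.eval, h9]
          refine ⟨⟨?_, ?_, ?_, ?_⟩, ?_⟩
          · rw [Mem.set_same]
            omega
          · intro b hb9 hba
            rw [Mem.set_of_ne hb9, Mem.set_of_ne hba, hb b hb9 hba]
          · rw [Mem.set_same]
            intro p hp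
            rw [Mem.set_of_ne ha]
            by_cases hpi : p = i
            · rw [hpi, Mem.set_same]
            · rw [Mem.set_of_ne_idx fun h => hpi (hinj p (by omega) i hlt h)]
              exact hw p (by omega)
          · rw [Mem.set_same]
            intro j hj
            rw [Mem.set_of_ne ha, Mem.set_of_ne_idx (hj i (by omega))]
            exact hu j fun p hp => hj p (by omega)
          · rw [Mem.set_same]
            omega
    have htime : forAllTime false n = 1 + ((1 + 1 + 1) * n + 1) := by
      simp only [forAllTime, Bool.false_eq_true, if_false]
      omega
    rw [htime]
    refine Run.seq (Q := fun s' => s' = s.set 9 0 0)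
      (Run.assign hP (Nat.zero_le _) (Nat.zero_le _) rfl) ?_
    rintro _ rfl
    have h0 : I (s.set 9 0 0) := by
      refine ⟨?_, ?_, ?_, ?_⟩
      · rw [Mem.set_same]
        exact Nat.zero_le _
      · intro b hb9 _
        exact Mem.set_of_ne hb9
      · rw [Mem.set_same]
        intro p hp
        omega
      · intro j _
        rw [Mem.set_of_ne ha]
    have h := Run.loop I (fun s' => n - s' 9 0) hstep h0
    rw [Mem.set_same, Nat.sub_zero] at h
    refine h.mono le_rfl ?_
    rintro s' ⟨⟨hle, hw⟩, hend⟩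
    have : s' 9 0 = n := by
      simp only [Expr.eval, hcount s' hw.1] at hend
      by_contra hne
      have : s' 9 0 < n := by omega
      simp [this] at hend
    rwa [this] at hw

/-- The loop counter, in cell `2` of array `8`. -/
def counter : Expr := Expr.read 8 (Expr.const 2)

/-- `body` for all values of the counter below `bound`. -/
def forCount (bound : Expr) (body : Cmd) : Cmd :=
  Cmd.seq (assign 8 (Expr.const 2) (Expr.const 0))
    (Cmd.loop (Expr.lt counter bound)
      (Cmd.seq body (assign 8 (Expr.const 2) (Expr.add counter (Expr.const 1)))))

theorem Run.forCount {W P : ℕ} (hP : 1 ≤ P) (hW : 2 ≤ W) {bound : Expr} {body : Cmd} {n τ : ℕ}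
    (hn : n ≤ W) (I : ℕ → Mem → Prop) (hbound : ∀ i s, I i s → bound.eval s 0 = n)
    (hset : ∀ i s v, I i s → I i (s.set 8 2 v))
    (hbody : ∀ i < n, ∀ s, I i s → s 8 2 = i →
      Run W P body s τ fun s' => I (i + 1) s' ∧ s' 8 2 = i)
    {s : Mem} (hs : I 0 s) : Run W P (PCCSS.forCount bound body) s ((τ + 2) * n + 2) (I n) := by
  have htime : (τ + 2) * n + 2 = 1 + ((τ + 1 + 1) * n + 1) := by ring
  rw [htime]
  refine Run.seq (Q := fun s' => s' = s.set 8 2 0) (Run.assign hP hW (Nat.zero_le _) rfl) ?_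
  rintro _ rfl
  have h := Run.loop (W := W) (P := P) (e := Expr.lt counter bound)
    (c := Cmd.seq body (PCCSS.assign 8 (Expr.const 2) (Expr.add counter (Expr.const 1))))
    (fun s' => s' 8 2 ≤ n ∧ I (s' 8 2) s') (fun s' => n - s' 8 2) (τ := τ + 1) ?_
    (s := s.set 8 2 0) ?_
  · simp only [Mem.set_same, Nat.sub_zero] at h
    refine h.mono le_rfl ?_
    rintro s' ⟨⟨hle, hI⟩, hend⟩
    have : s' 8 2 = n := by
      simp only [counter, Expr.eval, hbound _ _ hI] at hend
      by_contra hne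
      have : s' 8 2 < n := by omega
      simp [this] at hend
    rwa [this] at hI
  · rintro s' ⟨hle, hI⟩ hlt
    have hlt : s' 8 2 < n := by
      simp only [counter, Expr.eval, hbound _ _ hI] at hlt
      by_contra h
      simp [h] at hlt
    refine Run.seq (hbody _ hlt s' hI rfl) ?_
    rintro s'' ⟨hI', h8⟩
    refine Run.assign hP hW ?_ ?_
    · simp only [counter, Expr.eval, h8]
      omega
    · simp only [counter, Expr.eval, h8, Mem.set_same]
      exact ⟨⟨by omega, hset _ _ _ hI'⟩, by omega⟩
  · simp only [Mem.set_same]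
    exact ⟨Nat.zero_le _, hset _ _ _ hs⟩

/-! ### The table of a code -/

section Table

variable {m B : ℕ}

theorem bitArray_val {n : ℕ} (f : Fin n → ZMod 2) (i : Fin n) : bitArray f i = (f i).val := by
  simp [bitArray]

theorem bitArray_of_le {n : ℕ} (f : Fin n → ZMod 2) {i : ℕ} (h : n ≤ i) : bitArray f i = 0 := by
  simp [bitArray, Nat.not_lt.2 h]

theorem bitArray_le_one {n : ℕ} (f : Fin n → ZMod 2) (i : ℕ) : bitArray f i ≤ 1 := by
  unfold bitArray
  split_ifs with h
  · exact Nat.lt_succ_iff.1 (ZMod.val_lt _)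
  · exact Nat.zero_le 1

/-- The `i`-th check of the variable `v`; if there is none, the value is `m`. -/
noncomputable def checkAt (H : Matrix (Fin m) (Fin B) (ZMod 2)) (v i : ℕ) : ℕ :=
  if h : v < B then ((checksOf H ⟨v, h⟩).toList.map Fin.val).getD i m else m

/-- The `k`-th variable of the check `c`; if there is none, the value is `B`. -/
noncomputable def varAt (H : Matrix (Fin m) (Fin B) (ZMod 2)) (c k : ℕ) : ℕ :=
  if h : c < m then ((varsOf H ⟨c, h⟩).toList.map Fin.val).getD k B else B

theorem getD_map_val_le {n : ℕ} (l : List (Fin n)) (i : ℕ) :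
    (l.map Fin.val).getD i n ≤ n := by
  rw [List.getD_eq_getElem?_getD, List.getElem?_map]
  cases l[i]? with
  | none => simp
  | some a => simp

theorem checkAt_le (H : Matrix (Fin m) (Fin B) (ZMod 2)) (v i : ℕ) : checkAt H v i ≤ m := by
  unfold checkAt
  split_ifs
  · exact getD_map_val_le _ _
  · exact le_rfl

theorem varAt_le (H : Matrix (Fin m) (Fin B) (ZMod 2)) (c k : ℕ) : varAt H c k ≤ B := by
  unfold varAt
  split_ifs
  · exact getD_map_val_le _ _
  · exact le_rfl

/-- Padding by a value where `F` vanishes turns sums over lists of varying length into sums with a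
fixed number of terms, as needed for fixed programs. -/
theorem sum_range_getD {α M : Type*} [AddCommMonoid M] (F : α → M) (d : α) (hd : F d = 0)
    (l : List α) (n : ℕ) (hn : l.length ≤ n) :
    ∑ i ∈ range n, F (l.getD i d) = (l.map F).sum := by
  induction l generalizing n with
  | nil => simp [hd]
  | cons a l ih =>
    obtain ⟨n, rfl⟩ : ∃ k, n = k + 1 := ⟨n - 1, by simp at hn; omega⟩
    rw [sum_range_succ', List.map_cons, List.sum_cons, add_comm]
    simp only [List.getD_cons_succ, List.getD_cons_zero]
    rw [ih n (by simpa using hn)]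

theorem sum_checkAt {H : Matrix (Fin m) (Fin B) (ZMod 2)}
    (hcol : ∀ j, (checksOf H j).card ≤ 32) (F : ℕ → ℕ) (hF : F m = 0) (v : Fin B) :
    ∑ i ∈ range 32, F (checkAt H v i) = ∑ c ∈ checksOf H v, F c := by
  simp only [checkAt, v.isLt, dite_true]
  rw [sum_range_getD F m hF _ 32 (by simpa using hcol v), List.map_map]
  exact sum_map_toList _ _

theorem sum_varAt {H : Matrix (Fin m) (Fin B) (ZMod 2)}
    (hrow : ∀ c, (varsOf H c).card ≤ 128) (F : ℕ → ℕ) (hF : F B = 0) (c : Fin m) :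
    ∑ k ∈ range 128, F (varAt H c k) = ∑ j ∈ varsOf H c, F j := by
  simp only [varAt, c.isLt, dite_true]
  rw [sum_range_getD F B hF _ 128 (by simpa using hrow c), List.map_map]
  exact sum_map_toList _ _

theorem exists_getD_eq {n : ℕ} {S : Finset (Fin n)} {a : Fin n} (ha : a ∈ S) {r : ℕ}
    (hr : S.card ≤ r) (d : ℕ) : ∃ i < r, (S.toList.map Fin.val).getD i d = a := by
  have h : a.val ∈ S.toList.map Fin.val := List.mem_map.2 ⟨a, mem_toList.2 ha, rfl⟩
  obtain ⟨i, hi, h⟩ := List.mem_iff_getElem.1 h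
  refine ⟨i, lt_of_lt_of_le (by simpa using hi) hr, ?_⟩
  rw [List.getD_eq_getElem _ _ hi, h]

/-- Variables with a common check are found in the table. -/
theorem exists_varAt_checkAt_eq {H : Matrix (Fin m) (Fin B) (ZMod 2)}
    (hcol : ∀ j, (checksOf H j).card ≤ 32) (hrow : ∀ c, (varsOf H c).card ≤ 128) {v j : Fin B}
    (h : ¬ Disjoint (checksOf H j) (checksOf H v)) :
    ∃ i < 32, ∃ k < 128, varAt H (checkAt H v i) k = j := by
  rw [not_disjoint_iff] at h
  obtain ⟨c, hcj, hcv⟩ := h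
  obtain ⟨i, hi, h1⟩ := exists_getD_eq hcv (hcol v) m
  obtain ⟨k, hk, h2⟩ := exists_getD_eq (mem_varsOf.2 (mem_checksOf.1 hcj)) (hrow c) B
  refine ⟨i, hi, k, hk, ?_⟩
  have h3 : checkAt H v i = c := by
    simp only [checkAt, v.isLt, dite_true]
    exact h1
  rw [h3]
  simp only [varAt, c.isLt, dite_true]
  exact h2

/-- The array `f` contains the sizes, the number of rounds, the parities of small numbers, the
checks of all variables, and the variables of these checks. -/
structure IsTable (H : Matrix (Fin m) (Fin B) (ZMod 2)) (n L : ℕ) (f : ℕ → ℕ) : Prop where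
  blocks : f 0 = B
  length : f 4 = n
  rounds : f 8 = L
  parity : ∀ x ≤ 129, f (4 * x + 1) = x % 2
  check : ∀ v ≤ B, ∀ i < 32, f (4 * (v * 32 + i) + 2) = checkAt H v i
  var : ∀ v ≤ B, ∀ i < 32, ∀ k < 128,
    f (4 * (v * 4096 + (i * 128 + k)) + 3) = varAt H (checkAt H v i) k

/-- The entries of the table. -/
noncomputable def tableFun (H : Matrix (Fin m) (Fin B) (ZMod 2)) (n L x : ℕ) : ℕ :=
  if x % 4 = 0 then if x = 0 then B else if x = 4 then n else if x = 8 then L else 0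
  else if x % 4 = 1 then x / 4 % 2
  else if x % 4 = 2 then checkAt H (x / 4 / 32) (x / 4 % 32)
  else varAt H (checkAt H (x / 4 / 4096) (x / 4 % 4096 / 128)) (x / 4 % 128)

/-- Four arrays are interleaved by the residue of the index modulo `4`, with `4096 = 32 * 128`.
Parities up to `129` cover one syndrome bit plus 128 estimated bits. There is a row for `v = B`
because this padding value can reach the stack. -/
theorem exists_table (H : Matrix (Fin m) (Fin B) (ZMod 2)) (n L : ℕ) :
    ∃ table : List ℕ, table.length = 4 * (4096 * (B + 1) + 130) ∧
      (∀ a ∈ table, a ≤ B + n + L + m + 1) ∧ IsTable H n L fun i => table.getD i 0 := by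
  set len := 4 * (4096 * (B + 1) + 130) with hlen
  have hget : ∀ i < len, ((List.range len).map (tableFun H n L)).getD i 0 = tableFun H n L i := by
    intro i hi
    rw [List.getD_eq_getElem _ _ (by simpa using hi)]
    simp
  refine ⟨(List.range len).map (tableFun H n L), by simp, ?_, ?_⟩
  · intro a ha
    obtain ⟨x, -, rfl⟩ := List.mem_map.1 ha
    unfold tableFun
    have h1 := checkAt_le H (x / 4 / 32) (x / 4 % 32)
    have h2 := varAt_le H (checkAt H (x / 4 / 4096) (x / 4 % 4096 / 128)) (x / 4 % 128)
    split_ifs <;> omega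
  · constructor
    · simp only [hget 0 (by omega)]
      rfl
    · simp only [hget 4 (by omega)]
      rfl
    · simp only [hget 8 (by omega)]
      rfl
    · intro x hx
      simp only [hget (4 * x + 1) (by omega)]
      rw [tableFun, if_neg (by omega), if_pos (by omega)]
      omega
    · intro v hv i hi
      simp only [hget (4 * (v * 32 + i) + 2) (by omega)]
      rw [tableFun, if_neg (by omega), if_neg (by omega), if_pos (by omega)]
      congr 1 <;> omega
    · intro v hv i hi k hk
      simp only [hget (4 * (v * 4096 + (i * 128 + k)) + 3) (by omega)]
      rw [tableFun, if_neg (by omega), if_neg (by omega), if_neg (by omega)]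
      have h1 : (4 * (v * 4096 + (i * 128 + k)) + 3) / 4 / 4096 = v := by omega
      have h2 : (4 * (v * 4096 + (i * 128 + k)) + 3) / 4 % 4096 / 128 = i := by omega
      have h3 : (4 * (v * 4096 + (i * 128 + k)) + 3) / 4 % 128 = k := by omega
      rw [h1, h2, h3]

end Table

/-! ### Counting violated checks -/

/-- The sum of the expressions `f 0, …, f (n - 1)`. -/
def sumExpr (f : ℕ → Expr) : ℕ → Expr
  | 0 => Expr.const 0
  | n + 1 => Expr.add (sumExpr f n) (f n)

theorem eval_sumExpr (f : ℕ → Expr) (n : ℕ) (s : Mem) (p : ℕ) :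
    (sumExpr f n).eval s p = ∑ i ∈ range n, (f i).eval s p := by
  induction n with
  | zero => rfl
  | succ n ih => rw [sum_range_succ, ← ih]; rfl

/-- Cell `i` of part `a` of the table. -/
def tableExpr (a : ℕ) (i : Expr) : Expr :=
  Expr.read 0 (Expr.add (Expr.mul (Expr.const 4) i) (Expr.const a))

theorem eval_tableExpr (a : ℕ) (i : Expr) (s : Mem) (p : ℕ) :
    (tableExpr a i).eval s p = s 0 (4 * i.eval s p + a) := rfl

/-- The index of the `i`-th check of the variable `v`. -/
def checkExpr (v : Expr) (i : ℕ) : Expr :=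
  tableExpr 2 (Expr.add (Expr.mul v (Expr.const 32)) (Expr.const i))

/-- The index of the `k`-th variable of the `i`-th check of the variable `v`. -/
def varExpr (v : Expr) (i k : ℕ) : Expr :=
  tableExpr 3 (Expr.add (Expr.mul v (Expr.const 4096)) (Expr.const (i * 128 + k)))

/-- The number of violated checks of the variable `v`, for the syndrome in array `1` and the
estimated error in array `5`. -/
def unsatExpr (v : Expr) : Expr :=
  sumExpr (fun i => tableExpr 1 (Expr.add (Expr.read 1 (checkExpr v i))
    (sumExpr (fun k => Expr.read 5 (varExpr v i k)) 128))) 32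

section Unsat

variable {m B : ℕ} {H : Matrix (Fin m) (Fin B) (ZMod 2)}

theorem val_sum_zmod_two {ι : Type*} (S : Finset ι) (f : ι → ZMod 2) :
    (∑ i ∈ S, f i).val = (∑ i ∈ S, (f i).val) % 2 := by
  have h : ∑ i ∈ S, f i = ((∑ i ∈ S, (f i).val : ℕ) : ZMod 2) := by
    rw [Nat.cast_sum]
    exact sum_congr rfl fun i _ => (ZMod.natCast_zmod_val (f i)).symm
  rw [h, ZMod.val_natCast]

/-- By linearity the given syndrome plus that of the estimate is the syndrome of the residual error.
For the padding index `c = m` both sides are `0`. -/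
theorem syndrome_add_sum_mod_two (hrow : ∀ c, (varsOf H c).card ≤ 128) (x est : Fin B → ZMod 2)
    {c : ℕ} (hc : c ≤ m) :
    (bitArray (H.mulVec x) c + ∑ k ∈ range 128, bitArray est (varAt H c k)) % 2 =
      bitArray (H.mulVec (x + est)) c := by
  rcases hc.lt_or_eq with h | rfl
  · have h1 := sum_varAt hrow (bitArray est) (bitArray_of_le est le_rfl) ⟨c, h⟩
    simp only at h1
    rw [h1, bitArray_val _ (⟨c, h⟩ : Fin m), bitArray_val _ (⟨c, h⟩ : Fin m), Matrix.mulVec_add,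
      Pi.add_apply, ZMod.val_add, mulVec_eq_sum_varsOf est, val_sum_zmod_two]
    simp only [bitArray_val]
    omega
  · rw [bitArray_of_le _ le_rfl, bitArray_of_le _ le_rfl]
    have : ∀ k, varAt H c k = B := fun k => by simp [varAt]
    simp [this, bitArray_of_le]

/-- Because all degrees are bounded, the count is one expression of fixed size and costs no separate
steps. Parities are looked up, since expressions have no remainder operation. -/
theorem eval_unsatExpr (hcol : ∀ j, (checksOf H j).card ≤ 32)
    (hrow : ∀ c, (varsOf H c).card ≤ 128) {n L : ℕ} {s : Mem} {x est : Fin B → ZMod 2}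
    (h0 : IsTable H n L (s 0)) (h1 : s 1 = bitArray (H.mulVec x)) (h5 : s 5 = bitArray est)
    {v : Expr} {p w : ℕ} (hv : v.eval s p = w) (hw : w ≤ B) :
    (unsatExpr v).eval s p = if h : w < B then unsatDeg H (x + est) ⟨w, h⟩ else 0 := by
  have hterm : ∀ i ∈ range 32, (tableExpr 1 (Expr.add (Expr.read 1 (checkExpr v i))
      (sumExpr (fun k => Expr.read 5 (varExpr v i k)) 128))).eval s p =
      bitArray (H.mulVec (x + est)) (checkAt H w i) := by
    intro i hi
    rw [mem_range] at hi
    have hc : (checkExpr v i).eval s p = checkAt H w i := by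
      rw [checkExpr, eval_tableExpr]
      simp only [Expr.eval, hv]
      exact h0.check w hw i hi
    have hk : ∀ k ∈ range 128, (Expr.read 5 (varExpr v i k)).eval s p =
        bitArray est (varAt H (checkAt H w i) k) := by
      intro k hk
      rw [mem_range] at hk
      rw [← h5, Expr.eval, varExpr, eval_tableExpr]
      simp only [Expr.eval, hv]
      rw [h0.var w hw i hi k hk]
    rw [eval_tableExpr]
    simp only [Expr.eval, hc, eval_sumExpr]
    rw [sum_congr rfl (fun k hk' => by simpa only [Expr.eval] using hk k hk'), h1, h0.parity,
      syndrome_add_sum_mod_two hrow x est (checkAt_le H w i)]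
    have h2 := sum_le_card_nsmul (range 128)
      (fun k => bitArray est (varAt H (checkAt H w i) k)) 1 fun k _ => bitArray_le_one _ _
    have h3 := bitArray_le_one (H.mulVec x) (checkAt H w i)
    rw [card_range, smul_eq_mul] at h2
    omega
  rw [unsatExpr, eval_sumExpr, sum_congr rfl hterm]
  split_ifs with h
  · have h2 := sum_checkAt hcol (bitArray (H.mulVec (x + est))) (bitArray_of_le _ le_rfl) ⟨w, h⟩
    simp only at h2
    rw [h2, unsatDeg, inter_comm, ← filter_mem_eq_inter, ← sum_filter_add_sum_filter_not _
      (fun c => c ∈ unsat H (x + est)), filter_mem_eq_inter, filter_mem_eq_inter, inter_comm]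
    rw [sum_congr (g := fun _ => 1) rfl, sum_eq_zero (s := filter _ _)]
    · simp
    · intro c hc
      have := (mem_filter.1 hc).2
      rw [mem_unsat, not_not] at this
      rw [bitArray_val, this, ZMod.val_zero]
    · intro c hc
      have := (mem_inter.1 hc).1
      rw [mem_unsat] at this
      rw [bitArray_val, zmod_two_eq_one this, ZMod.val_one]
  · have : ∀ i, checkAt H w i = m := fun i => by simp [checkAt, h]
    simp [this, bitArray_of_le]

end Unsat

/-! ### Decoding of the inner code -/

/-- The number of blocks. -/
def blocksExpr : Expr := Expr.read 0 (Expr.const 0)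

/-- The length of the blocks. -/
def lengthExpr : Expr := Expr.read 0 (Expr.const 4)

/-- The syndrome bit of block `pid` whose number is the counter; it is `0` if there is none. -/
def syndromeBitExpr : Expr :=
  Expr.mul (Expr.lt counter (Expr.sub lengthExpr (Expr.const 1)))
    (Expr.read 2 (Expr.add (Expr.mul Expr.pid (Expr.sub lengthExpr (Expr.const 1))) counter))

/-- Majority decoding of all blocks: array `6` counts the nonzero syndrome bits. -/
def decodeInner (parallel : Bool) : Cmd :=
  Cmd.seq
    (forCount lengthExpr (forAll parallel blocksExpr 6 Expr.pid
      (Expr.add (Expr.read 6 Expr.pid) syndromeBitExpr)))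
    (forCount lengthExpr (forAll parallel blocksExpr 4
      (Expr.add (Expr.mul Expr.pid lengthExpr) counter)
      (Expr.add syndromeBitExpr
        (Expr.lt lengthExpr (Expr.mul (Expr.const 2) (Expr.read 6 Expr.pid))))))

/-- The syndrome bit number `j` of block `b`, and `0` for `j = n - 1`. -/
def syndromeBit (n : ℕ) (f : ℕ → ℕ) (b j : ℕ) : ℕ :=
  (if j < n - 1 then 1 else 0) * f (b * (n - 1) + j)

/-- The estimated error at position `j` of block `b`, up to even numbers. -/
def innerEstimate (n : ℕ) (f : ℕ → ℕ) (b j : ℕ) : ℕ :=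
  syndromeBit n f b j + if n < 2 * ∑ i ∈ range n, syndromeBit n f b i then 1 else 0

theorem syndromeBit_le_one {n : ℕ} {f : ℕ → ℕ} (hf : ∀ i, f i ≤ 1) (b j : ℕ) :
    syndromeBit n f b j ≤ 1 := by
  unfold syndromeBit
  have := hf (b * (n - 1) + j)
  split_ifs <;> omega

theorem eval_syndromeBitExpr {n : ℕ} {s : Mem} {f : ℕ → ℕ} {j : ℕ} (h4 : s 0 4 = n) (h2 : s 2 = f)
    (h8 : s 8 2 = j) (p : ℕ) : syndromeBitExpr.eval s p = syndromeBit n f p j := by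
  simp only [syndromeBitExpr, lengthExpr, counter, Expr.eval, h4, h2, h8, syndromeBit]

theorem sum_syndromeBit_le {n : ℕ} {f : ℕ → ℕ} (hf : ∀ i, f i ≤ 1) (b i : ℕ) :
    ∑ j ∈ range i, syndromeBit n f b j ≤ i := by
  have := sum_le_card_nsmul (range i) (fun j => syndromeBit n f b j) 1
    fun j _ => syndromeBit_le_one hf b j
  simpa using this

/-- The outer loops run over the `n` positions and each iteration treats all blocks: time of order
`n` with one processor per block, of order `B * n` with a single one. The first scan counts the
syndrome bits, the second writes the majority estimate. -/
theorem Run.decodeInner {W P B n : ℕ} (parallel : Bool) {s : Mem} {f : ℕ → ℕ} (hP : 1 ≤ P)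
    (hBP : parallel = true → B ≤ P) (hB : 1 ≤ B) (hn : 1 < n) (hW : B * n ≤ W)
    (h0 : s 0 0 = B) (h4 : s 0 4 = n) (h2 : s 2 = f) (hf : ∀ i, f i ≤ 1) (h6 : s 6 = fun _ => 0) :
    Run W P (PCCSS.decodeInner parallel) s
      (((forAllTime parallel B + 2) * n + 2) + ((forAllTime parallel B + 2) * n + 2)) fun s' =>
      (∀ a, a ≠ 4 → a ≠ 6 → a ≠ 8 → a ≠ 9 → s' a = s a) ∧
        ∀ b < B, ∀ j < n, s' 4 (b * n + j) = innerEstimate n f b j := by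
  have hnB : n ≤ B * n := Nat.le_mul_of_pos_left n hB
  have hBn : B * 2 ≤ B * n := Nat.mul_le_mul_left B hn
  let I : ℕ → Mem → Prop := fun i s' =>
    (∀ a, a ≠ 4 → a ≠ 6 → a ≠ 8 → a ≠ 9 → s' a = s a) ∧
      s' 6 = fun b => if b < B then ∑ j ∈ range i, syndromeBit n f b j else 0
  refine Run.seq (Q := I n) ?_ ?_
  · refine Run.forCount hP (by omega) (by omega) I ?_ ?_ ?_ ?_
    · rintro i s' ⟨hs, -⟩
      rw [lengthExpr, Expr.eval, hs 0 (by decide) (by decide) (by decide) (by decide)]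
      exact h4
    · rintro i s' v ⟨hs, hs6⟩
      exact ⟨fun a ha4 ha6 ha8 ha9 => by rw [Mem.set_of_ne ha8, hs a ha4 ha6 ha8 ha9],
        by rw [Mem.set_of_ne (by decide), hs6]⟩
    · rintro i hi s' ⟨hs, hs6⟩ h8
      have hs0 : s' 0 = s 0 := hs 0 (by decide) (by decide) (by decide) (by decide)
      have hs2 : s' 2 = f := (hs 2 (by decide) (by decide) (by decide) (by decide)).trans h2
      refine (Run.forAll parallel (n := B) id
        (fun b => ∑ j ∈ range (i + 1), syndromeBit n f b j) hP hBP (by omega) (by decide)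
        ?_ ?_ ?_ ?_ ?_).mono le_rfl ?_
      · intro s'' hs''
        rw [blocksExpr, Expr.eval, hs'' 0 (by decide) (by decide), hs0]
        exact h0
      · intro p hp s'' hs'' hu
        refine ⟨rfl, ?_⟩
        rw [Expr.eval, Expr.eval, eval_syndromeBitExpr (n := n) (f := f) (j := i)
          (by rw [hs'' 0 (by decide) (by decide), hs0, h4])
          (by rw [hs'' 2 (by decide) (by decide), hs2])
          (by rw [hs'' 8 (by decide) (by decide), h8]), sum_range_succ]
        rw [Expr.eval, hu p (fun q _ hq h => hq h.symm), hs6]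
        simp only [if_pos hp]
      · intro p hp
        exact (le_of_lt hp).trans (by omega)
      · intro p hp
        exact (sum_syndromeBit_le hf p (i + 1)).trans (by omega)
      · exact fun p _ q _ h => h
      · intro s'' hw
        refine ⟨⟨fun a ha4 ha6 ha8 ha9 => ?_, ?_⟩, ?_⟩
        · rw [hw.of_ne ha9 ha6, hs a ha4 ha6 ha8 ha9]
        · funext b
          rw [hw.eq_ite b, hs6]
          split_ifs with hb
          · rfl
          · exact if_neg hb
        · rw [hw.of_ne (by decide) (by decide), h8]
    · refine ⟨fun _ _ _ _ _ => rfl, ?_⟩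
      rw [h6]
      funext b
      simp
  · rintro s₁ ⟨hs₁, hs₁6⟩
    let J : ℕ → Mem → Prop := fun i s' =>
      (∀ a, a ≠ 4 → a ≠ 8 → a ≠ 9 → s' a = s₁ a) ∧
        ∀ b < B, ∀ j < i, s' 4 (b * n + j) = innerEstimate n f b j
    refine (Run.forCount (n := n) (τ := forAllTime parallel B) hP (by omega) (by omega) J
      ?_ ?_ ?_ ?_).mono le_rfl ?_
    · rintro i s' ⟨hs, -⟩
      rw [lengthExpr, Expr.eval, hs 0 (by decide) (by decide) (by decide),
        hs₁ 0 (by decide) (by decide) (by decide) (by decide)]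
      exact h4
    · rintro i s' v ⟨hs, hs4⟩
      refine ⟨fun a ha4 ha8 ha9 => by rw [Mem.set_of_ne ha8, hs a ha4 ha8 ha9], ?_⟩
      rw [Mem.set_of_ne (by decide)]
      exact hs4
    · rintro i hi s' ⟨hs, hs4⟩ h8
      have hs0 : s' 0 = s 0 := (hs 0 (by decide) (by decide) (by decide)).trans
        (hs₁ 0 (by decide) (by decide) (by decide) (by decide))
      have hs2 : s' 2 = f := ((hs 2 (by decide) (by decide) (by decide)).trans
        (hs₁ 2 (by decide) (by decide) (by decide) (by decide))).trans h2
      have hs6 := (hs 6 (by decide) (by decide) (by decide)).trans hs₁6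
      have hinj : ∀ b b' j j' : ℕ, j < n → j' < n → b * n + j = b' * n + j' → b = b' ∧ j = j' := by
        intro b b' j j' hj hj' h
        have h1 : (b * n + j) % n = (b' * n + j') % n := by rw [h]
        rw [Nat.mul_add_mod_self_right, Nat.mul_add_mod_self_right, Nat.mod_eq_of_lt hj,
          Nat.mod_eq_of_lt hj'] at h1
        subst h1
        exact ⟨Nat.eq_of_mul_eq_mul_right (by omega) (Nat.add_right_cancel h), rfl⟩
      refine (Run.forAll parallel (n := B) (fun b => b * n + i)
        (fun b => innerEstimate n f b i) hP hBP (by omega) (by decide)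
        ?_ ?_ ?_ ?_ ?_).mono le_rfl ?_
      · intro s'' hs''
        rw [blocksExpr, Expr.eval, hs'' 0 (by decide) (by decide), hs0]
        exact h0
      · intro p hp s'' hs'' _
        have hs''0 : s'' 0 4 = n := by rw [hs'' 0 (by decide) (by decide), hs0, h4]
        have hs''8 : s'' 8 2 = i := by rw [hs'' 8 (by decide) (by decide), h8]
        have hs''6 : s'' 6 p = ∑ j ∈ range n, syndromeBit n f p j := by
          rw [hs'' 6 (by decide) (by decide), hs6]
          simp only [if_pos hp]
        constructor
        · simp only [Expr.eval, lengthExpr, counter, hs''0, hs''8]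
        · rw [Expr.eval, eval_syndromeBitExpr hs''0
            (by rw [hs'' 2 (by decide) (by decide), hs2]) hs''8]
          simp only [Expr.eval, lengthExpr, hs''0, hs''6, innerEstimate]
      · intro p hp
        have : (p + 1) * n ≤ B * n := Nat.mul_le_mul_right n hp
        rw [add_mul, one_mul] at this
        omega
      · intro p hp
        have := syndromeBit_le_one (n := n) hf p i
        simp only [innerEstimate]
        split_ifs <;> omega
      · intro p _ q _ h
        exact (hinj p q i i hi hi h).1
      · intro s'' hw
        refine ⟨⟨fun a ha4 ha8 ha9 => ?_, ?_⟩, ?_⟩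
        · rw [hw.of_ne ha9 ha4, hs a ha4 ha8 ha9]
        · intro b hb j hj
          by_cases hji : j = i
          · subst hji
            exact hw.2.1 b hb
          · rw [hw.2.2 _ fun q _ h => hji (hinj b q j i (by omega) hi h).2]
            exact hs4 b hb j (by omega)
        · rw [hw.of_ne (by decide) (by decide), h8]
    · exact ⟨fun _ _ _ _ => rfl, fun b _ j hj => absurd hj (Nat.not_lt_zero j)⟩
    · rintro s' ⟨hs, hs4⟩
      exact ⟨fun a ha4 ha6 ha8 ha9 => by rw [hs a ha4 ha8 ha9, hs₁ a ha4 ha6 ha8 ha9], hs4⟩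

section Majority

variable {B n : ℕ}

theorem bitArray₂_apply (f : Fin B × Fin n → ZMod 2) (b : Fin B) (j : Fin n) :
    bitArray₂ f (b * n + j) = (f (b, j)).val := by
  have h : b.val * n + j.val = (finProdFinEquiv (b, j)).val := by
    rw [finProdFinEquiv_apply_val]
    simp only
    ring
  rw [bitArray₂, h, bitArray_val, Equiv.symm_apply_apply]

theorem syndromeBit_innerCheck (hn : 0 < n) (e : Fin B × Fin n → ZMod 2) (b : Fin B) (j : Fin n) :
    syndromeBit n (bitArray₂ ((innerCheck B n).mulVec e)) b j =
      (e (b, j) + e (b, ⟨n - 1, Nat.sub_lt hn one_pos⟩)).val := by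
  unfold syndromeBit
  split_ifs with h
  · have h1 := bitArray₂_apply ((innerCheck B n).mulVec e) b ⟨j, h⟩
    simp only at h1
    rw [one_mul, h1, innerCheck_mulVec hn]
    rfl
  · have : j = ⟨n - 1, Nat.sub_lt hn one_pos⟩ := by
      ext
      simp only
      omega
    rw [zero_mul, this, CharTwo.add_self_eq_zero, ZMod.val_zero]

/-- Majority decoding recovers errors of weight less than half the block length. -/
theorem innerEstimate_correct (hn : 0 < n) {e : Fin B × Fin n → ZMod 2}
    (he : hammingNorm e ≤ (n - 1) / 2) (b : Fin B) (j : Fin n) :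
    ((innerEstimate n (bitArray₂ ((innerCheck B n).mulVec e)) b j : ℕ) : ZMod 2) = e (b, j) := by
  set l : Fin n := ⟨n - 1, Nat.sub_lt hn one_pos⟩ with hl
  set wt := (univ.filter fun i : Fin n => e (b, i) ≠ 0).card with hwt
  have hwt_le : wt ≤ (n - 1) / 2 := by
    refine le_trans ?_ he
    refine card_le_card_of_injOn (fun i => (b, i)) ?_ ?_
    · intro i hi
      simpa using hi
    · exact fun i _ i' _ h => congrArg Prod.snd h
  have hsum : ∑ i ∈ range n, syndromeBit n (bitArray₂ ((innerCheck B n).mulVec e)) b i =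
      ∑ i : Fin n, (e (b, i) + e (b, l)).val := by
    rw [← Fin.sum_univ_eq_sum_range]
    exact sum_congr rfl fun i _ => syndromeBit_innerCheck hn e b i
  -- Syndrome bit `i` is `e i + e l` with `l` the last position. The number of ones is `wt` if `e l
  -- = 0` and `n - wt` if `e l = 1`; as `2 * wt < n`, comparison with `n / 2` reveals `e l`.
  have hcount : (if n < 2 * ∑ i : Fin n, (e (b, i) + e (b, l)).val then 1 else 0) =
      (e (b, l)).val := by
    rcases zmod_two_cases (e (b, l)) with h | h
    · have : ∑ i : Fin n, (e (b, i) + e (b, l)).val = wt := by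
        rw [hwt, card_filter]
        refine sum_congr rfl fun i _ => ?_
        rcases zmod_two_cases (e (b, i)) with h' | h' <;> rw [h, h'] <;> decide
      rw [this, h, if_neg (by omega), ZMod.val_zero]
    · have : ∑ i : Fin n, (e (b, i) + e (b, l)).val + wt = n := by
        rw [hwt, card_filter, ← sum_add_distrib]
        have : ∀ i : Fin n, (e (b, i) + e (b, l)).val + (if e (b, i) ≠ 0 then 1 else 0) = 1 := by
          intro i
          rcases zmod_two_cases (e (b, i)) with h' | h' <;> rw [h, h'] <;> decide
        rw [sum_congr rfl fun i _ => this i]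
        simp
      rw [if_pos (by omega), h, ZMod.val_one]
  rw [innerEstimate, hsum, hcount, syndromeBit_innerCheck hn, Nat.cast_add,
    ZMod.natCast_zmod_val, ZMod.natCast_zmod_val, add_assoc, CharTwo.add_self_eq_zero, add_zero]

end Majority

/-! ### Decoding of the outer code -/

/-- The number of rounds of parallel bit flipping. -/
def roundsExpr : Expr := Expr.read 0 (Expr.const 8)

/-- `1` if the variable `v` takes part in more than `16` violated checks. -/
def flipExpr (v : Expr) : Expr := Expr.lt (Expr.const 16) (unsatExpr v)

/-- Parallel bit flipping. -/
def decodeOuterParallel : Cmd :=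
  forCount roundsExpr (Cmd.par blocksExpr (Expr.const 1) 5 Expr.pid
    (Expr.sub (Expr.add (Expr.read 5 Expr.pid) (flipExpr Expr.pid))
      (Expr.mul (Expr.const 2) (Expr.mul (Expr.read 5 Expr.pid) (flipExpr Expr.pid)))))

/-- The height of the stack of array `7`. -/
def heightExpr : Expr := Expr.read 8 (Expr.const 0)

/-- The variable taken from the stack. -/
def topExpr : Expr := Expr.read 8 (Expr.const 1)

/-- Take a variable from the stack. If it takes part in more than `16` violated checks, flip it and
put the variables of all its checks on the stack. -/
def flipStep : Cmd :=
  Cmd.seq (assign 8 (Expr.const 0) (Expr.sub heightExpr (Expr.const 1)))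
    (Cmd.seq (assign 8 (Expr.const 1) (Expr.read 7 heightExpr))
      (Cmd.ite (flipExpr topExpr)
        (Cmd.seq (assign 5 topExpr (Expr.sub (Expr.const 1) (Expr.read 5 topExpr)))
          (Cmd.seq (forAll false (Expr.const 4096) 7 (Expr.add heightExpr Expr.pid)
              (tableExpr 3 (Expr.add (Expr.mul topExpr (Expr.const 4096)) Expr.pid)))
            (assign 8 (Expr.const 0) (Expr.add heightExpr (Expr.const 4096)))))
        Cmd.skip))

/-- Sequential bit flipping; the stack contains all variables that may have to be flipped. -/
def decodeOuterSequential : Cmd :=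
  Cmd.seq (forAll false blocksExpr 7 Expr.pid Expr.pid)
    (Cmd.seq (assign 8 (Expr.const 0) blocksExpr)
      (Cmd.loop (Expr.lt (Expr.const 0) heightExpr) flipStep))

/-- Write the estimated error of the outer code to the first positions of the blocks. -/
def writeOuter (parallel : Bool) : Cmd :=
  forAll parallel blocksExpr 3 (Expr.mul Expr.pid lengthExpr) (Expr.read 5 Expr.pid)

section Outer

variable {m B : ℕ} {H : Matrix (Fin m) (Fin B) (ZMod 2)}

theorem eval_flipExpr (hcol : ∀ j, (checksOf H j).card ≤ 32)
    (hrow : ∀ c, (varsOf H c).card ≤ 128) {n L : ℕ} {s : Mem} {x est : Fin B → ZMod 2}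
    (h0 : IsTable H n L (s 0)) (h1 : s 1 = bitArray (H.mulVec x)) (h5 : s 5 = bitArray est)
    {v : Expr} {p w : ℕ} (hv : v.eval s p = w) (hw : w ≤ B) :
    (flipExpr v).eval s p =
      if ∃ h : w < B, 16 < unsatDeg H (x + est) ⟨w, h⟩ then 1 else 0 := by
  rw [flipExpr, Expr.eval, eval_unsatExpr hcol hrow h0 h1 h5 hv hw, Expr.eval]
  by_cases h : w < B <;> simp [h]

/-- The program never sees `x`, but the syndrome and the estimate determine the violated checks of
the residual `x + est`, which follows the iterates of `flipAll`. -/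
theorem Run.decodeOuterParallel {W P n L : ℕ} {s : Mem} {x : Fin B → ZMod 2} {e : ℕ}
    (hH : Expands H e) (hrow : ∀ c, (varsOf H c).card ≤ 128) (hB : 1 ≤ B) (hBP : B ≤ P)
    (hBW : 2 * B ≤ W) (hLW : L ≤ W) (h0 : IsTable H n L (s 0))
    (h1 : s 1 = bitArray (H.mulVec x)) (h5 : s 5 = fun _ => 0) :
    Run W P PCCSS.decodeOuterParallel s ((1 + 2) * L + 2) fun s' =>
      (∀ a, a ≠ 5 → a ≠ 8 → a ≠ 9 → s' a = s a) ∧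
        ∃ est, s' 5 = bitArray est ∧ x + est = (flipAll H)^[L] x := by
  refine Run.forCount (hB.trans hBP) (by omega) hLW (fun i s' =>
    (∀ a, a ≠ 5 → a ≠ 8 → a ≠ 9 → s' a = s a) ∧
      ∃ est, s' 5 = bitArray est ∧ x + est = (flipAll H)^[i] x) ?_ ?_ ?_ ?_
  · rintro i s' ⟨hs, -⟩
    rw [roundsExpr, Expr.eval, hs 0 (by decide) (by decide) (by decide)]
    exact h0.rounds
  · rintro i s' v ⟨hs, hs5⟩
    refine ⟨fun a ha5 ha8 ha9 => by rw [Mem.set_of_ne ha8, hs a ha5 ha8 ha9], ?_⟩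
    rw [Mem.set_of_ne (by decide)]
    exact hs5
  · rintro i hi s' ⟨hs, est, hs5, hest⟩ h8
    have hs0 : s' 0 = s 0 := hs 0 (by decide) (by decide) (by decide)
    have hs1 : s' 1 = bitArray (H.mulVec x) :=
      (hs 1 (by decide) (by decide) (by decide)).trans h1
    set est' : Fin B → ZMod 2 := fun j => est j + if 16 < unsatDeg H (x + est) j then 1 else 0
      with hest'
    refine (Run.parAll (n := B) id (bitArray est') ?_ hBP ?_ ?_ ?_ ?_ ?_).mono le_rfl ?_
    · rw [blocksExpr, Expr.eval, hs0]
      exact h0.blocks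
    · exact fun _ _ => rfl
    · intro p hp
      have hflip := eval_flipExpr hH.degree_le hrow (by rw [hs0]; exact h0) hs1 hs5
        (v := Expr.pid) (p := p) rfl hp.le
      simp only [Expr.eval, hflip, hs5]
      have h2 := bitArray_val est ⟨p, hp⟩
      have h3 := bitArray_val est' ⟨p, hp⟩
      simp only at h2 h3
      rw [h2, h3]
      simp only [hest', hp, exists_true_left]
      -- The written value `a + b - 2 * a * b` is the exclusive or of two bits.
      rcases zmod_two_cases (est ⟨p, hp⟩) with h | h <;> rw [h] <;> split_ifs <;> decide
    · exact fun p hp => (le_of_lt hp).trans (by omega)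
    · exact fun p _ => (bitArray_le_one _ _).trans (by omega)
    · exact fun p _ q _ h => h
    · intro s'' hw
      refine ⟨⟨fun a ha5 ha8 ha9 => by rw [hw.of_ne ha9 ha5, hs a ha5 ha8 ha9], est', ?_, ?_⟩, ?_⟩
      · funext j
        rw [hw.eq_ite j]
        split_ifs with h
        · rfl
        · rw [hs5, bitArray_of_le _ (by omega), bitArray_of_le _ (by omega)]
      · rw [Function.iterate_succ_apply', ← hest]
        funext j
        simp only [hest', flipAll, Pi.add_apply]
        ring
      · rw [hw.of_ne (by decide) (by decide), h8]
  · refine ⟨fun _ _ _ _ => rfl, 0, ?_, ?_⟩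
    · rw [h5]
      funext j
      simp [bitArray]
    · rw [add_zero]
      rfl

/-- The estimated error in array `5`. -/
def estimate (B : ℕ) (s : Mem) : Fin B → ZMod 2 := fun j => (s 5 j : ZMod 2)

theorem estimate_eq {s : Mem} {est : Fin B → ZMod 2} (h : s 5 = bitArray est) :
    estimate B s = est := by
  funext j
  rw [estimate, h, bitArray_val, ZMod.natCast_zmod_val]

/-- The invariant of sequential bit flipping: `x` is the error, `s₀` the initial memory. -/
structure FlipInvariant (H : Matrix (Fin m) (Fin B) (ZMod 2)) (x : Fin B → ZMod 2) (t C : ℕ)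
    (s₀ s : Mem) : Prop where
  frame : ∀ a, a ≠ 5 → a ≠ 7 → a ≠ 8 → a ≠ 9 → s a = s₀ a
  bits : s 5 = bitArray (estimate B s)
  stack_le : ∀ i < s 8 0, s 7 i ≤ B
  stack_complete : ∀ j : Fin B, 16 < unsatDeg H (x + estimate B s) j → ∃ i < s 8 0, s 7 i = j
  potential : s 8 0 + 4097 * (unsat H (x + estimate B s)).card ≤ C
  weight : (supp x).card ≤ t → (supp (x + estimate B s)).card ≤ 2 * t ∧
    (unsat H (x + estimate B s)).card ≤ 32 * t

/-- The potential is the stack height plus `4097` times the number of violated checks. A flip pops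
one variable, pushes 4096 and loses at least one violated check; without a flip only the pop
remains. So the potential drops in both cases, whatever the weight of the error. -/
theorem Run.flipStep {W n L : ℕ} {s₀ s : Mem} {x : Fin B → ZMod 2} {e t C : ℕ}
    (hH : Expands H e) (ht : 2 * t ≤ e) (hrow : ∀ c, (varsOf H c).card ≤ 128)
    (hBW : B ≤ W) (hCW : C ≤ W) (hW : 4096 ≤ W) (h0 : IsTable H n L (s₀ 0))
    (h1 : s₀ 1 = bitArray (H.mulVec x)) (hI : FlipInvariant H x t C s₀ s) (hpos : s 8 0 ≠ 0) :
    Run W 1 PCCSS.flipStep s 12300 fun s' => FlipInvariant H x t C s₀ s' ∧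
      s' 8 0 + 4097 * (unsat H (x + estimate B s')).card <
        s 8 0 + 4097 * (unsat H (x + estimate B s)).card := by
  obtain ⟨hframe, hbits, hle, hcomplete, hpot, hwt⟩ := hI
  set est := estimate B s with hest
  set k := s 8 0 - 1 with hk
  set v := s 7 k with hv
  have hvB : v ≤ B := hle k (by omega)
  -- The 4096 pushes cost `3 * 4096 + 2 = 12290` steps; the rest is single assignments, the branch
  -- and some slack.
  have time : 12300 = 1 + (1 + (12297 + 1)) := rfl
  rw [time]
  refine Run.seq (Q := fun s₁ => s₁ = s.set 8 0 k)
    (Run.assign le_rfl (Nat.zero_le _) (show k ≤ W by omega) rfl) ?_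
  rintro _ rfl
  refine Run.seq (Q := fun s₂ => s₂ = (s.set 8 0 k).set 8 1 v) ?_ ?_
  · have h7 : (Expr.read 7 heightExpr).eval (s.set 8 0 k) 0 = v := by
      simp only [heightExpr, Expr.eval, Mem.set_same]
      rw [Mem.set_of_ne (by decide)]
    refine Run.assign le_rfl (by simp only [Expr.eval]; omega) ?_ ?_
    · rw [h7]
      exact hvB.trans hBW
    · rw [h7]
      rfl
  rintro _ rfl
  set s₂ := (s.set 8 0 k).set 8 1 v with hs₂
  have hs₂a : ∀ a, a ≠ 8 → s₂ a = s a := fun a ha => by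
    rw [hs₂, Mem.set_of_ne ha, Mem.set_of_ne ha]
  have hs₂0 : s₂ 8 0 = k := by
    rw [hs₂, Mem.set_of_ne_idx (by decide), Mem.set_same]
  have hs₂1 : s₂ 8 1 = v := Mem.set_same
  have htab : IsTable H n L (s₂ 0) := by
    rw [hs₂a 0 (by decide), hframe 0 (by decide) (by decide) (by decide) (by decide)]
    exact h0
  have hsyn : s₂ 1 = bitArray (H.mulVec x) := by
    rw [hs₂a 1 (by decide), hframe 1 (by decide) (by decide) (by decide) (by decide), h1]
  have hest₂ : s₂ 5 = bitArray est := by rw [hs₂a 5 (by decide), hbits]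
  have hflip := eval_flipExpr hH.degree_le hrow htab hsyn hest₂ (v := topExpr) (p := 0)
    (w := v) hs₂1 hvB
  refine Run.ite ?_ ?_
  · intro hne
    rw [hflip] at hne
    have hex : ∃ h : v < B, 16 < unsatDeg H (x + est) ⟨v, h⟩ := by
      by_contra h
      exact hne (if_neg h)
    obtain ⟨hvlt, hdeg⟩ := hex
    set j : Fin B := ⟨v, hvlt⟩ with hj
    set est' : Fin B → ZMod 2 := est + Pi.single j 1 with hest'
    have hy : x + est' = (x + est) + Pi.single j 1 := (add_assoc _ _ _).symm
    have hunsat := card_unsat_flip_lt hH hdeg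
    rw [← hy] at hunsat
    have time : 12297 = 1 + (12290 + 1) + 5 := rfl
    rw [time]
    refine Run.mono (T := 1 + (12290 + 1)) ?_ (Nat.le_add_right _ _) (fun _ h => h)
    refine Run.seq (Q := fun s₃ => (∀ a, a ≠ 5 → s₃ a = s₂ a) ∧ s₃ 5 = bitArray est') ?_ ?_
    · refine Run.assign le_rfl ?_ ?_ ⟨?_, ?_⟩
      · simp only [topExpr, Expr.eval, hs₂1]
        omega
      · simp only [Expr.eval]
        omega
      · exact fun a ha => Mem.set_of_ne ha
      · funext i
        simp only [topExpr, Expr.eval, hs₂1]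
        have hjv : v = (j : ℕ) := rfl
        by_cases hi : i = v
        · rw [hi, Mem.set_same, hest₂, hjv, bitArray_val, bitArray_val, hest', Pi.add_apply,
            Pi.single_eq_same]
          rcases zmod_two_cases (est j) with h | h <;> rw [h] <;> decide
        · rw [Mem.set_of_ne_idx hi, hest₂]
          by_cases hiB : i < B
          · have h2 := bitArray_val est ⟨i, hiB⟩
            have h3 := bitArray_val est' ⟨i, hiB⟩
            simp only at h2 h3
            rw [h2, h3, hest', Pi.add_apply, Pi.single_eq_of_ne, add_zero]
            intro h
            exact hi (congrArg Fin.val h)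
          · rw [bitArray_of_le _ (by omega), bitArray_of_le _ (by omega)]
    rintro s₃ ⟨hs₃, hs₃5⟩
    have hs₃0 : s₃ 8 0 = k := by rw [hs₃ 8 (by decide), hs₂0]
    have hs₃1 : s₃ 8 1 = v := by rw [hs₃ 8 (by decide), hs₂1]
    have htab₃ : s₃ 0 = s₂ 0 := hs₃ 0 (by decide)
    have hs₃7 : s₃ 7 = s 7 := by rw [hs₃ 7 (by decide), hs₂a 7 (by decide)]
    set V : ℕ → ℕ := fun r => s₂ 0 (4 * (v * 4096 + r) + 3) with hV
    have hVvar : ∀ i < 32, ∀ l < 128, V (i * 128 + l) = varAt H (checkAt H v i) l :=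
      fun i hi l hl => htab.var v hvB i hi l hl
    have hVle : ∀ r < 4096, V r ≤ B := by
      intro r hr
      have : r = r / 128 * 128 + r % 128 := by omega
      rw [this, hVvar _ (by omega) _ (by omega)]
      exact varAt_le _ _ _
    refine Run.seq (Q := Written 7 4096 (fun r => k + r) V s₃)
      (Run.forAll false (n := 4096) _ _ le_rfl (by simp) hW (by decide) ?_ ?_ ?_ ?_ ?_) ?_
    · exact fun _ _ => rfl
    · intro r _ s' hs' _
      have h8 : s' 8 = s₃ 8 := hs' 8 (by decide) (by decide)
      have h0' : s' 0 = s₃ 0 := hs' 0 (by decide) (by decide)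
      constructor
      · simp only [heightExpr, Expr.eval, h8, hs₃0]
      · rw [eval_tableExpr]
        simp only [topExpr, Expr.eval, h8, hs₃1, h0', htab₃, hV]
    · intro r hr
      omega
    · exact fun r hr => (hVle r hr).trans hBW
    · intro r _ r' _ h
      exact Nat.add_left_cancel h
    rintro s₄ ⟨hs₄, hs₄w, hs₄u⟩
    have h8 : s₄ 8 = s₃ 8 := hs₄ 8 (by decide) (by decide)
    have heval : (Expr.add heightExpr (Expr.const 4096)).eval s₄ 0 = k + 4096 := by
      simp only [heightExpr, Expr.eval, h8, hs₃0]
    refine Run.assign le_rfl (Nat.zero_le _) ?_ ?_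
    · rw [heval]
      omega
    · rw [heval]
      set s₅ := s₄.set 8 ((Expr.const 0).eval s₄ 0) (k + 4096) with hs₅
      have hs₅0 : s₅ 8 0 = k + 4096 := Mem.set_same
      have hs₅5 : s₅ 5 = bitArray est' := by
        rw [hs₅, Mem.set_of_ne (by decide), hs₄ 5 (by decide) (by decide), hs₃5]
      have hs₅7 : s₅ 7 = s₄ 7 := Mem.set_of_ne (by decide)
      have hest₅ : estimate B s₅ = est' := estimate_eq hs₅5
      refine ⟨⟨?_, ?_, ?_, ?_, ?_, ?_⟩, ?_⟩
      · intro a ha5 ha7 ha8 ha9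
        rw [hs₅, Mem.set_of_ne ha8, hs₄ a ha9 ha7, hs₃ a ha5, hs₂a a ha8, hframe a ha5 ha7 ha8 ha9]
      · rw [hest₅, hs₅5]
      · rw [hs₅0, hs₅7]
        intro i hi
        by_cases hik : i < k
        · rw [hs₄u i fun r _ (h : i = k + r) => by omega, hs₃7]
          exact hle i (by omega)
        · have : i = k + (i - k) := by omega
          rw [this, hs₄w (i - k) (by omega)]
          exact hVle _ (by omega)
      · rw [hest₅, hs₅0, hs₅7]
        intro l hl
        -- A flippable variable without a check in common with `j` was flippable before, hence is on
        -- the stack below the popped cell; every other one has just been pushed.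
        by_cases hdis : Disjoint (checksOf H l) (checksOf H j)
        · rw [hy, unsatDeg_flip_of_disjoint hdis] at hl
          obtain ⟨i, hi, hil⟩ := hcomplete l hl
          have hik : i ≠ k := by
            rintro rfl
            have hlj : l = j := Fin.ext hil.symm
            rw [hlj, disjoint_self_iff_empty] at hdis
            simp [unsatDeg, hdis] at hdeg
          refine ⟨i, by omega, ?_⟩
          rw [hs₄u i fun r _ (h : i = k + r) => by omega, hs₃7, hil]
        · obtain ⟨i, hi, r, hr, hir⟩ := exists_varAt_checkAt_eq hH.degree_le hrow hdis
          refine ⟨k + (i * 128 + r), by omega, ?_⟩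
          rw [hs₄w _ (by omega), hVvar i hi r hr]
          exact hir
      · rw [hest₅, hs₅0]
        omega
      · rw [hest₅]
        intro hx
        rw [hy]
        exact flip_invariant hH ht (hwt hx) hdeg
      · rw [hest₅, hs₅0]
        omega
  · intro heq
    rw [hflip] at heq
    have hnex : ¬ ∃ h : v < B, 16 < unsatDeg H (x + est) ⟨v, h⟩ := by
      intro h
      rw [if_pos h] at heq
      exact one_ne_zero heq
    refine (Run.skip (Q := fun s' => s' = s₂) rfl).mono (by decide) ?_
    rintro _ rfl
    have hest₂' : estimate B s₂ = est := estimate_eq hest₂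
    refine ⟨⟨?_, ?_, ?_, ?_, ?_, ?_⟩, ?_⟩
    · intro a ha5 ha7 ha8 ha9
      rw [hs₂a a ha8, hframe a ha5 ha7 ha8 ha9]
    · rw [hest₂', hest₂]
    · rw [hs₂0, hs₂a 7 (by decide)]
      exact fun i hi => hle i (by omega)
    · rw [hest₂', hs₂0, hs₂a 7 (by decide)]
      intro l hl
      obtain ⟨i, hi, hil⟩ := hcomplete l hl
      -- The popped variable is not flippable, so removing it loses no candidate.
      have hik : i ≠ k := by
        rintro rfl
        have hvl : v = l := hil
        refine hnex ⟨hvl ▸ l.isLt, ?_⟩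
        have : (⟨v, hvl ▸ l.isLt⟩ : Fin B) = l := Fin.ext hvl
        rwa [this]
      exact ⟨i, by omega, hil⟩
    · rw [hest₂', hs₂0]
      omega
    · rw [hest₂']
      exact hwt
    · rw [hest₂', hs₂0]
      omega

/-- All variables start on the stack, and the potential is at most `B + 4097 * m`, so the loop takes
linear time. Once the stack is empty nothing is flippable; since the residual has weight at most `2
* t ≤ e`, `exists_flippable` makes it zero. -/
theorem Run.decodeOuterSequential {W n L : ℕ} {s : Mem} {x : Fin B → ZMod 2} {e t : ℕ}
    (hH : Expands H e) (ht : 2 * t ≤ e) (hrow : ∀ c, (varsOf H c).card ≤ 128)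
    (hW : 4096 + B + 4097 * m ≤ W) (h0 : IsTable H n L (s 0))
    (h1 : s 1 = bitArray (H.mulVec x)) (h5 : s 5 = fun _ => 0) :
    Run W 1 PCCSS.decodeOuterSequential s
      ((3 * B + 2) + (1 + (12301 * (B + 4097 * m) + 1))) fun s' =>
      (∀ a, a ≠ 5 → a ≠ 7 → a ≠ 8 → a ≠ 9 → s' a = s a) ∧
        ∃ est, s' 5 = bitArray est ∧ ((supp x).card ≤ t → x + est = 0) := by
  have hB : ∀ s' : Mem, s' 0 = s 0 → blocksExpr.eval s' 0 = B := by
    intro s' hs'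
    rw [blocksExpr, Expr.eval, hs']
    exact h0.blocks
  refine Run.seq (Run.forAll false (n := B) id id le_rfl (by simp) (by omega) (by decide)
    ?_ ?_ ?_ ?_ ?_) ?_
  · exact fun s' hs' => hB s' (hs' 0 (by decide) (by decide))
  · exact fun p _ s' _ _ => ⟨rfl, rfl⟩
  · exact fun p hp => (le_of_lt hp).trans (by omega)
  · exact fun p hp => (le_of_lt hp).trans (by omega)
  · exact fun p _ q _ h => h
  intro s₁ hw
  have hs₁ : blocksExpr.eval s₁ 0 = B := hB s₁ (hw.of_ne (by decide) (by decide))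
  refine Run.seq (Q := fun s₂ => s₂ = s₁.set 8 0 B) ?_ ?_
  · refine Run.assign le_rfl (Nat.zero_le _) ?_ ?_
    · rw [hs₁]
      omega
    · rw [hs₁]
      rfl
  rintro _ rfl
  set s₂ := s₁.set 8 0 B with hs₂
  have hs₂0 : s₂ 8 0 = B := Mem.set_same
  have hs₂5 : s₂ 5 = bitArray (0 : Fin B → ZMod 2) := by
    rw [hs₂, Mem.set_of_ne (by decide), hw.of_ne (by decide) (by decide), h5]
    funext j
    simp [bitArray]
  have hs₂7 : ∀ i < B, s₂ 7 i = i := by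
    intro i hi
    rw [hs₂, Mem.set_of_ne (by decide), hw.eq_ite i, if_pos hi]
    rfl
  have hest : estimate B s₂ = 0 := estimate_eq hs₂5
  have hcard : (unsat H x).card ≤ m := by simpa using (unsat H x).card_le_univ
  have hI : FlipInvariant H x t (B + 4097 * m) s s₂ := by
    refine ⟨?_, ?_, ?_, ?_, ?_, ?_⟩
    · intro a _ ha7 ha8 ha9
      rw [hs₂, Mem.set_of_ne ha8, hw.of_ne ha9 ha7]
    · rw [hest, hs₂5]
    · rw [hs₂0]
      intro i hi
      rw [hs₂7 i hi]
      exact hi.le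
    · rw [hs₂0]
      exact fun j _ => ⟨j, j.isLt, hs₂7 j j.isLt⟩
    · rw [hest, hs₂0, add_zero]
      omega
    · rw [hest, add_zero]
      intro hx
      have := card_unsat_le hH x
      omega
  have hloop := Run.loop (W := W) (P := 1) (e := Expr.lt (Expr.const 0) heightExpr)
    (c := PCCSS.flipStep) (FlipInvariant H x t (B + 4097 * m) s)
    (fun s' => s' 8 0 + 4097 * (unsat H (x + estimate B s')).card) (τ := 12300)
    (fun s' hs' hne => Run.flipStep hH ht hrow (by omega) (by omega) (by omega) h0 h1 hs' (by
      intro h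
      simp [heightExpr, Expr.eval, h] at hne)) hI
  refine hloop.mono ?_ ?_
  · rw [hest, hs₂0, add_zero]
    have := Nat.mul_le_mul_left 12301 (show B + 4097 * (unsat H x).card ≤ B + 4097 * m by omega)
    omega
  · rintro s' ⟨hI', hend⟩
    refine ⟨hI'.frame, estimate B s', hI'.bits, fun hx => ?_⟩
    by_contra hne
    obtain ⟨j, hj⟩ := exists_flippable hH ((hI'.weight hx).1.trans ht) hne
    obtain ⟨i, hi, -⟩ := hI'.stack_complete j hj
    have : (0 : ℕ) < s' 8 0 := by omega
    simp [heightExpr, Expr.eval, this] at hend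

/-- Only the block parities of the output matter, so one entry per block is written; the others keep
their initial zeros. -/
theorem Run.writeOuter {W P n : ℕ} (parallel : Bool) {s : Mem} {est : Fin B → ZMod 2} (hP : 1 ≤ P)
    (hBP : parallel = true → B ≤ P) (hn : 0 < n) (hW : B * n ≤ W) (hW1 : 1 ≤ W) (h0 : s 0 0 = B)
    (h4 : s 0 4 = n) (h3 : s 3 = fun _ => 0) (h5 : s 5 = bitArray est) :
    Run W P (PCCSS.writeOuter parallel) s (forAllTime parallel B) fun s' =>
      (∀ a, a ≠ 3 → a ≠ 9 → s' a = s a) ∧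
        output (B := B) (n := n) s' 3 = firstInBlock hn est := by
  have hBn : B ≤ B * n := Nat.le_mul_of_pos_right B hn
  refine (Run.forAll parallel (n := B) (fun b => b * n) (bitArray est) hP hBP (by omega)
    (by decide) ?_ ?_ ?_ ?_ ?_).mono le_rfl ?_
  · intro s' hs'
    rw [blocksExpr, Expr.eval, hs' 0 (by decide) (by decide)]
    exact h0
  · intro p _ s' hs' _
    constructor
    · simp only [lengthExpr, Expr.eval]
      rw [hs' 0 (by decide) (by decide), h4]
    · simp only [Expr.eval]
      rw [hs' 5 (by decide) (by decide), h5]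
  · exact fun p hp => (Nat.mul_le_mul_right n hp.le).trans hW
  · exact fun p _ => (bitArray_le_one _ _).trans hW1
  · exact fun p _ q _ h => Nat.eq_of_mul_eq_mul_right hn h
  · intro s' hw
    refine ⟨fun a ha3 ha9 => hw.of_ne ha9 ha3, ?_⟩
    funext ⟨b, j⟩
    simp only [output, firstInBlock]
    by_cases hj : j = ⟨0, hn⟩
    · rw [if_pos hj, hj, add_zero, hw.2.1 b b.isLt, bitArray_val, ZMod.natCast_zmod_val]
    · rw [if_neg hj, hw.2.2, h3, Nat.cast_zero]
      intro p _ h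
      have h1 : (b.val * n + j.val) % n = (p * n) % n := by rw [h]
      rw [Nat.mul_add_mod_self_right, Nat.mul_mod_left, Nat.mod_eq_of_lt j.isLt] at h1
      exact hj (Fin.ext h1)

end Outer

/-! ### The decoders -/

/-- The sequential decoder. -/
def sequentialDecoder : Cmd :=
  Cmd.seq (decodeInner false) (Cmd.seq decodeOuterSequential (writeOuter false))

/-- The parallel decoder. -/
def parallelDecoder : Cmd :=
  Cmd.seq (decodeInner true) (Cmd.seq decodeOuterParallel (writeOuter true))

section Decoders

variable {m B n : ℕ} {H : Matrix (Fin m) (Fin B) (ZMod 2)}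

theorem blockParity_add (v w : Fin B × Fin n → ZMod 2) :
    blockParity (v + w) = blockParity v + blockParity w :=
  funext fun _ => sum_add_distrib

theorem add_output_mem_of_outer (hn : 0 < n) {eZ : Fin B × Fin n → ZMod 2} {s : Mem}
    {est : Fin B → ZMod 2} (hs : output (B := B) (n := n) s 3 = firstInBlock hn est)
    (h : blockParity eZ + est = 0) :
    eZ + output s 3 ∈ dualCode (codeOf (innerCheck B n)) := by
  rw [mem_dualCode_innerCheck hn, hs, blockParity_add, blockParity_firstInBlock, h]

/-- Here the error is recovered exactly, not merely up to stabilizers. -/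
theorem add_output_mem_of_inner (hn : 0 < n) {eX : Fin B × Fin n → ZMod 2} {s : Mem}
    (hs : ∀ b < B, ∀ j < n, s 4 (b * n + j) =
      innerEstimate n (bitArray₂ ((innerCheck B n).mulVec eX)) b j)
    (h : hammingNorm eX ≤ (n - 1) / 2) : eX + output s 4 ∈ dualCode (codeOf (pcX n H)) := by
  have : eX + output s 4 = 0 := by
    funext ⟨b, j⟩
    rw [Pi.add_apply, output, hs b b.isLt j j.isLt, innerEstimate_correct hn h,
      CharTwo.add_self_eq_zero, Pi.zero_apply]
  rw [this]
  exact Submodule.zero_mem _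

theorem bitArray₂_le_one (f : Fin B × Fin n → ZMod 2) (i : ℕ) : bitArray₂ f i ≤ 1 :=
  bitArray_le_one _ i

theorem decodesWithin_sequentialDecoder {d : ℕ} (hH : Expands H (d - 1))
    (hrow : ∀ c, (varsOf H c).card ≤ 128) (hm : m ≤ B) (hB : 1 ≤ B) (hn : 1 < n) :
    DecodesWithin n H sequentialDecoder ((d - 1) / 2) ((n - 1) / 2) (10 ^ 8 * (B * n))
      ((10 ^ 8 : ℕ) * (B * n : ℕ)) 1 := by
  have hBn : B * 2 ≤ B * n := Nat.mul_le_mul_left B hn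
  have hnB : n ≤ B * n := Nat.le_mul_of_pos_left n hB
  -- The sequential decoder does not read the number of rounds, so `0` is stored.
  obtain ⟨table, hlen, hent, htab⟩ := exists_table H n 0
  refine ⟨table, by omega, fun a ha => (hent a ha).trans (by omega), fun eZ eX => ?_⟩
  set s := initMem table (bitArray ((pcX n H).mulVec eZ))
    (bitArray₂ ((innerCheck B n).mulVec eX)) with hs
  have hs1 : s 1 = bitArray (H.mulVec (blockParity eZ)) := by rw [← pcX_mulVec]; rfl
  have hrun : Run (10 ^ 8 * (B * n)) 1 sequentialDecoder s
      (((forAllTime false B + 2) * n + 2 + ((forAllTime false B + 2) * n + 2)) +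
        (((3 * B + 2) + (1 + (12301 * (B + 4097 * m) + 1))) + forAllTime false B)) fun s' =>
      (hammingNorm eZ ≤ (d - 1) / 2 → eZ + output s' 3 ∈ dualCode (codeOf (innerCheck B n))) ∧
        (hammingNorm eX ≤ (n - 1) / 2 → eX + output s' 4 ∈ dualCode (codeOf (pcX n H))) := by
    refine Run.seq (Run.decodeInner false le_rfl (by simp) hB hn (by omega) htab.blocks htab.length
      (f := bitArray₂ ((innerCheck B n).mulVec eX)) rfl (bitArray₂_le_one _) rfl) ?_
    rintro s₁ ⟨hs₁, hs₁4⟩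
    have hs₁0 : s₁ 0 = s 0 := hs₁ 0 (by decide) (by decide) (by decide) (by decide)
    refine Run.seq (Run.decodeOuterSequential (x := blockParity eZ) (t := (d - 1) / 2) hH
      (by omega) hrow (by omega) (n := n) (L := 0) (by rw [hs₁0]; exact htab)
      ((hs₁ 1 (by decide) (by decide) (by decide) (by decide)).trans hs1)
      (hs₁ 5 (by decide) (by decide) (by decide) (by decide))) ?_
    rintro s₂ ⟨hs₂, est, hest, hcorrect⟩
    have hs₂0 : s₂ 0 = s 0 := (hs₂ 0 (by decide) (by decide) (by decide) (by decide)).trans hs₁0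
    refine (Run.writeOuter (n := n) false le_rfl (by simp) (by omega) (by omega) (by omega)
      (by rw [hs₂0]; exact htab.blocks) (by rw [hs₂0]; exact htab.length)
      ((hs₂ 3 (by decide) (by decide) (by decide) (by decide)).trans
        (hs₁ 3 (by decide) (by decide) (by decide) (by decide))) hest).mono le_rfl ?_
    rintro s₃ ⟨hs₃, hout⟩
    refine ⟨fun h => add_output_mem_of_outer (by omega) hout
      (hcorrect ((hammingNorm_blockParity_le eZ).trans h)),
      fun h => add_output_mem_of_inner (by omega) ?_ h⟩
    rw [hs₃ 4 (by decide) (by decide), hs₂ 4 (by decide) (by decide) (by decide) (by decide)]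
    exact hs₁4
  obtain ⟨t, s', ht, hexec, hcorrect⟩ := hrun
  refine ⟨1, t, s', by simp, ?_, hexec, hcorrect⟩
  -- The dominant cost is `12301 * 4097 * m`, about `5 * 10 ^ 7 * m` with `m ≤ B`; this explains the
  -- constant `10 ^ 8`.
  rw [← Nat.cast_mul]
  refine Nat.cast_le.2 (ht.trans ?_)
  have h1 : (forAllTime false B + 2) * n = 3 * (B * n) + 4 * n := by
    simp only [forAllTime, Bool.false_eq_true, if_false]
    ring
  rw [h1]
  simp only [forAllTime, Bool.false_eq_true, if_false]
  omega

/-- This is the change of base, with `1 / log 2 < 2`. -/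
theorem natLog_two_le (hB : 1 ≤ B) : (Nat.log 2 B : ℝ) ≤ 2 * Real.log B := by
  have h1 : (Nat.log 2 B : ℝ) ≤ Real.logb 2 B := by
    simpa using Real.natLog_le_logb B 2
  have h2 : (0 : ℝ) ≤ Real.log B := Real.log_nonneg (by exact_mod_cast hB)
  have h3 := Real.log_two_gt_d9
  refine h1.trans ?_
  rw [Real.logb, div_le_iff₀ (by linarith)]
  nlinarith

theorem decodesWithin_parallelDecoder {d : ℕ} (hH : Expands H (d - 1))
    (hrow : ∀ c, (varsOf H c).card ≤ 128) (hm : m ≤ B) (hB : 1 ≤ B) (hn : 1 < n) :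
    DecodesWithin n H parallelDecoder ((d - 1) / 2) ((n - 1) / 2) (10 ^ 8 * (B * n))
      ((10 ^ 8 : ℕ) * (Real.log B + n)) ((10 ^ 8 : ℕ) * (B + B * Real.log B)) := by
  have hBn : B * 2 ≤ B * n := Nat.mul_le_mul_left B hn
  have hnB : n ≤ B * n := Nat.le_mul_of_pos_left n hB
  -- With `B < 2 ^ L`, halving the weight `L` times leaves nothing.
  set L := Nat.log 2 B + 1 with hL
  have hLB : L ≤ B + 1 := Nat.add_le_add_right (Nat.log_le_self 2 B) 1
  have hBL : B < 2 ^ L := Nat.lt_pow_succ_log_self (by norm_num) B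
  have hlog0 : (0 : ℝ) ≤ Real.log B := Real.log_nonneg (by exact_mod_cast hB)
  obtain ⟨table, hlen, hent, htab⟩ := exists_table H n L
  refine ⟨table, by omega, fun a ha => (hent a ha).trans (by omega), fun eZ eX => ?_⟩
  set s := initMem table (bitArray ((pcX n H).mulVec eZ))
    (bitArray₂ ((innerCheck B n).mulVec eX)) with hs
  have hs1 : s 1 = bitArray (H.mulVec (blockParity eZ)) := by rw [← pcX_mulVec]; rfl
  have hrun : Run (10 ^ 8 * (B * n)) B parallelDecoder s
      (((forAllTime true B + 2) * n + 2 + ((forAllTime true B + 2) * n + 2)) +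
        (((1 + 2) * L + 2) + forAllTime true B)) fun s' =>
      (hammingNorm eZ ≤ (d - 1) / 2 → eZ + output s' 3 ∈ dualCode (codeOf (innerCheck B n))) ∧
        (hammingNorm eX ≤ (n - 1) / 2 → eX + output s' 4 ∈ dualCode (codeOf (pcX n H))) := by
    refine Run.seq (Run.decodeInner true hB (fun _ => le_rfl) hB hn (by omega) htab.blocks
      htab.length (f := bitArray₂ ((innerCheck B n).mulVec eX)) rfl (bitArray₂_le_one _) rfl) ?_
    rintro s₁ ⟨hs₁, hs₁4⟩
    have hs₁0 : s₁ 0 = s 0 := hs₁ 0 (by decide) (by decide) (by decide) (by decide)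
    refine Run.seq (Run.decodeOuterParallel (x := blockParity eZ) hH hrow hB le_rfl
      (by omega) (by omega) (n := n) (L := L) (by rw [hs₁0]; exact htab)
      ((hs₁ 1 (by decide) (by decide) (by decide) (by decide)).trans hs1)
      (hs₁ 5 (by decide) (by decide) (by decide) (by decide))) ?_
    rintro s₂ ⟨hs₂, est, hest, hcorrect⟩
    have hs₂0 : s₂ 0 = s 0 := (hs₂ 0 (by decide) (by decide) (by decide)).trans hs₁0
    refine (Run.writeOuter (n := n) true hB (fun _ => le_rfl) (by omega) (by omega) (by omega)
      (by rw [hs₂0]; exact htab.blocks) (by rw [hs₂0]; exact htab.length)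
      ((hs₂ 3 (by decide) (by decide) (by decide)).trans
        (hs₁ 3 (by decide) (by decide) (by decide) (by decide))) hest).mono le_rfl ?_
    rintro s₃ ⟨hs₃, hout⟩
    refine ⟨fun h => add_output_mem_of_outer (by omega) hout ?_,
      fun h => add_output_mem_of_inner (by omega) ?_ h⟩
    · have hw : (supp (blockParity eZ)).card ≤ (d - 1) / 2 :=
        (hammingNorm_blockParity_le eZ).trans h
      rw [hcorrect]
      exact iterate_flipAll_eq_zero hH (by omega) hBL
    · rw [hs₃ 4 (by decide) (by decide), hs₂ 4 (by decide) (by decide) (by decide)]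
      exact hs₁4
  obtain ⟨t, s', ht, hexec, hcorrect⟩ := hrun
  refine ⟨B, t, s', ?_, ?_, hexec, hcorrect⟩
  · have : (0 : ℝ) ≤ B * Real.log B := mul_nonneg (Nat.cast_nonneg B) hlog0
    have : (0 : ℝ) ≤ B := Nat.cast_nonneg B
    push_cast
    linarith
  · have h1 : t ≤ 6 * n + 3 * Nat.log 2 B + 10 := by
      simp only [forAllTime, if_true] at ht
      omega
    have h2 : (t : ℝ) ≤ 6 * n + 3 * Nat.log 2 B + 10 := by exact_mod_cast h1
    have h3 := natLog_two_le hB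
    have h4 : (1 : ℝ) ≤ n := by exact_mod_cast hn.le
    push_cast
    linarith

end Decoders

/-! ### Outer codes of all lengths -/

/-- Here `15 / 16 * 32 = 30`. -/
theorem expands_of_isExpanderCheckMatrix {m B : ℕ} {H : Matrix (Fin m) (Fin B) (ZMod 2)}
    {Δ : ℕ} {α : ℝ} (h : IsExpanderCheckMatrix H 32 Δ α (15 / 16)) {e : ℕ} (he : (e : ℝ) ≤ α * B) :
    Expands H e := by
  refine ⟨fun j => (h.variableDegree j).le, fun S hS => ?_⟩
  have h1 := h.expansion S ((Nat.cast_le.2 hS).trans he)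
  have h2 : (30 * S.card : ℝ) ≤ ((S.biUnion (checksOf H)).card : ℝ) := by
    refine le_trans (le_of_eq ?_) h1
    push_cast
    ring
  exact_mod_cast h2

/-- `d` exceeds by one the size up to which sets expand, since nonzero codewords are heavier than
that size. Below length 128 the matrix without rows serves, with `d = 1`; there `expFrac * B ≤ 1`.
-/
theorem exists_outer_code {B : ℕ} (hB : 1 ≤ B) :
    ∃ (m d : ℕ) (H : Matrix (Fin m) (Fin B) (ZMod 2)),
      (128 ≤ B → IsExpanderCheckMatrix H 32 128 expFrac (15 / 16)) ∧
        Expands H (d - 1) ∧ (∀ c, (varsOf H c).card ≤ 128) ∧ 2 * m ≤ B ∧ 0 < d ∧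
          expFrac * B ≤ d := by
  by_cases h : 128 ≤ B
  · obtain ⟨m, H, hexp, hm⟩ := exists_expander_code h
    refine ⟨m, ⌊expFrac * B⌋₊ + 1, H, fun _ => hexp, ?_, hexp.checkDegree, hm, Nat.succ_pos _, ?_⟩
    · exact expands_of_isExpanderCheckMatrix hexp
        (Nat.floor_le (mul_nonneg expFrac_pos.le (Nat.cast_nonneg B)))
    · push_cast
      exact (Nat.lt_floor_add_one _).le
  · refine ⟨0, 1, Matrix.of fun i => i.elim0, fun h' => absurd h' h, ⟨fun j => ?_, fun S hS => ?_⟩,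
      fun c => c.elim0, by omega, one_pos, ?_⟩
    · simp [checksOf]
    · have : S.card = 0 := by omega
      omega
    · have h1 : (B : ℝ) ≤ 128 := by exact_mod_cast (by omega : B ≤ 128)
      have h2 : expFrac ≤ 1 / 128 := by unfold expFrac; norm_num
      have := expFrac_pos
      push_cast
      nlinarith

end PCCSS

/-! ### The main theorem -/

theorem theorem2 :
    ∃ (c : ℝ) (K M D Δ : ℕ) (α β : ℝ) (seqDec parDec : PCCSS.Cmd),
      0 < c ∧ 0 < D ∧ 0 < α ∧ 3 / 4 < β ∧
      ∀ n₀ N : ℕ, 1 < n₀ → 1 < N → n₀ ∣ N →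
        ∃ (m k d : ℕ) (H₂ : Matrix (Fin m) (Fin (N / n₀)) (ZMod 2)),
          -- the outer code is an asymptotically good expander code of dimension `k`
          (M ≤ N / n₀ → PCCSS.IsExpanderCheckMatrix H₂ D Δ α β) ∧
          Module.finrank (ZMod 2) (PCCSS.codeOf H₂) = k ∧
          (∀ x ∈ PCCSS.codeOf H₂, x ≠ 0 → d ≤ hammingNorm x) ∧
          -- parameters of the quantum code
          PCCSS.pcX n₀ H₂ * (PCCSS.innerCheck (N / n₀) n₀).transpose = 0 ∧
          Fintype.card (Fin (N / n₀) × Fin n₀) = N ∧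
          Module.finrank ℂ
            (PCCSS.cssSpace (PCCSS.pcX n₀ H₂) (PCCSS.innerCheck (N / n₀) n₀)) = 2 ^ k ∧
          c * (N / n₀ : ℕ) ≤ k ∧
          c * (N / n₀ : ℕ) ≤ d ∧
          d ≤ PCCSS.minWeightOutside (PCCSS.codeOf (PCCSS.pcX n₀ H₂))
            (PCCSS.dualCode (PCCSS.codeOf (PCCSS.innerCheck (N / n₀) n₀))) ∧
          n₀ ≤ PCCSS.minWeightOutside (PCCSS.codeOf (PCCSS.innerCheck (N / n₀) n₀))
            (PCCSS.dualCode (PCCSS.codeOf (PCCSS.pcX n₀ H₂))) ∧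
          -- sequential syndrome decoding
          PCCSS.DecodesWithin n₀ H₂ seqDec ((d - 1) / 2) ((n₀ - 1) / 2) (K * N) (K * N) 1 ∧
          -- parallel syndrome decoding
          PCCSS.DecodesWithin n₀ H₂ parDec ((d - 1) / 2) ((n₀ - 1) / 2) (K * N)
            (K * (Real.log (N / n₀ : ℕ) + n₀))
            (K * ((N / n₀ : ℕ) + (N / n₀ : ℕ) * Real.log (N / n₀ : ℕ))) ∧
          -- encoding
          ∃ C : PCCSS.Circuit (Fin (N / n₀) × Fin n₀),
            C.Encodes k
              (PCCSS.cssSpace (PCCSS.pcX n₀ H₂) (PCCSS.innerCheck (N / n₀) n₀)) ∧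
            C.size ≤ K * ((N / n₀) ^ 2 + N) ∧
            C.depth ≤ K * (N / n₀ + n₀) := by
  refine ⟨PCCSS.expFrac, 10 ^ 8, 128, 32, 128, PCCSS.expFrac, 15 / 16, PCCSS.sequentialDecoder,
    PCCSS.parallelDecoder, PCCSS.expFrac_pos, by norm_num, PCCSS.expFrac_pos, by norm_num, ?_⟩
  intro n₀ N hn₀ hN hdvd
  have hBn : N / n₀ * n₀ = N := Nat.div_mul_cancel hdvd
  have hB : 1 ≤ N / n₀ := Nat.div_pos (Nat.le_of_dvd (by omega) hdvd) (by omega)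
  generalize N / n₀ = B at *
  subst hBn
  obtain ⟨m, d, H, hexp, hH, hrow, hm, hd, hcd⟩ := PCCSS.exists_outer_code hB
  have hk := PCCSS.le_finrank_codeOf_add H
  have hdist : ∀ x ∈ PCCSS.codeOf H, x ≠ 0 → d ≤ hammingNorm x := by
    intro x hx hx0
    have := PCCSS.lt_hammingNorm_of_mem_codeOf hH hx hx0
    omega
  -- The dimension is at least `B - m > 0`. Without a nonzero codeword both minimum weights would
  -- default to `0`.
  have hne : ∃ x ∈ PCCSS.codeOf H, x ≠ 0 := by
    refine Submodule.exists_mem_ne_zero_of_ne_bot fun h => ?_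
    rw [h, finrank_bot] at hk
    omega
  obtain ⟨C, hC, hsize, hdepth⟩ := PCCSS.exists_encoder (n := n₀) hB (by omega) H
  refine ⟨m, Module.finrank (ZMod 2) (PCCSS.codeOf H), d, H, hexp, rfl, hdist,
    PCCSS.pcX_mul_transpose_innerCheck H, by simp, hC.finrank_eq, ?_, hcd,
    PCCSS.le_minWeightOutside_X (by omega) hdist hne, PCCSS.le_minWeightOutside_Z (by omega) hne,
    PCCSS.decodesWithin_sequentialDecoder hH hrow (by omega) hB hn₀,
    PCCSS.decodesWithin_parallelDecoder hH hrow (by omega) hB hn₀, C, hC, ?_, ?_⟩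
  · have h1 : (B : ℝ) ≤ 2 * (Module.finrank (ZMod 2) (PCCSS.codeOf H) : ℕ) := by
      exact_mod_cast (by omega : B ≤ 2 * Module.finrank (ZMod 2) (PCCSS.codeOf H))
    have h2 : PCCSS.expFrac ≤ 1 / 2 := by
      unfold PCCSS.expFrac
      norm_num
    have h3 : PCCSS.expFrac * B ≤ 1 / 2 * B :=
      mul_le_mul_of_nonneg_right h2 (Nat.cast_nonneg B)
    linarith
  · have : B ≤ B * n₀ := Nat.le_mul_of_pos_right B (by omega)
    omega
  · omega
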